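/- Let $M$ be a (Hausdorff, $\sigma$-compact, boundaryless) smooth manifold, $E\to M$ a smooth real vector bundle of rank $n$, and $\mathcal A=\Gamma(\bigwedge E)$ the $\mathbb Z_2$-graded commutative algebra of superfunctions of the split supermanifold $(M,\bigwedge E)$. Let $\mathcal X^G(M)=\mathrm{Der}_{\mathbb R}\mathcal A$ be the left $\mathcal A$-module of supervector fields (sums of an even and an odd graded derivation), with graded commutator $[\cdot,\cdot]$. A graded $p$-form is an $\mathcal A$-multilinear (with the sign rule, left linear in the first slot), graded alternating map $\mathcal X^G(M)^p\to\mathcal A$. For homogeneous $D_i$, for a graded $1$-form $\lambda$ $$\mathbf d\lambda(D_1,D_2)=D_1(\lambda(D_2))-(-1)^{|D_1||D_2|}D_2(\lambda(D_1))-\lambda([D_1,D_2]),$$ and for a graded $2$-form $\boldsymbol\omega$ $$\begin{aligned}\mathbf d\boldsymbol\omega(D_1,D_2,D_3)={}&D_1(\boldsymbol\omega(D_2,D_3))-(-1)^{|D_1||D_2|}D_2(\boldsymbol\omega(D_1,D_3))+(-1)^{(|D_1|+|D_2|)|D_3|}D_3(\boldsymbol\omega(D_1,D_2))\\&-\boldsymbol\omega([D_1,D_2],D_3)+(-1)^{|D_2||D_3|}\boldsymbol\omega([D_1,D_3],D_2)-(-1)^{|D_1|(|D_2|+|D_3|)}\boldsymbol\omega([D_2,D_3],D_1).\end{aligned}$$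 A graded $2$-form $\boldsymbol\omega$ is a graded symplectic form if $\mathbf d\boldsymbol\omega=0$ and $D\mapsto\iota_D\boldsymbol\omega$, where $(\iota_D\boldsymbol\omega)(D')=(-1)^{|D||D'|}\boldsymbol\omega(D,D')$, is a bijection from $\mathcal X^G(M)$ to the graded $1$-forms. It is odd if $|\boldsymbol\omega(D_1,D_2)|\equiv|D_1|+|D_2|+1 \pmod 2$. Let $\nabla$ be a smooth linear connection on $E$. For a vector field $X$ let $\nabla_X$ also denote its extension to an even derivation of $\mathcal A$ (with $\nabla_Xf=Xf$ for $f\in C^\infty(M)$), and for $\chi\in\Gamma(E^*)$ let $i_\chi$ be the odd derivation with $i_\chi f=0$ and $i_\chi\sigma=\chi(\sigma)$ for $\sigma\in\Gamma(E)$. A triple of data $(\tilde\omega,K,L)$ consists of a closed ordinary $2$-form $\tilde\omega$ on $M$, tensor fields $K_k\in\Gamma(T^*M\otimes\bigwedge^kE)$ for $1\le k\le n$, and tensor fields $L_k\in\Gamma(E\otimes\bigwedge^{k-1}E)$ for $2\le k\le n+1$ whose total antisymmetrization in $\bigwedge^kE$ vanishes (for $k=2$: $L_2$ is symmetric). It represents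 the graded $2$-form $\boldsymbol\omega$ with respect to $\nabla$ if $\boldsymbol\omega=\pi^*\tilde\omega+\mathbf d\lambda$, where $\pi^*\tilde\omega$ is the pullback of $\tilde\omega$ along the projection $(M,\bigwedge E)\to M$ and $\lambda$ is the graded $1$-form with $$\lambda(\nabla_X)=\sum_{k=1}^nK_k(X),\qquad \lambda(i_\chi)=\sum_{k=2}^{n+1}L_k(\chi).$$ Let $\boldsymbol\omega$ be an odd graded symplectic form on $(M,\bigwedge E)$. Then there is exactly one triple $(\tilde\omega,K,L)$ that represents $\boldsymbol\omega$ with respect to $\nabla$, and it satisfies $\tilde\omega=0$ and $L_2=0$, and $K_1\in\Gamma(T^*M\otimes E)$ defines an isomorphism of smooth vector bundles $TM\cong E$. -/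

import Mathlib

open scoped Manifold ContDiff Topology
open Bundle

noncomputable section

namespace OddSymplectic

/-! ## Superfunctions on the split supermanifold `(M, ⋀E)` -/

section Superfunctions

variable (m n : ℕ) {M : Type*} [TopologicalSpace M] [ChartedSpace (EuclideanSpace ℝ (Fin m)) M]
  (V : M → Type*) [TopologicalSpace (TotalSpace (EuclideanSpace ℝ (Fin n)) V)]
  [∀ x, AddCommGroup (V x)] [∀ x, Module ℝ (V x)] [∀ x, TopologicalSpace (V x)]
  [FiberBundle (EuclideanSpace ℝ (Fin n)) V]

/-- Smooth sections of the bundle `V` of rank `n` over the `m`-dimensional manifold `M`. -/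
abbrev Sec : Type _ := Cₛ^∞⟮𝓡 m; EuclideanSpace ℝ (Fin n), V⟯

/-- Smooth vector fields on the `m`-dimensional manifold `M`. -/
abbrev VecField (M : Type*) [TopologicalSpace M] [ChartedSpace (EuclideanSpace ℝ (Fin m)) M]
    [IsManifold (𝓡 m) ∞ M] : Type _ :=
  Cₛ^∞⟮𝓡 m; EuclideanSpace ℝ (Fin m), (TangentSpace (𝓡 m) : M → Type _)⟯

/-- The smooth functions (degree `0`) and the smooth sections of `V` (degree `1`), regarded as
fields of elements of the exterior algebras of the fibres. -/
def generators : Set (∀ x, ExteriorAlgebra ℝ (V x)) :=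
  {a | (∃ f : C^∞⟮𝓡 m, M; ℝ⟯, a = fun x => algebraMap ℝ (ExteriorAlgebra ℝ (V x)) (f x)) ∨
    (∃ σ : Sec m n V, a = fun x => ExteriorAlgebra.ι ℝ (σ x))}

/-- The algebra `Γ(⋀V)` of superfunctions: the fields `x ↦ a x ∈ ⋀(V x)` that are smooth, i.e. near
every point they agree with a polynomial (for the exterior product) in smooth functions and smooth
sections of `V`. -/
def Superfunctions : Subalgebra ℝ (∀ x, ExteriorAlgebra ℝ (V x)) where
  carrier := {s | ∀ x₀ : M, ∃ a ∈ Algebra.adjoin ℝ (generators m n V), ∀ᶠ x in 𝓝 x₀, s x = a x}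
  mul_mem' := by
    intro s t hs ht x₀
    obtain ⟨a, ha, h⟩ := hs x₀
    obtain ⟨b, hb, h'⟩ := ht x₀
    refine ⟨a * b, mul_mem ha hb, ?_⟩
    filter_upwards [h, h'] with x hx hx'
    simp [hx, hx']
  add_mem' := by
    intro s t hs ht x₀
    obtain ⟨a, ha, h⟩ := hs x₀
    obtain ⟨b, hb, h'⟩ := ht x₀
    refine ⟨a + b, add_mem ha hb, ?_⟩
    filter_upwards [h, h'] with x hx hx'
    simp [hx, hx']
  algebraMap_mem' := fun r x₀ => ⟨algebraMap ℝ _ r, algebraMap_mem _ r, by simp⟩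

/-- The algebra `Γ(⋀V)`, as a type. -/
abbrev SF : Type _ := ↥(Superfunctions m n V)

instance : Ring (SF m n V) := inferInstance

instance : AddCommGroup (SF m n V) := inferInstance

instance : Module (SF m n V) (SF m n V) := inferInstance

instance : Module (SF m n V) (SF m n V →ₗ[ℝ] SF m n V) := inferInstance

/-- A smooth function, as a superfunction. -/
def ofFun (f : C^∞⟮𝓡 m, M; ℝ⟯) : SF m n V :=
  ⟨fun x => algebraMap ℝ (ExteriorAlgebra ℝ (V x)) (f x),
    fun _ => ⟨_, Algebra.subset_adjoin (Or.inl ⟨f, rfl⟩), by simp⟩⟩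

/-- A smooth section of `V`, as a superfunction of degree `1`. -/
def ofSec (σ : Sec m n V) : SF m n V :=
  ⟨fun x => ExteriorAlgebra.ι ℝ (σ x),
    fun _ => ⟨_, Algebra.subset_adjoin (Or.inr ⟨σ, rfl⟩), by simp⟩⟩

variable {m n V}

/-- The superfunction `a` is homogeneous of parity `i`: its values lie in the sum of the exterior
powers `⋀ᵏ(V x)` with `k ≡ i` modulo `2`. -/
def HasParity (i : ZMod 2) (a : SF m n V) : Prop :=
  ∀ x, (a : ∀ x, ExteriorAlgebra ℝ (V x)) x ∈ CliffordAlgebra.evenOdd (0 : QuadraticForm ℝ (V x)) i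

theorem involute_mem {s : ∀ x, ExteriorAlgebra ℝ (V x)} (hs : s ∈ Superfunctions m n V) :
    (fun x => (CliffordAlgebra.involute (s x) : CliffordAlgebra (0 : QuadraticForm ℝ (V x)))) ∈
      Superfunctions m n V := by
  intro x₀
  obtain ⟨a, ha, h⟩ := hs x₀
  refine ⟨fun x => (CliffordAlgebra.involute (a x) : CliffordAlgebra (0 : QuadraticForm ℝ (V x))),
    ?_, ?_⟩
  · clear h
    induction ha using Algebra.adjoin_induction with
    | mem b hb =>
      rcases hb with ⟨f, rfl⟩ | ⟨σ, rfl⟩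
      · have : (fun x => (CliffordAlgebra.involute
            (algebraMap ℝ (ExteriorAlgebra ℝ (V x)) (f x)) :
            CliffordAlgebra (0 : QuadraticForm ℝ (V x)))) =
            fun x => algebraMap ℝ (ExteriorAlgebra ℝ (V x)) (f x) := by
          funext x
          exact AlgHom.commutes _ _
        rw [this]
        exact Algebra.subset_adjoin (Or.inl ⟨f, rfl⟩)
      · have : (fun x => (CliffordAlgebra.involute
            (ExteriorAlgebra.ι ℝ (σ x)) : CliffordAlgebra (0 : QuadraticForm ℝ (V x)))) =
            -fun x => ExteriorAlgebra.ι ℝ (σ x) := by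
          funext x
          exact CliffordAlgebra.involute_ι _
        rw [this]
        exact neg_mem (Algebra.subset_adjoin (Or.inr ⟨σ, rfl⟩))
    | algebraMap r =>
      have : (fun x => (CliffordAlgebra.involute
            ((algebraMap ℝ (∀ x, ExteriorAlgebra ℝ (V x)) r) x) :
            CliffordAlgebra (0 : QuadraticForm ℝ (V x)))) =
            algebraMap ℝ (∀ x, ExteriorAlgebra ℝ (V x)) r := by
        funext x
        exact AlgHom.commutes _ _
      rw [this]
      exact algebraMap_mem _ r
    | add b c _ _ hb hc =>
      have := add_mem hb hc
      convert this using 1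
      funext x
      exact map_add _ _ _
    | mul b c _ _ hb hc =>
      have := mul_mem hb hc
      convert this using 1
      funext x
      exact map_mul _ _ _
  · filter_upwards [h] with x hx
    rw [hx]

theorem exists_parity_decomposition (a : SF m n V) :
    ∃ a₀ a₁ : SF m n V, HasParity 0 a₀ ∧ HasParity 1 a₁ ∧ a = a₀ + a₁ := by
  have key : ∀ (x : M) (y : CliffordAlgebra (0 : QuadraticForm ℝ (V x))),
      (2⁻¹ : ℝ) • (y + CliffordAlgebra.involute y) ∈
          CliffordAlgebra.evenOdd (0 : QuadraticForm ℝ (V x)) 0 ∧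
        (2⁻¹ : ℝ) • (y - CliffordAlgebra.involute y) ∈
          CliffordAlgebra.evenOdd (0 : QuadraticForm ℝ (V x)) 1 := by
    intro x y
    have hy : y ∈ (⨆ i, CliffordAlgebra.evenOdd (0 : QuadraticForm ℝ (V x)) i) := by
      rw [(DirectSum.Decomposition.isInternal
        (CliffordAlgebra.evenOdd (0 : QuadraticForm ℝ (V x)))).submodule_iSup_eq_top]
      trivial
    induction hy using Submodule.iSup_induction' with
    | mem i z hz =>
      fin_cases i
      · have h0 := CliffordAlgebra.involute_eq_of_mem_even hz
        refine ⟨?_, ?_⟩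
        · rw [h0]
          exact Submodule.smul_mem _ _ (add_mem hz hz)
        · rw [h0]
          simp
      · have h0 := CliffordAlgebra.involute_eq_of_mem_odd hz
        refine ⟨?_, ?_⟩
        · rw [h0]
          simp
        · rw [h0]
          exact Submodule.smul_mem _ _ (sub_mem hz (neg_mem hz))
    | zero => simp
    | add y z _ _ hy hz =>
      refine ⟨?_, ?_⟩
      · have := add_mem hy.1 hz.1
        rw [← smul_add] at this
        convert this using 2
        rw [map_add]
        abel
      · have := add_mem hy.2 hz.2
        rw [← smul_add] at this
        convert this using 2
        rw [map_add]
        abel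
  let b : SF m n V := ⟨_, involute_mem a.2⟩
  refine ⟨(2⁻¹ : ℝ) • (a + b), (2⁻¹ : ℝ) • (a - b), fun x => (key x _).1, fun x => (key x _).2, ?_⟩
  rw [← smul_add, add_add_sub_cancel, ← two_smul ℝ a, smul_smul]
  norm_num

end Superfunctions

/-! ## Supervector fields -/

/-- The sign `(-1)^i`. -/
def sgn (i : ZMod 2) : ℝ := if i = 0 then 1 else -1

section Derivations

variable {m n : ℕ} {M : Type*} [TopologicalSpace M] [ChartedSpace (EuclideanSpace ℝ (Fin m)) M]
  {V : M → Type*} [TopologicalSpace (TotalSpace (EuclideanSpace ℝ (Fin n)) V)]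
  [∀ x, AddCommGroup (V x)] [∀ x, Module ℝ (V x)] [∀ x, TopologicalSpace (V x)]
  [FiberBundle (EuclideanSpace ℝ (Fin n)) V]

/-- `D` is a homogeneous graded derivation of parity `i` of `Γ(⋀V)`. -/
structure IsDer (i : ZMod 2) (D : SF m n V →ₗ[ℝ] SF m n V) : Prop where
  parity : ∀ (j : ZMod 2) (a : SF m n V), HasParity j a → HasParity (i + j) (D a)
  leibniz : ∀ (j : ZMod 2) (a b : SF m n V), HasParity j a →
    D (a * b) = D a * b + sgn (i * j) • (a * D b)

theorem HasParity.add {i : ZMod 2} {a b : SF m n V} (ha : HasParity i a) (hb : HasParity i b) :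
    HasParity i (a + b) := fun x => add_mem (ha x) (hb x)

theorem HasParity.smul {i : ZMod 2} {a : SF m n V} (r : ℝ) (ha : HasParity i a) :
    HasParity i (r • a) := fun x => Submodule.smul_mem _ r (ha x)

theorem HasParity.mul {i j : ZMod 2} {a b : SF m n V} (ha : HasParity i a) (hb : HasParity j b) :
    HasParity (i + j) (a * b) := fun x => SetLike.mul_mem_graded (ha x) (hb x)

theorem HasParity.comm {i j : ZMod 2} {a b : SF m n V} (ha : HasParity i a)
    (hb : HasParity j b) : a * b = sgn (i * j) • (b * a) := by
  apply Subtype.ext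
  funext x
  have h := CliffordAlgebra.map_mul_map_of_isOrtho_of_mem_evenOdd
    (QuadraticMap.Isometry.id (0 : QuadraticForm ℝ (V x)))
    (QuadraticMap.Isometry.id (0 : QuadraticForm ℝ (V x)))
    (by intro v w; simp [QuadraticMap.IsOrtho]) _ _ (ha x) (hb x)
  rw [CliffordAlgebra.map_id] at h
  have h' : (a.1 x : CliffordAlgebra (0 : QuadraticForm ℝ (V x))) * b.1 x =
      (-1 : ℤˣ) ^ (j * i) • ((b.1 x : CliffordAlgebra (0 : QuadraticForm ℝ (V x))) * a.1 x) := h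
  have e : ∀ y : CliffordAlgebra (0 : QuadraticForm ℝ (V x)),
      (-1 : ℤˣ) ^ (j * i) • y = sgn (i * j) • y := by
    intro y
    rw [mul_comm j i]
    generalize i * j = k
    fin_cases k
    · change (-1 : ℤˣ) ^ (0 : ZMod 2) • y = sgn 0 • y
      simp [sgn]
    · change (-1 : ℤˣ) ^ (1 : ZMod 2) • y = sgn 1 • y
      simp [sgn]
  rw [e] at h'
  exact h'

theorem sgn_mul_self (i : ZMod 2) : sgn i * sgn i = 1 := by
  unfold sgn; split_ifs <;> norm_num

theorem sgn_add (i j : ZMod 2) : sgn (i + j) = sgn i * sgn j := by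
  have h01 : ∀ k : ZMod 2, k = 0 ∨ k = 1 := by decide
  have h2 : (1 : ZMod 2) + 1 = 0 := by decide
  rcases h01 i with rfl | rfl <;> rcases h01 j with rfl | rfl <;> simp [sgn, h2]

theorem IsDer.zero (i : ZMod 2) : IsDer i (0 : SF m n V →ₗ[ℝ] SF m n V) where
  parity := fun _ _ _ _ => zero_mem _
  leibniz := by simp

theorem IsDer.add {i : ZMod 2} {D D' : SF m n V →ₗ[ℝ] SF m n V} (h : IsDer i D)
    (h' : IsDer i D') : IsDer i (D + D') where
  parity := fun j a ha => (h.parity j a ha).add (h'.parity j a ha)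
  leibniz := fun j a b ha => by
    simp only [LinearMap.add_apply, h.leibniz j a b ha, h'.leibniz j a b ha, add_mul, mul_add,
      smul_add]
    abel

/-- The product `a • D : b ↦ a * D b` of a superfunction and a derivation is a derivation. -/
theorem IsDer.smul {i j : ZMod 2} {a : SF m n V} {D : SF m n V →ₗ[ℝ] SF m n V}
    (ha : HasParity j a) (h : IsDer i D) : IsDer (j + i) (a • D) where
  parity := fun k b hb => by
    rw [add_assoc]
    exact ha.mul (h.parity k b hb)
  leibniz := fun k b c hb => by
    simp only [LinearMap.smul_apply, smul_eq_mul, h.leibniz k b c hb, mul_add, add_mul,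
      mul_smul_comm]
    rw [← mul_assoc a b, ha.comm hb, sgn_add]
    simp only [smul_mul_assoc, smul_smul, mul_assoc]
    rw [mul_comm (sgn (i * k))]

/-- The graded commutator `D ∘ D' - (-1)^{ij} D' ∘ D` is a derivation. -/
theorem IsDer.bracket {i j : ZMod 2} {D D' : SF m n V →ₗ[ℝ] SF m n V} (h : IsDer i D)
    (h' : IsDer j D') : IsDer (i + j) (D ∘ₗ D' - sgn (i * j) • (D' ∘ₗ D)) where
  parity := fun k a ha => by
    have h1 := h.parity _ _ (h'.parity k a ha)
    have h2 := (h'.parity _ _ (h.parity k a ha)).smul (-sgn (i * j))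
    rw [← add_assoc] at h1
    rw [← add_assoc, add_comm j i, neg_smul, ] at h2
    simpa [sub_eq_add_neg] using h1.add h2
  leibniz := fun k a b ha => by
    simp only [LinearMap.sub_apply, LinearMap.comp_apply, LinearMap.smul_apply,
      h.leibniz k a _ ha, h'.leibniz k a _ ha, map_add, map_smul,
      h.leibniz _ _ _ (h'.parity k a ha), h'.leibniz _ _ _ (h.parity k a ha)]
    have e1 : sgn (i * (j + k)) = sgn (i * j) * sgn (i * k) := by rw [mul_add, sgn_add]
    have e2 : sgn (j * (i + k)) = sgn (i * j) * sgn (j * k) := by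
      rw [mul_add, sgn_add, mul_comm j i]
    have e3 : sgn ((i + j) * k) = sgn (i * k) * sgn (j * k) := by rw [add_mul, sgn_add]
    have e4 := sgn_mul_self (i * j)
    rw [e1, e2, e3]
    simp only [smul_add, mul_sub, sub_mul, smul_mul_assoc, mul_smul_comm, smul_smul, smul_sub]
    rw [← mul_assoc (sgn (i * j)) (sgn (i * j)) (sgn (j * k)), e4]
    match_scalars <;> ring

variable (m n V) in
/-- The left `Γ(⋀V)`-module `Der_ℝ Γ(⋀V)` of supervector fields: the sums of an even and an odd
graded derivation. -/
def SuperFields : Submodule (SF m n V) (SF m n V →ₗ[ℝ] SF m n V) where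
  carrier := {D | ∃ D₀ D₁, IsDer 0 D₀ ∧ IsDer 1 D₁ ∧ D = D₀ + D₁}
  zero_mem' := ⟨0, 0, IsDer.zero 0, IsDer.zero 1, by simp⟩
  add_mem' := by
    rintro _ _ ⟨D₀, D₁, h₀, h₁, rfl⟩ ⟨D₀', D₁', h₀', h₁', rfl⟩
    exact ⟨D₀ + D₀', D₁ + D₁', h₀.add h₀', h₁.add h₁', by abel⟩
  smul_mem' := by
    rintro a _ ⟨D₀, D₁, h₀, h₁, rfl⟩
    obtain ⟨a₀, a₁, ha₀, ha₁, rfl⟩ := exists_parity_decomposition a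
    refine ⟨a₀ • D₀ + a₁ • D₁, a₀ • D₁ + a₁ • D₀, ?_, ?_, ?_⟩
    · have e := IsDer.smul ha₁ h₁
      rw [show (1 : ZMod 2) + 1 = 0 by decide] at e
      have e' := IsDer.smul ha₀ h₀
      rw [add_zero] at e'
      exact e'.add e
    · have e := IsDer.smul ha₁ h₀
      rw [add_zero] at e
      have e' := IsDer.smul ha₀ h₁
      rw [zero_add] at e'
      exact e'.add e
    · rw [smul_add, add_smul, add_smul]
      abel

variable (m n V) in
/-- The module of supervector fields, as a type. -/
abbrev SX : Type _ := ↥(SuperFields m n V)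

instance : AddCommGroup (SX m n V) := inferInstance

instance : Module (SF m n V) (SX m n V) := (SuperFields m n V).module

instance : SMul (SF m n V) (SX m n V) := Module.toDistribMulAction.toSMul

instance : Module ℝ (SX m n V) := inferInstance

variable (m n V) in
/-- Homogeneous supervector fields of parity `i`. -/
structure HomDer (i : ZMod 2) where
  toMap : SF m n V →ₗ[ℝ] SF m n V
  isDer : IsDer i toMap

instance (i : ZMod 2) : CoeFun (HomDer m n V i) (fun _ => SF m n V → SF m n V) :=
  ⟨fun D => D.toMap⟩

namespace HomDer

/-- A homogeneous supervector field is a supervector field. -/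
def toSX {i : ZMod 2} (D : HomDer m n V i) : SX m n V :=
  ⟨D.toMap, by
    have h01 : ∀ k : ZMod 2, k = 0 ∨ k = 1 := by decide
    rcases h01 i with rfl | rfl
    · exact ⟨D.toMap, 0, D.isDer, IsDer.zero 1, by simp⟩
    · exact ⟨0, D.toMap, IsDer.zero 0, D.isDer, by simp⟩⟩

/-- The graded commutator of homogeneous supervector fields. -/
def bracket {i j : ZMod 2} (D : HomDer m n V i) (D' : HomDer m n V j) : HomDer m n V (i + j) :=
  ⟨D.toMap ∘ₗ D'.toMap - sgn (i * j) • (D'.toMap ∘ₗ D.toMap), D.isDer.bracket D'.isDer⟩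

end HomDer

/-! ## Graded forms -/

variable (m n V) in
/-- Graded `1`-forms: the `Γ(⋀V)`-linear maps from supervector fields to superfunctions. -/
abbrev OneForm : Type _ := SX m n V →ₗ[SF m n V] SF m n V

variable (m n V) in
/-- Graded `2`-forms: the `Γ(⋀V)`-bilinear graded alternating maps on supervector fields. -/
structure TwoForm where
  toMap : SX m n V →ₗ[ℝ] SX m n V →ₗ[ℝ] SF m n V
  smul_left : ∀ (a : SF m n V) (D D' : SX m n V), toMap (a • D) D' = a * toMap D D'
  smul_right : ∀ (i j : ZMod 2) (D : HomDer m n V i) (a : SF m n V) (D' : SX m n V),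
    HasParity j a → toMap D.toSX (a • D') = sgn (i * j) • (a * toMap D.toSX D')
  alternating : ∀ (i j : ZMod 2) (D : HomDer m n V i) (D' : HomDer m n V j),
    toMap D.toSX D'.toSX = -(sgn (i * j) • toMap D'.toSX D.toSX)

/-- The exterior differential of a graded `1`-form, evaluated on homogeneous supervector fields. -/
def OneForm.d (lam : OneForm m n V) {i j : ZMod 2} (D₁ : HomDer m n V i) (D₂ : HomDer m n V j) :
    SF m n V :=
  D₁ (lam D₂.toSX) - sgn (i * j) • D₂ (lam D₁.toSX) - lam (D₁.bracket D₂).toSX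

namespace TwoForm

/-- The exterior differential of a graded `2`-form, evaluated on homogeneous supervector fields. -/
def d (Ω : TwoForm m n V) {i j k : ZMod 2} (D₁ : HomDer m n V i) (D₂ : HomDer m n V j)
    (D₃ : HomDer m n V k) : SF m n V :=
  D₁ (Ω.toMap D₂.toSX D₃.toSX)
    - sgn (i * j) • D₂ (Ω.toMap D₁.toSX D₃.toSX)
    + sgn ((i + j) * k) • D₃ (Ω.toMap D₁.toSX D₂.toSX)
    - Ω.toMap (D₁.bracket D₂).toSX D₃.toSX
    + sgn (j * k) • Ω.toMap (D₁.bracket D₃).toSX D₂.toSX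
    - sgn (i * j + i * k) • Ω.toMap (D₂.bracket D₃).toSX D₁.toSX

/-- `ω` is closed. -/
def IsClosed (Ω : TwoForm m n V) : Prop :=
  ∀ (i j k : ZMod 2) (D₁ : HomDer m n V i) (D₂ : HomDer m n V j) (D₃ : HomDer m n V k),
    Ω.d D₁ D₂ D₃ = 0

/-- The contraction `ι_D ω`, i.e. the `1`-form `D' ↦ (-1)^{|D||D'|} ω(D, D') = -ω(D', D)`; the
second expression also makes sense for inhomogeneous `D` and `D'`. -/
def contract (Ω : TwoForm m n V) (D : SX m n V) : OneForm m n V where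
  toFun := fun D' => -Ω.toMap D' D
  map_add' := fun D₁ D₂ => by
    rw [map_add, LinearMap.add_apply, neg_add]
  map_smul' := fun a D' => by
    rw [Ω.smul_left, RingHom.id_apply, smul_eq_mul, mul_neg]

theorem contract_apply (Ω : TwoForm m n V) {i j : ZMod 2} (D : HomDer m n V i)
    (D' : HomDer m n V j) :
    Ω.contract D.toSX D'.toSX = sgn (i * j) • Ω.toMap D.toSX D'.toSX := by
  change -Ω.toMap D'.toSX D.toSX = _
  rw [Ω.alternating j i D' D, neg_neg, mul_comm]

/-- A graded symplectic form: closed, and `D ↦ ι_D ω` is an isomorphism from supervector fields to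
graded `1`-forms. -/
def IsSymplectic (Ω : TwoForm m n V) : Prop :=
  Ω.IsClosed ∧ Function.Bijective Ω.contract

/-- `ω` is odd: it shifts the parity by `1`. -/
def IsOdd (Ω : TwoForm m n V) : Prop :=
  ∀ (i j : ZMod 2) (D : HomDer m n V i) (D' : HomDer m n V j),
    HasParity (i + j + 1) (Ω.toMap D.toSX D'.toSX)

end TwoForm

end Derivations

/-! ## Tensor fields describing closed graded 2-forms -/

section Data

variable (m n : ℕ) {M : Type*} [TopologicalSpace M] [ChartedSpace (EuclideanSpace ℝ (Fin m)) M]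
  (V : M → Type*) [TopologicalSpace (TotalSpace (EuclideanSpace ℝ (Fin n)) V)]
  [∀ x, AddCommGroup (V x)] [∀ x, Module ℝ (V x)] [∀ x, TopologicalSpace (V x)]
  [FiberBundle (EuclideanSpace ℝ (Fin n)) V]
  [IsManifold (𝓡 m) ∞ M]

/-- Smooth sections of the dual bundle `V*`. -/
structure DualSec where
  toFun : ∀ x, Module.Dual ℝ (V x)
  smooth : ∀ σ : Sec m n V, ContMDiff (𝓡 m) 𝓘(ℝ, ℝ) ∞ (fun x => toFun x (σ x))

/-- The data `(ω̃, K, L)`: a closed ordinary `2`-form `base` on `M`, tensor fields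
`K k ∈ Γ(T*M ⊗ ⋀ᵏV)`, `k ≥ 1`, and tensor fields `L k ∈ Γ(V ⊗ ⋀ᵏ⁻¹V)`, `k ≥ 2`, whose total
antisymmetrization vanishes (for `k = 2`: symmetric ones). A tensor field with values in `V ⊗ W`
is viewed as a field of linear maps `V* → W`; smoothness means that smooth arguments give smooth
values. For the remaining indices `k`, `K k` and `L k` are `0` by convention. -/
structure MonterdeData where
  base : ∀ x : M, TangentSpace (𝓡 m) x →ₗ[ℝ] TangentSpace (𝓡 m) x →ₗ[ℝ] ℝ
  K : ℕ → ∀ x : M, TangentSpace (𝓡 m) x →ₗ[ℝ] ExteriorAlgebra ℝ (V x)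
  L : ℕ → ∀ x : M, Module.Dual ℝ (V x) →ₗ[ℝ] ExteriorAlgebra ℝ (V x)
  base_alternating : ∀ (x : M) (v : TangentSpace (𝓡 m) x), base x v v = 0
  base_smooth : ∀ X Y : VecField m M,
    ContMDiff (𝓡 m) 𝓘(ℝ, ℝ) ∞ (fun x => base x (X x) (Y x))
  base_closed : ∀ (X Y Z : VecField m M) (x : M),
    mvfderiv (𝓡 m) (fun y => base y (Y y) (Z y)) x (X x)
      - mvfderiv (𝓡 m) (fun y => base y (X y) (Z y)) x (Y x)
      + mvfderiv (𝓡 m) (fun y => base y (X y) (Y y)) x (Z x)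
      - base x (VectorField.mlieBracket (𝓡 m) X Y x) (Z x)
      + base x (VectorField.mlieBracket (𝓡 m) X Z x) (Y x)
      - base x (VectorField.mlieBracket (𝓡 m) Y Z x) (X x) = 0
  K_zero : K 0 = 0
  K_degree : ∀ k x v, K k x v ∈ ⋀[ℝ]^k (V x)
  K_smooth : ∀ (k : ℕ) (X : VecField m M), (fun x => K k x (X x)) ∈ Superfunctions m n V
  L_zero : L 0 = 0
  L_one : L 1 = 0
  L_degree : ∀ k x χ, L (k + 1) x χ ∈ ⋀[ℝ]^k (V x)
  L_smooth : ∀ (k : ℕ) (χ : DualSec m n V),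
    (fun x => L k x (χ.toFun x)) ∈ Superfunctions m n V
  L_symm : ∀ (k : ℕ) (x : M) (e : Module.Basis (Fin n) ℝ (V x)),
    ∑ i, ExteriorAlgebra.ι ℝ (e i) * L k x (e.coord i) = 0

variable {m n V}

/-- The supervector field `D` projects onto the vector field `X` of `M`: `D f = X f` for every
smooth function `f` on `M`. -/
def ProjectsTo (D : SF m n V → SF m n V) (X : ∀ x : M, TangentSpace (𝓡 m) x) : Prop :=
  ∀ (f : C^∞⟮𝓡 m, M; ℝ⟯) (x : M), (D (ofFun m n V f)).1 x =
    algebraMap ℝ (ExteriorAlgebra ℝ (V x)) (mvfderiv (𝓡 m) f x (X x))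

/-- `D` is the supervector field `∇_X`: the even derivation with `D f = X f` for functions and
`D σ = ∇_X σ` for sections `σ` of `V`. -/
def IsCovariant [∀ x, IsTopologicalAddGroup (V x)] [∀ x, ContinuousSMul ℝ (V x)]
    (nab : CovariantDerivative (𝓡 m) (EuclideanSpace ℝ (Fin n)) V)
    (X : VecField m M) (D : HomDer m n V 0) : Prop :=
  ProjectsTo D X ∧
    ∀ (σ : Sec m n V) (x : M), (D (ofSec m n V σ)).1 x = ExteriorAlgebra.ι ℝ (nab σ x (X x))

/-- `D` is the supervector field `i_χ` (insertion of the section `χ` of `V*`): the odd derivation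
with `D f = 0` for functions and `D σ = χ(σ)` for sections `σ` of `V`. -/
def IsInsertion (χ : DualSec m n V) (D : HomDer m n V 1) : Prop :=
  ProjectsTo D 0 ∧
    ∀ (σ : Sec m n V) (x : M), (D (ofSec m n V σ)).1 x =
      algebraMap ℝ (ExteriorAlgebra ℝ (V x)) (χ.toFun x (σ x))

/-- `η` is the pullback of the ordinary `2`-form `α` along the projection of the supermanifold
onto `M`. -/
def IsPullback (α : ∀ x : M, TangentSpace (𝓡 m) x →ₗ[ℝ] TangentSpace (𝓡 m) x →ₗ[ℝ] ℝ)
    (η : TwoForm m n V) : Prop :=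
  ∀ (X Y : VecField m M) (D D' : SX m n V), ProjectsTo D.1 X → ProjectsTo D'.1 Y →
    ∀ x, (η.toMap D D').1 x = algebraMap ℝ (ExteriorAlgebra ℝ (V x)) (α x (X x) (Y x))

namespace MonterdeData

/-- `(ω̃, K, L)` are the data of the graded `2`-form `ω` with respect to the connection `∇`: one has
`ω = π*ω̃ + dλ`, where `π*ω̃` is the pullback of `ω̃` and `λ` is the graded `1`-form with
`λ(∇_X) = ∑_{k ≥ 1} K_k(X)` and `λ(i_χ) = ∑_{k ≥ 2} L_k(χ)`. (Here `K_k = 0` for `k > n` and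
`L_k = 0` for `k > n + 1`, because `⋀ᵏV = 0` for `k > n`.) -/
def Represents [∀ x, IsTopologicalAddGroup (V x)] [∀ x, ContinuousSMul ℝ (V x)]
    (d : MonterdeData m n V) (nab : CovariantDerivative (𝓡 m) (EuclideanSpace ℝ (Fin n)) V)
    (Ω : TwoForm m n V) : Prop :=
  ∃ (η : TwoForm m n V) (lam : OneForm m n V),
    IsPullback d.base η ∧
    (∀ (X : VecField m M) (D : HomDer m n V 0), IsCovariant nab X D →
      ∀ x, (lam D.toSX).1 x = ∑ k ∈ Finset.Icc 1 n, d.K k x (X x)) ∧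
    (∀ (χ : DualSec m n V) (D : HomDer m n V 1), IsInsertion χ D →
      ∀ x, (lam D.toSX).1 x = ∑ k ∈ Finset.Icc 2 (n + 1), d.L k x (χ.toFun x)) ∧
    ∀ (i j : ZMod 2) (D : HomDer m n V i) (D' : HomDer m n V j),
      Ω.toMap D.toSX D'.toSX = η.toMap D.toSX D'.toSX + lam.d D D'

end MonterdeData

variable (m n V) in
/-- The field `κ` of linear maps `T_x M → ⋀(V x)` takes its values in `V x = ⋀¹(V x)` and defines an
isomorphism of smooth vector bundles `TM ≅ V`. -/
def DefinesBundleIso (κ : ∀ x : M, TangentSpace (𝓡 m) x →ₗ[ℝ] ExteriorAlgebra ℝ (V x)) : Prop :=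
  ∃ e : ∀ x : M, TangentSpace (𝓡 m) x ≃ₗ[ℝ] V x,
    (∀ x v, κ x v = ExteriorAlgebra.ι ℝ (e x v)) ∧
    ContMDiff (𝓡 m).tangent ((𝓡 m).prod 𝓘(ℝ, EuclideanSpace ℝ (Fin n))) ∞
      (fun p : TangentBundle (𝓡 m) M =>
        (⟨p.1, e p.1 p.2⟩ : TotalSpace (EuclideanSpace ℝ (Fin n)) V)) ∧
    ContMDiff ((𝓡 m).prod 𝓘(ℝ, EuclideanSpace ℝ (Fin n))) (𝓡 m).tangent ∞
      (fun p : TotalSpace (EuclideanSpace ℝ (Fin n)) V =>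
        (⟨p.1, (e p.1).symm p.2⟩ : TangentBundle (𝓡 m) M))

end Data

end OddSymplectic

end

noncomputable section

set_option linter.unusedSectionVars false

namespace OddSymplectic

/-! ## The grading of an exterior algebra -/

section Fibre

variable {W : Type*} [AddCommGroup W] [Module ℝ W]

/-! The proof rests on the Euler field `eps`, the even derivation ε of Γ(⋀V) acting as
multiplication by k in degree k. Bracketing with ε multiplies `∇_X` by 0 and `i_χ` by -1
(`hasWeight_cov`, `hasWeight_ins`), and these fields span all supervector fields locally
(`Frame.homDer_apply_eq`). Hence the Lie derivative L_ε on graded 1-forms is diagonal: on the degree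
k part it has eigenvalue k at `∇_X` and k + 1 at `i_χ` (`OneForm.pr_lieEps`).

Existence: closedness gives Cartan's formula L_ε Ω = d(ι_ε Ω) (`TwoForm.eps_apply`). As Ω is odd,
ι_ε Ω has no degree 0 part at `∇_X`, so the eigenvalue 0 does not occur and λ = L_ε⁻¹ ι_ε Ω exists;
it is obtained as a polynomial in L_ε. Then L_ε(Ω - dλ) = 0, and weights together with parity force
Ω = dλ (`TwoForm.exists_primitive`). Locally ε = ∑ s_j i_{χ_j}, so λ(ε) = Ω(ε, ε) = 0 says exactly
that the tensors L have vanishing antisymmetrization. Thus the data are `base = 0`, K_k the degree k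
part of λ(∇), and L_{k+1} the degree k part of λ(i). Since λ is odd, λ(i_χ) is even and L_2 = 0.

Uniqueness: for any representing triple λ(ε) = 0, and the pullback is killed by ε, so L_ε λ = ι_ε Ω.
Inverting the eigenvalues recovers λ, the only undetermined component being the degree 0 part of
λ(∇_X), which vanishes by definition of the data. Then `base` is read off from Ω - dλ.

Isomorphism: modulo nilpotents an odd Ω pairs only `∇` with `i`, and K_1 is this pairing
(`OneForm.anchor_eq_sum`). Writing the 1-forms D ↦ D f and D ↦ D σ as contractions of Ω makes K_1
injective and surjective, with smooth preimages. -/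

/-- The parity involution of an exterior algebra. -/
def inv : ExteriorAlgebra ℝ W →ₐ[ℝ] ExteriorAlgebra ℝ W :=
  CliffordAlgebra.involute (Q := (0 : QuadraticForm ℝ W))

theorem inv_inv (y : ExteriorAlgebra ℝ W) : inv (inv y) = y :=
  CliffordAlgebra.involute_involute (Q := (0 : QuadraticForm ℝ W)) y

theorem inv_ι (w : W) : inv (ExteriorAlgebra.ι ℝ w) = -ExteriorAlgebra.ι ℝ w :=
  CliffordAlgebra.involute_ι (Q := (0 : QuadraticForm ℝ W)) w

/-- Passing a vector costs one sign per degree. Consequently `y ↦ ι w * contr φ y` is an untwisted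
derivation, which is how connection coefficients enter `exists_covariant`. -/
theorem ι_mul_inv (w : W) (y : ExteriorAlgebra ℝ W) :
    ExteriorAlgebra.ι ℝ w * inv y = y * ExteriorAlgebra.ι ℝ w := by
  induction y using ExteriorAlgebra.induction with
  | algebraMap r =>
    have h : inv (algebraMap ℝ (ExteriorAlgebra ℝ W) r) = algebraMap ℝ _ r := AlgHom.commutes _ _
    rw [h, Algebra.commutes]
  | ι v =>
    have h : inv (ExteriorAlgebra.ι ℝ v) = -ExteriorAlgebra.ι ℝ v :=
      CliffordAlgebra.involute_ι (Q := (0 : QuadraticForm ℝ W)) v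
    rw [h, mul_neg, neg_eq_iff_add_eq_zero, ExteriorAlgebra.ι_add_mul_swap]
  | mul a b ha hb => rw [map_mul, ← mul_assoc, ha, mul_assoc, hb, mul_assoc]
  | add a b ha hb => rw [map_add, mul_add, add_mul, ha, hb]

theorem sgn_zero : sgn 0 = 1 := by simp [sgn]

theorem sgn_one : sgn 1 = -1 := by simp [sgn]

theorem zmod_two_cases (i : ZMod 2) : i = 0 ∨ i = 1 := by
  revert i; decide

theorem inv_eq_of_mem {i : ZMod 2} {y : ExteriorAlgebra ℝ W}
    (h : y ∈ CliffordAlgebra.evenOdd (0 : QuadraticForm ℝ W) i) : inv y = sgn i • y := by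
  rcases zmod_two_cases i with rfl | rfl
  · rw [sgn_zero, one_smul]
    exact CliffordAlgebra.involute_eq_of_mem_even h
  · rw [sgn_one, neg_one_smul]
    exact CliffordAlgebra.involute_eq_of_mem_odd h

theorem exists_evenOdd_add (y : ExteriorAlgebra ℝ W) :
    ∃ y₀ ∈ CliffordAlgebra.evenOdd (0 : QuadraticForm ℝ W) 0,
      ∃ y₁ ∈ CliffordAlgebra.evenOdd (0 : QuadraticForm ℝ W) 1, y = y₀ + y₁ := by
  have hy : y ∈ (⨆ i, CliffordAlgebra.evenOdd (0 : QuadraticForm ℝ W) i) := by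
    rw [(DirectSum.Decomposition.isInternal
      (CliffordAlgebra.evenOdd (0 : QuadraticForm ℝ W))).submodule_iSup_eq_top]
    trivial
  induction hy using Submodule.iSup_induction' with
  | mem i z hz =>
    rcases zmod_two_cases i with rfl | rfl
    · exact ⟨z, hz, 0, zero_mem _, by simp⟩
    · exact ⟨0, zero_mem _, z, hz, by simp⟩
  | zero => exact ⟨0, zero_mem _, 0, zero_mem _, by simp⟩
  | add y z _ _ hy hz =>
    obtain ⟨a, ha, b, hb, rfl⟩ := hy
    obtain ⟨c, hc, d, hd, rfl⟩ := hz
    exact ⟨a + c, add_mem ha hc, b + d, add_mem hb hd, by abel⟩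

/-- The parity subspaces are the eigenspaces of `inv`, because 2 is invertible. Parity claims
thereby become equations. -/
theorem mem_evenOdd_iff {i : ZMod 2} {y : ExteriorAlgebra ℝ W} :
    y ∈ CliffordAlgebra.evenOdd (0 : QuadraticForm ℝ W) i ↔ inv y = sgn i • y := by
  refine ⟨inv_eq_of_mem, fun h => ?_⟩
  obtain ⟨a, ha, b, hb, rfl⟩ := exists_evenOdd_add y
  rw [map_add, inv_eq_of_mem ha, inv_eq_of_mem hb, sgn_zero, sgn_one] at h
  rcases zmod_two_cases i with rfl | rfl
  · rw [sgn_zero] at h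
    have hb0 : b = 0 := by
      have : (2 : ℝ) • b = 0 := by
        calc (2 : ℝ) • b = (1 : ℝ) • (a + b) - ((1 : ℝ) • a + (-1 : ℝ) • b) := by module
          _ = 0 := by rw [h, sub_self]
      simpa using this
    simpa [hb0] using ha
  · rw [sgn_one] at h
    have ha0 : a = 0 := by
      have : (2 : ℝ) • a = 0 := by
        calc (2 : ℝ) • a = ((1 : ℝ) • a + (-1 : ℝ) • b) - (-1 : ℝ) • (a + b) := by module
          _ = 0 := by rw [h, sub_self]
      simpa using this
    simpa [ha0] using hb

/-- The projection of an exterior algebra onto its `k`-th exterior power. -/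
def proj (k : ℕ) : ExteriorAlgebra ℝ W →ₗ[ℝ] ExteriorAlgebra ℝ W :=
  GradedAlgebra.proj (fun i : ℕ => ⋀[ℝ]^i W) k

theorem proj_mem (k : ℕ) (y : ExteriorAlgebra ℝ W) : proj k y ∈ ⋀[ℝ]^k W :=
  SetLike.coe_mem _

theorem proj_of_mem {k : ℕ} {y : ExteriorAlgebra ℝ W} (h : y ∈ ⋀[ℝ]^k W) : proj k y = y :=
  DirectSum.decompose_of_mem_same (fun i : ℕ => ⋀[ℝ]^i W) h

theorem proj_of_mem_ne {j k : ℕ} {y : ExteriorAlgebra ℝ W} (h : y ∈ ⋀[ℝ]^j W) (hjk : j ≠ k) :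
    proj k y = 0 :=
  DirectSum.decompose_of_mem_ne (fun i : ℕ => ⋀[ℝ]^i W) h hjk

theorem algebraMap_mem_degree (r : ℝ) :
    algebraMap ℝ (ExteriorAlgebra ℝ W) r ∈ ⋀[ℝ]^0 W := by
  rw [ExteriorAlgebra.exteriorPower, pow_zero]
  exact Submodule.algebraMap_mem r

theorem ι_mem_degree (w : W) : ExteriorAlgebra.ι ℝ w ∈ ⋀[ℝ]^1 W := by
  rw [ExteriorAlgebra.exteriorPower, pow_one]
  exact LinearMap.mem_range_self _ w

theorem mul_mem_degree {i j : ℕ} {y z : ExteriorAlgebra ℝ W} (hy : y ∈ ⋀[ℝ]^i W)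
    (hz : z ∈ ⋀[ℝ]^j W) : y * z ∈ ⋀[ℝ]^(i + j) W :=
  SetLike.mul_mem_graded hy hz

theorem degree_induction {motive : ExteriorAlgebra ℝ W → Prop}
    (homogeneous : ∀ (k : ℕ) (y : ExteriorAlgebra ℝ W), y ∈ ⋀[ℝ]^k W → motive y)
    (add : ∀ y z, motive y → motive z → motive (y + z)) (y : ExteriorAlgebra ℝ W) : motive y :=
  DirectSum.Decomposition.inductionOn (fun i : ℕ => ⋀[ℝ]^i W)
    (homogeneous 0 0 (zero_mem _)) (fun m => homogeneous _ _ m.2) add y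

theorem proj_mul (k : ℕ) (y z : ExteriorAlgebra ℝ W) :
    proj k (y * z) = ∑ ij ∈ Finset.HasAntidiagonal.antidiagonal k, proj ij.1 y * proj ij.2 z := by
  induction y using degree_induction with
  | add y y' hy hy' => simp only [add_mul, map_add, hy, hy', Finset.sum_add_distrib]
  | homogeneous i y hy =>
    induction z using degree_induction with
    | add z z' hz hz' => simp only [mul_add, map_add, hz, hz', Finset.sum_add_distrib]
    | homogeneous j z hz =>
      by_cases h : i + j = k
      · rw [proj_of_mem (h ▸ mul_mem_degree hy hz), Finset.sum_eq_single (i, j),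
          proj_of_mem hy, proj_of_mem hz]
        · rintro ⟨a, b⟩ hab hne
          by_cases ha : i = a
          · have hb : j ≠ b := by
              rintro rfl
              exact hne (by rw [ha])
            simp [proj_of_mem_ne hz hb]
          · simp [proj_of_mem_ne hy ha]
        · intro h'
          exact absurd (Finset.HasAntidiagonal.mem_antidiagonal.2 h) h'
      · rw [proj_of_mem_ne (mul_mem_degree hy hz) h, Finset.sum_eq_zero]
        rintro ⟨a, b⟩ hab
        by_cases ha : i = a
        · have hb : j ≠ b := by
            rintro rfl
            exact h (by rw [ha]; exact Finset.HasAntidiagonal.mem_antidiagonal.1 hab)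
          simp [proj_of_mem_ne hz hb]
        · simp [proj_of_mem_ne hy ha]

/-- In positive degree an element is a sum of products with a left factor `ι w`, and `algebraMapInv`
is an algebra map killing `ι w`. -/
theorem proj_zero_eq (y : ExteriorAlgebra ℝ W) :
    proj 0 y = algebraMap ℝ _ (ExteriorAlgebra.algebraMapInv y) := by
  induction y using degree_induction with
  | add y z hy hz => simp only [map_add, hy, hz]
  | homogeneous k y hy =>
    rcases Nat.eq_zero_or_pos k with rfl | hk
    · rw [proj_of_mem hy]
      rw [ExteriorAlgebra.exteriorPower, pow_zero, Submodule.mem_one] at hy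
      obtain ⟨r, rfl⟩ := hy
      rw [ExteriorAlgebra.algebraMap_leftInverse]
    · rw [proj_of_mem_ne hy hk.ne']
      obtain ⟨k, rfl⟩ := Nat.exists_eq_succ_of_ne_zero hk.ne'
      rw [ExteriorAlgebra.exteriorPower, Nat.succ_eq_add_one, pow_succ'] at hy
      induction hy using Submodule.mul_induction_on' with
      | mem_mul_mem a ha b hb =>
        obtain ⟨w, rfl⟩ := ha
        simp [ExteriorAlgebra.algebraMapInv]
      | add a _ b _ ha hb => rw [map_add, map_add, ← ha, ← hb, add_zero]

/-- The Euler operator of an exterior algebra: multiplication by `k` on the `k`-th exterior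
power. -/
def eul : ExteriorAlgebra ℝ W →ₗ[ℝ] ExteriorAlgebra ℝ W :=
  (DirectSum.toModule ℝ ℕ _ fun k => (k : ℝ) • (⋀[ℝ]^k W).subtype) ∘ₗ
    (DirectSum.decomposeLinearEquiv (fun i : ℕ => ⋀[ℝ]^i W)).toLinearMap

theorem eul_of_mem {k : ℕ} {y : ExteriorAlgebra ℝ W} (h : y ∈ ⋀[ℝ]^k W) :
    eul y = (k : ℝ) • y := by
  rw [eul, LinearMap.comp_apply]
  have : (DirectSum.decomposeLinearEquiv (fun i : ℕ => ⋀[ℝ]^i W)).toLinearMap y =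
      DirectSum.lof ℝ ℕ (fun i : ℕ => ⋀[ℝ]^i W) k ⟨y, h⟩ :=
    DirectSum.decompose_of_mem (fun i : ℕ => ⋀[ℝ]^i W) h
  rw [this, DirectSum.toModule_lof]
  rfl

theorem eul_mul (y z : ExteriorAlgebra ℝ W) : eul (y * z) = eul y * z + y * eul z := by
  induction y using degree_induction with
  | add y y' hy hy' => simp only [add_mul, map_add, hy, hy']; abel
  | homogeneous i y hy =>
    induction z using degree_induction with
    | add z z' hz hz' => simp only [mul_add, map_add, hz, hz']; abel
    | homogeneous j z hz =>
      rw [eul_of_mem (mul_mem_degree hy hz), eul_of_mem hy, eul_of_mem hz]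
      push_cast
      rw [smul_mul_assoc, mul_smul_comm, add_smul]

theorem proj_eul (k : ℕ) (y : ExteriorAlgebra ℝ W) : proj k (eul y) = (k : ℝ) • proj k y := by
  induction y using degree_induction with
  | add y y' hy hy' => simp only [map_add, smul_add, hy, hy']
  | homogeneous i y hy =>
    rw [eul_of_mem hy, map_smul]
    by_cases h : i = k
    · rw [h]
    · rw [proj_of_mem_ne hy h, smul_zero, smul_zero]

theorem inv_of_mem {k : ℕ} {y : ExteriorAlgebra ℝ W} (h : y ∈ ⋀[ℝ]^k W) :
    inv y = sgn k • y := by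
  induction k generalizing y with
  | zero =>
    rw [ExteriorAlgebra.exteriorPower, pow_zero, Submodule.mem_one] at h
    obtain ⟨r, rfl⟩ := h
    simp [sgn_zero]
  | succ k ih =>
    rw [ExteriorAlgebra.exteriorPower, pow_succ'] at h
    induction h using Submodule.mul_induction_on' with
    | mem_mul_mem a ha b hb =>
      obtain ⟨w, rfl⟩ := ha
      rw [map_mul, inv_ι, ih hb, Nat.cast_succ, sgn_add, sgn_one]
      simp
    | add a _ b _ ha hb => rw [map_add, ha, hb, smul_add]

theorem proj_inv (k : ℕ) (y : ExteriorAlgebra ℝ W) : proj k (inv y) = sgn k • proj k y := by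
  induction y using degree_induction with
  | add y y' hy hy' => simp only [map_add, smul_add, hy, hy']
  | homogeneous i y hy =>
    rw [inv_of_mem hy, map_smul]
    by_cases h : i = k
    · rw [h]
    · rw [proj_of_mem_ne hy h, smul_zero, smul_zero]

/-- `inv` multiplies the degree k part by both `sgn k` and `sgn i`; when these differ, twice that
part is zero. This is what excludes the eigenvalue 0 of the Euler field on odd superfunctions. -/
theorem proj_eq_zero_of_parity {i : ZMod 2} {k : ℕ} (hk : (k : ZMod 2) ≠ i)
    {y : ExteriorAlgebra ℝ W} (h : y ∈ CliffordAlgebra.evenOdd (0 : QuadraticForm ℝ W) i) :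
    proj k y = 0 := by
  have h1 := proj_inv k y
  rw [inv_eq_of_mem h, map_smul] at h1
  generalize (k : ZMod 2) = j at hk h1
  have h2 : (2 : ℝ) • proj k y = 0 := by
    rcases zmod_two_cases i with rfl | rfl <;> rcases zmod_two_cases j with rfl | rfl
    · exact absurd rfl hk
    · rw [sgn_zero, sgn_one] at h1
      calc (2 : ℝ) • proj k y = (1 : ℝ) • proj k y - (-1 : ℝ) • proj k y := by module
        _ = 0 := by rw [h1, sub_self]
    · rw [sgn_zero, sgn_one] at h1
      calc (2 : ℝ) • proj k y = (1 : ℝ) • proj k y - (-1 : ℝ) • proj k y := by module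
        _ = 0 := by rw [h1, sub_self]
    · exact absurd rfl hk
  simpa using h2

variable [Module.Finite ℝ W]

theorem eq_zero_of_mem_degree {k : ℕ} (hk : Module.finrank ℝ W < k) {y : ExteriorAlgebra ℝ W}
    (h : y ∈ ⋀[ℝ]^k W) : y = 0 := by
  have : Module.finrank ℝ (⋀[ℝ]^k W) = 0 := by
    rw [exteriorPower.finrank_eq, Nat.choose_eq_zero_of_lt hk]
  rw [Module.finrank_eq_zero_iff_of_free] at this
  exact congrArg Subtype.val (Subsingleton.elim (⟨y, h⟩ : ⋀[ℝ]^k W) 0)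

theorem sum_proj {N : ℕ} (hN : Module.finrank ℝ W ≤ N) (y : ExteriorAlgebra ℝ W) :
    ∑ k ∈ Finset.range (N + 1), proj k y = y := by
  induction y using degree_induction with
  | add y y' hy hy' => simp only [map_add, Finset.sum_add_distrib, hy, hy']
  | homogeneous i y hy =>
    by_cases h : i < N + 1
    · rw [Finset.sum_eq_single i, proj_of_mem hy]
      · intro j _ hj
        exact proj_of_mem_ne hy hj.symm
      · intro h'
        exact absurd (Finset.mem_range.2 h) h'
    · rw [eq_zero_of_mem_degree (by omega) hy]
      simp

end Fibre

/-! ### Interior products on an exterior algebra -/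

section Contraction

variable {W : Type*} [AddCommGroup W] [Module ℝ W]

/-- Insertion of a linear form into an element of an exterior algebra. -/
def contr : Module.Dual ℝ W →ₗ[ℝ] ExteriorAlgebra ℝ W →ₗ[ℝ] ExteriorAlgebra ℝ W :=
  CliffordAlgebra.contractLeft (Q := (0 : QuadraticForm ℝ W))

theorem contr_ι (φ : Module.Dual ℝ W) (w : W) :
    contr φ (ExteriorAlgebra.ι ℝ w) = algebraMap ℝ _ (φ w) :=
  CliffordAlgebra.contractLeft_ι (Q := (0 : QuadraticForm ℝ W)) φ w

theorem contr_algebraMap (φ : Module.Dual ℝ W) (r : ℝ) :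
    contr φ (algebraMap ℝ (ExteriorAlgebra ℝ W) r) = 0 :=
  CliffordAlgebra.contractLeft_algebraMap (Q := (0 : QuadraticForm ℝ W)) φ r

theorem contr_ι_mul (φ : Module.Dual ℝ W) (w : W) (z : ExteriorAlgebra ℝ W) :
    contr φ (ExteriorAlgebra.ι ℝ w * z) = φ w • z - ExteriorAlgebra.ι ℝ w * contr φ z :=
  CliffordAlgebra.contractLeft_ι_mul (Q := (0 : QuadraticForm ℝ W)) (d := φ) w z

/-- The twist `inv y` collects one sign for each vector that the insertion passes. It makes `ins χ`
an odd derivation. -/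
theorem contr_mul (φ : Module.Dual ℝ W) (y z : ExteriorAlgebra ℝ W) :
    contr φ (y * z) = contr φ y * z + inv y * contr φ z := by
  induction y using CliffordAlgebra.left_induction with
  | algebraMap r =>
    have h : inv (algebraMap ℝ (ExteriorAlgebra ℝ W) r) = algebraMap ℝ _ r := AlgHom.commutes _ _
    have h' := contr_algebraMap φ (W := W) r
    rw [h, h', zero_mul, zero_add, ← Algebra.smul_def, map_smul, Algebra.smul_def]
  | add y y' hy hy' => simp only [add_mul, map_add, hy, hy']; abel
  | ι_mul y w hy =>
    have h1 := contr_ι_mul φ w y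
    have h2 := contr_ι_mul φ w (y * z)
    have h3 := inv_ι w
    change contr φ (ExteriorAlgebra.ι ℝ w * y * z) = contr φ (ExteriorAlgebra.ι ℝ w * y) * z +
      inv (ExteriorAlgebra.ι ℝ w * y) * contr φ z
    rw [mul_assoc, h2, hy, h1, map_mul, h3, mul_add, sub_mul, smul_mul_assoc, mul_assoc, mul_assoc,
      neg_mul]
    abel

end Contraction

/-! ### Superfunctions as germs of polynomials in functions and sections -/

section Local

variable {m n : ℕ} {M : Type*} [TopologicalSpace M] [ChartedSpace (EuclideanSpace ℝ (Fin m)) M]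
  {V : M → Type*} [TopologicalSpace (TotalSpace (EuclideanSpace ℝ (Fin n)) V)]
  [∀ x, AddCommGroup (V x)] [∀ x, Module ℝ (V x)] [∀ x, TopologicalSpace (V x)]
  [FiberBundle (EuclideanSpace ℝ (Fin n)) V]

theorem SF.ext {a b : SF m n V} (h : ∀ x, a.1 x = b.1 x) : a = b :=
  Subtype.ext (funext h)

@[simp] theorem coe_mul_apply (a b : SF m n V) (x : M) : (a * b).1 x = a.1 x * b.1 x := rfl

@[simp] theorem coe_add_apply (a b : SF m n V) (x : M) : (a + b).1 x = a.1 x + b.1 x := rfl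

@[simp] theorem coe_sub_apply (a b : SF m n V) (x : M) : (a - b).1 x = a.1 x - b.1 x := rfl

@[simp] theorem coe_neg_apply (a : SF m n V) (x : M) : (-a).1 x = -a.1 x := rfl

@[simp] theorem coe_smul_apply (r : ℝ) (a : SF m n V) (x : M) : (r • a).1 x = r • a.1 x := rfl

@[simp] theorem coe_zero_apply (x : M) : (0 : SF m n V).1 x = 0 := rfl

@[simp] theorem coe_ofFun_apply (f : C^∞⟮𝓡 m, M; ℝ⟯) (x : M) :
    (ofFun m n V f).1 x = algebraMap ℝ _ (f x) := rfl

@[simp] theorem coe_ofSec_apply (σ : Sec m n V) (x : M) :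
    (ofSec m n V σ).1 x = ExteriorAlgebra.ι ℝ (σ x) := rfl

/-- Evaluation of a superfunction at a point. -/
def ev (x : M) : SF m n V →ₗ[ℝ] ExteriorAlgebra ℝ (V x) where
  toFun a := a.1 x
  map_add' _ _ := rfl
  map_smul' _ _ := rfl

@[simp] theorem coe_sum_apply {ι : Type*} (s : Finset ι) (a : ι → SF m n V) (x : M) :
    (∑ i ∈ s, a i).1 x = ∑ i ∈ s, (a i).1 x :=
  map_sum (ev x) a s

theorem adjoin_generators_le :
    Algebra.adjoin ℝ (generators m n V) ≤ Superfunctions m n V :=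
  fun a ha _ => ⟨a, ha, by simp⟩

theorem exists_mem_adjoin (a : SF m n V) (x₀ : M) :
    ∃ b : SF m n V, b.1 ∈ Algebra.adjoin ℝ (generators m n V) ∧ ∀ᶠ x in 𝓝 x₀, a.1 x = b.1 x := by
  obtain ⟨b, hb, h⟩ := a.2 x₀
  exact ⟨⟨b, adjoin_generators_le hb⟩, hb, h⟩

theorem mem_superfunctions_of_eventually {s : ∀ x, ExteriorAlgebra ℝ (V x)}
    (h : ∀ x₀, ∃ b : SF m n V, ∀ᶠ x in 𝓝 x₀, s x = b.1 x) : s ∈ Superfunctions m n V := by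
  intro x₀
  obtain ⟨b, hb⟩ := h x₀
  obtain ⟨c, hc, h'⟩ := b.2 x₀
  refine ⟨c, hc, ?_⟩
  filter_upwards [hb, h'] with x hx hx'
  rw [hx, hx']

/-- Combined with `exists_mem_adjoin`, this is the induction principle for every statement about
superfunctions that depends only on germs. -/
theorem adjoin_superfunction_induction {motive : SF m n V → Prop}
    (fn : ∀ f, motive (ofFun m n V f)) (sec : ∀ σ, motive (ofSec m n V σ))
    (add : ∀ a b, motive a → motive b → motive (a + b))
    (mul : ∀ a b, motive a → motive b → motive (a * b)) {a : SF m n V}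
    (ha : a.1 ∈ Algebra.adjoin ℝ (generators m n V)) : motive a := by
  suffices ∀ (b : ∀ x, ExteriorAlgebra ℝ (V x)) (hb : b ∈ Algebra.adjoin ℝ (generators m n V)),
      motive ⟨b, adjoin_generators_le hb⟩ from this a.1 ha
  intro b hb
  induction hb using Algebra.adjoin_induction with
  | mem b hb =>
    rcases hb with ⟨f, rfl⟩ | ⟨σ, rfl⟩
    · exact fn f
    · exact sec σ
  | algebraMap r => exact fn (ContMDiffMap.const r)
  | add b c _ _ hb hc => exact add _ _ hb hc
  | mul b c _ _ hb hc => exact mul _ _ hb hc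

/-! ### Parity and degree -/

/-- The parity involution of the algebra of superfunctions. -/
def tau : SF m n V →ₐ[ℝ] SF m n V where
  toFun a := ⟨fun x => inv (a.1 x), involute_mem a.2⟩
  map_one' := SF.ext fun _ => map_one inv
  map_mul' _ _ := SF.ext fun _ => map_mul inv _ _
  map_zero' := SF.ext fun _ => map_zero inv
  map_add' _ _ := SF.ext fun _ => map_add inv _ _
  commutes' r := SF.ext fun _ => AlgHom.commutes inv r

@[simp] theorem coe_tau_apply (a : SF m n V) (x : M) : (tau a).1 x = inv (a.1 x) := rfl

theorem tau_tau (a : SF m n V) : tau (tau a) = a := SF.ext fun _ => inv_inv _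

/-- The `i`-th power of the parity involution. -/
def tw (i : ZMod 2) : SF m n V →ₐ[ℝ] SF m n V := if i = 0 then AlgHom.id ℝ _ else tau

theorem tw_zero (a : SF m n V) : tw 0 a = a := by simp [tw]

theorem tw_one (a : SF m n V) : tw 1 a = tau a := by simp [tw]

theorem hasParity_iff {j : ZMod 2} {a : SF m n V} : HasParity j a ↔ tau a = sgn j • a :=
  ⟨fun h => SF.ext fun x => mem_evenOdd_iff.1 (h x),
    fun h x => mem_evenOdd_iff.2 (congrArg (fun b : SF m n V => b.1 x) h)⟩

/-- The sign (-1)^{i|a|} makes sense only for homogeneous `a`, whereas the automorphism `tw i` is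
defined on all superfunctions. Leibniz rules written with `tw` need no homogeneity. -/
theorem tw_eq_smul {i j : ZMod 2} {a : SF m n V} (h : HasParity j a) :
    tw i a = sgn (i * j) • a := by
  rcases zmod_two_cases i with rfl | rfl
  · rw [tw_zero, zero_mul, sgn_zero, one_smul]
  · rw [tw_one, one_mul, hasParity_iff.1 h]

theorem hasParity_ofFun (f : C^∞⟮𝓡 m, M; ℝ⟯) : HasParity 0 (ofFun m n V f) :=
  hasParity_iff.2 <| SF.ext fun x => by
    rw [sgn_zero, one_smul]
    exact AlgHom.commutes inv _

theorem hasParity_ofSec (σ : Sec m n V) : HasParity 1 (ofSec m n V σ) :=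
  hasParity_iff.2 <| SF.ext fun x => by
    rw [sgn_one, neg_one_smul]
    exact inv_ι _

theorem tw_ofFun (i : ZMod 2) (f : C^∞⟮𝓡 m, M; ℝ⟯) : tw i (ofFun m n V f) = ofFun m n V f := by
  rw [tw_eq_smul (hasParity_ofFun f), mul_zero, sgn_zero, one_smul]

theorem tw_tau (i : ZMod 2) (a : SF m n V) : tw i (tau a) = tau (tw i a) := by
  rcases zmod_two_cases i with rfl | rfl
  · rw [tw_zero, tw_zero]
  · rw [tw_one, tw_one]

theorem proj_mem_superfunctions (k : ℕ) (a : SF m n V) :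
    (fun x => proj k (a.1 x)) ∈ Superfunctions m n V := by
  refine mem_superfunctions_of_eventually fun x₀ => ?_
  obtain ⟨b, hb, h⟩ := exists_mem_adjoin a x₀
  -- All degrees are treated at once, since one component of a product involves all lower components
  -- of the factors.
  suffices ∀ k, (fun x => proj k (b.1 x)) ∈ Superfunctions m n V from
    ⟨⟨_, this k⟩, by filter_upwards [h] with x hx; rw [hx]⟩
  clear h
  refine adjoin_superfunction_induction
    (motive := fun b => ∀ k, (fun x => proj k (b.1 x)) ∈ Superfunctions m n V)
    ?fn ?sec ?add ?mul hb
  case fn =>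
    intro f k
    by_cases hk : 0 = k
    · convert (ofFun m n V f).2 using 1
      funext x
      exact proj_of_mem (hk ▸ algebraMap_mem_degree (f x))
    · convert (0 : SF m n V).2 using 1
      funext x
      exact proj_of_mem_ne (algebraMap_mem_degree (f x)) hk
  case sec =>
    intro σ k
    by_cases hk : 1 = k
    · convert (ofSec m n V σ).2 using 1
      funext x
      exact proj_of_mem (hk ▸ ι_mem_degree (σ x))
    · convert (0 : SF m n V).2 using 1
      funext x
      exact proj_of_mem_ne (ι_mem_degree (σ x)) hk
  case add =>
    intro a b ha hb k
    convert add_mem (ha k) (hb k) using 1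
    funext x
    exact map_add _ _ _
  case mul =>
    intro a b ha hb k
    convert (∑ ij ∈ Finset.HasAntidiagonal.antidiagonal k,
      (⟨_, ha ij.1⟩ : SF m n V) * ⟨_, hb ij.2⟩ : SF m n V).2 using 1
    funext x
    rw [coe_sum_apply]
    exact proj_mul _ _ _

/-- The component of degree `k` of a superfunction. -/
def pr (k : ℕ) : SF m n V →ₗ[ℝ] SF m n V where
  toFun a := ⟨fun x => proj k (a.1 x), proj_mem_superfunctions k a⟩
  map_add' _ _ := SF.ext fun _ => map_add (proj k) _ _
  map_smul' _ _ := SF.ext fun _ => map_smul (proj k) _ _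

@[simp] theorem coe_pr_apply (k : ℕ) (a : SF m n V) (x : M) : (pr k a).1 x = proj k (a.1 x) := rfl

/-! ### Derivations from pointwise data -/

/-- Only the germ at `x` matters, so the argument may be taken polynomial in the generators, and the
twisted Leibniz rule reduces to them. This is the source of all uniqueness statements for
supervector fields. -/
theorem eq_zero_of_generators {i : ZMod 2} {x : M} (P : SF m n V →ₗ[ℝ] ExteriorAlgebra ℝ (V x))
    (hmul : ∀ a b, P (a * b) = P a * b.1 x + (tw i a).1 x * P b)
    (hloc : ∀ a b : SF m n V, (∀ᶠ y in 𝓝 x, a.1 y = b.1 y) → P a = P b)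
    (hfun : ∀ f, P (ofFun m n V f) = 0) (hsec : ∀ σ, P (ofSec m n V σ) = 0) (a : SF m n V) :
    P a = 0 := by
  obtain ⟨b, hb, h⟩ := exists_mem_adjoin a x
  rw [hloc a b h]
  clear h
  refine adjoin_superfunction_induction (motive := fun b => P b = 0) ?fn ?sec ?add ?mul hb
  case fn =>
    intro f
    exact hfun f
  case sec =>
    intro σ
    exact hsec σ
  case add =>
    intro a b ha hb
    rw [map_add, ha, hb, add_zero]
  case mul =>
    intro a b ha hb
    rw [hmul, ha, hb, zero_mul, mul_zero, add_zero]

theorem IsDer.map_mul {i : ZMod 2} {D : SF m n V →ₗ[ℝ] SF m n V} (h : IsDer i D)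
    (a b : SF m n V) : D (a * b) = D a * b + tw i a * D b := by
  obtain ⟨a₀, a₁, h₀, h₁, rfl⟩ := exists_parity_decomposition a
  rw [add_mul, map_add, h.leibniz _ _ _ h₀, h.leibniz _ _ _ h₁, map_add, map_add, tw_eq_smul h₀,
    tw_eq_smul h₁, add_mul, add_mul, smul_mul_assoc, smul_mul_assoc]
  abel

/-- Twisted point derivations which depend only on germs and have smooth values on the generators
define a homogeneous supervector field. -/
theorem exists_homDer {i : ZMod 2} (P : ∀ x : M, SF m n V →ₗ[ℝ] ExteriorAlgebra ℝ (V x))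
    (hmul : ∀ x a b, P x (a * b) = P x a * b.1 x + (tw i a).1 x * P x b)
    (hloc : ∀ (x : M) (a b : SF m n V), (∀ᶠ y in 𝓝 x, a.1 y = b.1 y) → P x a = P x b)
    (hfun : ∀ f, ∃ c : SF m n V, HasParity i c ∧ ∀ x, P x (ofFun m n V f) = c.1 x)
    (hsec : ∀ σ, ∃ c : SF m n V, HasParity (i + 1) c ∧ ∀ x, P x (ofSec m n V σ) = c.1 x) :
    ∃ D : HomDer m n V i, ∀ a x, (D a).1 x = P x a := by
  have hmem : ∀ a, (fun x => P x a) ∈ Superfunctions m n V := by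
    intro a
    refine mem_superfunctions_of_eventually fun x₀ => ?_
    obtain ⟨b, hb, h⟩ := exists_mem_adjoin a x₀
    suffices (fun x => P x b) ∈ Superfunctions m n V from
      ⟨⟨_, this⟩, by filter_upwards [eventually_eventually_nhds.2 h] with x hx; exact hloc x a b hx⟩
    clear h
    refine adjoin_superfunction_induction (motive := fun b => (fun x => P x b) ∈ Superfunctions m n V) ?fn ?sec ?add ?mul hb
    case fn =>
      intro f
      obtain ⟨c, -, hc⟩ := hfun f
      convert c.2 using 1
      exact funext hc
    case sec =>
      intro σ
      obtain ⟨c, -, hc⟩ := hsec σ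
      convert c.2 using 1
      exact funext hc
    case add =>
      intro a b ha hb
      convert add_mem ha hb using 1
      funext x
      exact map_add _ _ _
    case mul =>
      intro a b ha hb
      convert ((⟨_, ha⟩ : SF m n V) * b + tw i a * ⟨_, hb⟩ : SF m n V).2 using 1
      funext x
      exact hmul x a b
  let D : SF m n V →ₗ[ℝ] SF m n V :=
    { toFun := fun a => ⟨fun x => P x a, hmem a⟩
      map_add' := fun _ _ => SF.ext fun x => map_add _ _ _
      map_smul' := fun _ _ => SF.ext fun x => map_smul _ _ _ }
  have hD : ∀ a b, D (a * b) = D a * b + tw i a * D b := fun a b => SF.ext fun x => hmul x a b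
  -- Parity `i` of `D` amounts to this commutation rule. Conjugating `D` by `tau` gives another
  -- derivation with the same twist, so the difference `Q` at `x` only has to be tested on
  -- generators.
  have htau : ∀ a, D (tau a) = sgn i • tau (D a) := by
    intro a
    refine SF.ext fun x => ?_
    let Q : SF m n V →ₗ[ℝ] ExteriorAlgebra ℝ (V x) :=
      P x - sgn i • (ev x ∘ₗ tau.toLinearMap ∘ₗ D ∘ₗ tau.toLinearMap)
    have hQ : ∀ a, Q a = P x a - sgn i • (tau (D (tau a))).1 x := fun a => rfl
    have key : ∀ a, Q a = 0 := by
      refine eq_zero_of_generators (i := i) Q ?_ ?_ ?_ ?_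
      · intro a b
        rw [hQ, hQ, hQ, hmul, map_mul, hD, map_add, map_mul, map_mul, tau_tau, tw_tau, tau_tau]
        simp only [coe_add_apply, coe_mul_apply, smul_add, sub_mul, mul_sub, smul_mul_assoc,
          mul_smul_comm]
        abel
      · intro a b h
        rw [hQ, hQ, hloc x a b h, coe_tau_apply, coe_tau_apply]
        have : (D (tau a)).1 x = (D (tau b)).1 x := by
          refine hloc x _ _ ?_
          filter_upwards [h] with y hy
          rw [coe_tau_apply, coe_tau_apply, hy]
        rw [this]
      · intro f
        obtain ⟨c, hc, h⟩ := hfun f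
        have hc' : D (ofFun m n V f) = c := SF.ext h
        rw [hQ, hasParity_iff.1 (hasParity_ofFun f), sgn_zero, one_smul, hc', hasParity_iff.1 hc, h,
          coe_smul_apply, smul_smul, sgn_mul_self, one_smul, sub_self]
      · intro σ
        obtain ⟨c, hc, h⟩ := hsec σ
        have hc' : D (ofSec m n V σ) = c := SF.ext h
        rw [hQ, hasParity_iff.1 (hasParity_ofSec σ), sgn_one, neg_one_smul, map_neg, hc', map_neg,
          hasParity_iff.1 hc, h, coe_neg_apply, coe_smul_apply, sgn_add, sgn_one, smul_neg,
          smul_smul, mul_neg, mul_one, mul_neg, sgn_mul_self, neg_smul, one_smul, neg_neg, sub_self]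
    have h := key (tau a)
    rw [hQ, tau_tau, sub_eq_zero] at h
    exact h
  refine ⟨⟨D, ?_, ?_⟩, fun a x => rfl⟩
  · intro j a ha
    have h := htau a
    rw [hasParity_iff.1 ha, map_smul] at h
    rw [hasParity_iff, sgn_add, mul_smul, h, smul_smul, sgn_mul_self, one_smul]
  · intro j a b ha
    rw [hD, tw_eq_smul ha, smul_mul_assoc]

theorem exists_eulerField : ∃ D : HomDer m n V 0, ∀ a x, (D a).1 x = eul (a.1 x) := by
  refine exists_homDer (fun x => eul ∘ₗ ev x) ?_ ?_ ?_ ?_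
  · intro x a b
    rw [tw_zero]
    exact eul_mul _ _
  · intro x a b h
    exact congrArg eul h.self_of_nhds
  · intro f
    refine ⟨0, fun x => zero_mem _, fun x => ?_⟩
    have := eul_of_mem (algebraMap_mem_degree (W := V x) (f x))
    rw [Nat.cast_zero, zero_smul] at this
    exact this
  · intro σ
    refine ⟨ofSec m n V σ, hasParity_ofSec σ, fun x => ?_⟩
    have := eul_of_mem (ι_mem_degree (σ x))
    rw [Nat.cast_one, one_smul] at this
    exact this

variable (m n V) in
/-- The Euler field: the even supervector field which is multiplication by `k` in degree `k`. -/
def eps : HomDer m n V 0 := exists_eulerField.choose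

@[simp] theorem coe_eps_apply (a : SF m n V) (x : M) : (eps m n V a).1 x = eul (a.1 x) :=
  exists_eulerField.choose_spec a x

end Local

section Insertion

variable {m n : ℕ} {M : Type*} [TopologicalSpace M] [ChartedSpace (EuclideanSpace ℝ (Fin m)) M]
  {V : M → Type*} [TopologicalSpace (TotalSpace (EuclideanSpace ℝ (Fin n)) V)]
  [∀ x, AddCommGroup (V x)] [∀ x, Module ℝ (V x)] [∀ x, TopologicalSpace (V x)]
  [FiberBundle (EuclideanSpace ℝ (Fin n)) V]

theorem exists_insertion (χ : DualSec m n V) :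
    ∃ D : HomDer m n V 1, ∀ a x, (D a).1 x = contr (χ.toFun x) (a.1 x) := by
  refine exists_homDer (fun x => contr (χ.toFun x) ∘ₗ ev x) ?_ ?_ ?_ ?_
  · intro x a b
    rw [tw_one]
    exact contr_mul _ _ _
  · intro x a b h
    exact congrArg (contr (χ.toFun x)) h.self_of_nhds
  · intro f
    exact ⟨0, fun x => zero_mem _, fun x => contr_algebraMap _ _⟩
  · intro σ
    exact ⟨ofFun m n V ⟨_, χ.smooth σ⟩, hasParity_ofFun _, fun x => contr_ι _ _⟩

/-- The supervector field `i_χ`. -/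
def ins (χ : DualSec m n V) : HomDer m n V 1 := (exists_insertion χ).choose

@[simp] theorem coe_ins_apply (χ : DualSec m n V) (a : SF m n V) (x : M) :
    (ins χ a).1 x = contr (χ.toFun x) (a.1 x) :=
  (exists_insertion χ).choose_spec a x

theorem isInsertion_ins [IsManifold (𝓡 m) ∞ M] (χ : DualSec m n V) : IsInsertion χ (ins χ) := by
  refine ⟨fun f x => ?_, fun σ x => ?_⟩
  · rw [coe_ins_apply, coe_ofFun_apply, contr_algebraMap, Pi.zero_apply, map_zero, map_zero]
  · rw [coe_ins_apply, coe_ofSec_apply, contr_ι]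

end Insertion

/-! ## Hadamard's lemma -/

section Hadamard

open MeasureTheory intervalIntegral

/-- Differentiation under the integral sign, iterated. The derivative takes values in `E →L[ℝ] F`,
so the induction must range over all targets `F`. Closed balls of `E` are compact, which supplies
the constant dominating bound. -/
theorem contDiff_nat_intervalIntegral {E : Type} [NormedAddCommGroup E] [NormedSpace ℝ E]
    [ProperSpace E] (k : ℕ) :
    ∀ {F : Type} [NormedAddCommGroup F] [NormedSpace ℝ F]
      {H : E × ℝ → F} (_ : ContDiff ℝ k H), ContDiff ℝ k (fun z => ∫ t in (0 : ℝ)..1, H (z, t)) := by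
  induction k with
  | zero =>
    intro F _ _ H hH
    have hc := hH.continuous
    exact contDiff_zero.2 (continuous_parametric_intervalIntegral_of_continuous' (by fun_prop) 0 1)
  | succ k ih =>
    intro F _ _ H hH
    have hH' : ContDiff ℝ ((k : ℕ∞ω) + 1) H := by exact_mod_cast hH
    let H' : E × ℝ → E →L[ℝ] F := fun p => (fderiv ℝ H p).comp (ContinuousLinearMap.inl ℝ E ℝ)
    have hfd : ContDiff ℝ k (fderiv ℝ H) := (contDiff_succ_iff_fderiv.1 hH').2.2
    have hcH' : ContDiff ℝ k H' := hfd.clm_comp contDiff_const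
    have hc' : Continuous H' := hcH'.continuous
    have hc : Continuous H := hH'.continuous
    have hd : ∀ z t, HasFDerivAt (fun z => H (z, t)) (H' (z, t)) z := by
      intro z t
      have h1 : HasFDerivAt H (fderiv ℝ H (z, t)) (z, t) :=
        (((contDiff_succ_iff_fderiv.1 hH').1) (z, t)).hasFDerivAt
      exact h1.comp z (hasFDerivAt_prodMk_left z t)
    rw [show (((k + 1 : ℕ)) : ℕ∞ω) = (k : ℕ∞ω) + 1 by norm_cast, contDiff_succ_iff_hasFDerivAt]
    refine ⟨fun z => ∫ t in (0 : ℝ)..1, H' (z, t), ih hcH', fun z => ?_⟩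
    obtain ⟨C, hC⟩ := ((isCompact_closedBall z 1).prod (isCompact_Icc (a := (0 : ℝ)) (b := 1))).exists_bound_of_continuousOn
      hc'.continuousOn
    refine hasFDerivAt_integral_of_dominated_of_fderiv_le (F' := fun z t => H' (z, t))
      (bound := fun _ => C) (Metric.closedBall_mem_nhds z one_pos) ?_ ?_ ?_ ?_ ?_ ?_
    · exact Filter.Eventually.of_forall fun z => (by fun_prop : Continuous fun t => H (z, t)).aestronglyMeasurable
    · exact (by fun_prop : Continuous fun t => H (z, t)).intervalIntegrable _ _
    · exact (by fun_prop : Continuous fun t => H' (z, t)).aestronglyMeasurable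
    · refine Filter.Eventually.of_forall fun t ht y hy => hC (y, t) ⟨hy, ?_⟩
      rw [Set.uIoc_of_le zero_le_one] at ht
      exact ⟨ht.1.le, ht.2⟩
    · exact intervalIntegrable_const
    · exact Filter.Eventually.of_forall fun t _ y _ => hd y t

/-- The coefficient is G_i(z) = ∫₀¹ ∂_i F(c + t(z - c)) dt, by the fundamental theorem of calculus
along the segment from `c` to `z`. -/
theorem exists_hadamard {m : ℕ} {F : EuclideanSpace ℝ (Fin m) → ℝ} (hF : ContDiff ℝ ∞ F)
    (c : EuclideanSpace ℝ (Fin m)) :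
    ∃ G : Fin m → EuclideanSpace ℝ (Fin m) → ℝ, (∀ i, ContDiff ℝ ∞ (G i)) ∧
      (∀ z, F z = F c + ∑ i, (z i - c i) * G i z) ∧
      ∀ i, G i c = fderiv ℝ F c (EuclideanSpace.single i 1) := by
  have hF' : ContDiff ℝ ∞ (fderiv ℝ F) := hF.fderiv_right (by norm_cast)
  have hc' := hF'.continuous
  refine ⟨fun i z => ∫ t in (0 : ℝ)..1, fderiv ℝ F (c + t • (z - c)) (EuclideanSpace.single i 1),
    fun i => ?_, fun z => ?_, fun i => by simp⟩
  · refine contDiff_infty.2 fun k => ?_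
    refine contDiff_nat_intervalIntegral k
      (H := fun p => fderiv ℝ F (c + p.2 • (p.1 - c)) (EuclideanSpace.single i 1)) ?_
    have : ContDiff ℝ k (fderiv ℝ F) := hF'.of_le (by exact_mod_cast le_top)
    have h2 : ContDiff ℝ k fun p : EuclideanSpace ℝ (Fin m) × ℝ => c + p.2 • (p.1 - c) := by
      fun_prop
    exact (this.comp h2).clm_apply contDiff_const
  · have hd : ∀ t : ℝ, HasDerivAt (fun t : ℝ => F (c + t • (z - c)))
        (fderiv ℝ F (c + t • (z - c)) (z - c)) t := by
      intro t
      have h1 : HasFDerivAt F (fderiv ℝ F (c + t • (z - c))) (c + t • (z - c)) :=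
        ((hF.differentiable (by simp)) _).hasFDerivAt
      have h2 : HasDerivAt (fun t : ℝ => c + t • (z - c)) (z - c) t := by
        simpa using ((hasDerivAt_id t).smul_const (z - c)).const_add c
      exact h1.comp_hasDerivAt t h2
    have h := integral_eq_sub_of_hasDerivAt (a := 0) (b := 1) (fun t _ => hd t)
      ((by fun_prop : Continuous fun t : ℝ => fderiv ℝ F (c + t • (z - c)) (z - c)).intervalIntegrable
        _ _)
    have hz : z - c = ∑ i, (z i - c i) • EuclideanSpace.single i (1 : ℝ) := by
      have := (EuclideanSpace.basisFun (Fin m) ℝ).sum_repr (z - c)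
      simpa using this.symm
    have h3 : ∀ t : ℝ, fderiv ℝ F (c + t • (z - c)) (z - c) =
        ∑ i, (z i - c i) * fderiv ℝ F (c + t • (z - c)) (EuclideanSpace.single i 1) := by
      intro t
      generalize fderiv ℝ F (c + t • (z - c)) = A
      conv_lhs => rw [hz]
      simp [map_sum]
    simp only [h3] at h
    rw [intervalIntegral.integral_finsetSum] at h
    · simp only [intervalIntegral.integral_const_mul] at h
      rw [h]
      simp
    · intro i _
      exact (by fun_prop : Continuous fun t : ℝ => (z i - c i) *
        fderiv ℝ F (c + t • (z - c)) (EuclideanSpace.single i 1)).intervalIntegrable _ _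

end Hadamard

/-! ### Bump functions and functions vanishing to second order -/

section Bump

variable {m : ℕ} {M : Type*} [TopologicalSpace M] [T2Space M]
  [ChartedSpace (EuclideanSpace ℝ (Fin m)) M] [IsManifold (𝓡 m) ∞ M]

theorem exists_bump (x₀ : M) {u : Set M} (hu : u ∈ 𝓝 x₀) :
    ∃ ρ : C^∞⟮𝓡 m, M; ℝ⟯, (∀ᶠ x in 𝓝 x₀, ρ x = 1) ∧ tsupport ρ ⊆ u := by
  obtain ⟨f, -, hf⟩ := (SmoothBumpFunction.nhds_basis_tsupport (I := 𝓡 m) x₀).mem_iff.1 hu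
  exact ⟨⟨f, f.contMDiff⟩, f.eventuallyEq_one, hf⟩

theorem contMDiff_mul_of_tsupport {ρ : C^∞⟮𝓡 m, M; ℝ⟯} {u : Set M} (hu : IsOpen u)
    (hρ : tsupport ρ ⊆ u) {g : M → ℝ} (hg : ContMDiffOn (𝓡 m) 𝓘(ℝ, ℝ) ∞ g u) :
    ContMDiff (𝓡 m) 𝓘(ℝ, ℝ) ∞ (fun x => ρ x * g x) := by
  refine contMDiff_of_tsupport fun x hx => ?_
  have hx' : x ∈ u := hρ (tsupport_mul_subset_left hx)
  exact ρ.contMDiff.contMDiffAt.mul (hg.contMDiffAt (hu.mem_nhds hx'))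

theorem mdifferentiableAt_of_smooth (f : C^∞⟮𝓡 m, M; ℝ⟯) (x : M) :
    MDifferentiableAt (𝓡 m) 𝓘(ℝ, ℝ) f x :=
  f.contMDiff.mdifferentiableAt (by simp)

theorem mvfderiv_congr {f g : M → ℝ} {x : M} (h : ∀ᶠ y in 𝓝 x, f y = g y) :
    mvfderiv (𝓡 m) f x = mvfderiv (𝓡 m) g x := by
  have h' : f =ᶠ[𝓝 x] g := h
  ext v
  simp only [mvfderiv, ContinuousLinearMap.comp_apply]
  rw [h'.mfderiv_eq]
  rfl

/-- A smooth function vanishing to second order at `y` is near `y` a sum of products of smooth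
functions vanishing at `y`. -/
theorem exists_eq_sum_mul {f : C^∞⟮𝓡 m, M; ℝ⟯} {y : M} (h0 : f y = 0)
    (h1 : mvfderiv (𝓡 m) f y = 0) :
    ∃ g h : Fin m → C^∞⟮𝓡 m, M; ℝ⟯, (∀ i, g i y = 0) ∧ (∀ i, h i y = 0) ∧
      ∀ᶠ x in 𝓝 y, f x = ∑ i, g i x * h i x := by
  set φ := extChartAt (𝓡 m) y with hφ
  set c := φ y with hc
  have htarget : φ.target ∈ 𝓝 c := extChartAt_target_mem_nhds y
  have hopen : IsOpen φ.target := isOpen_extChartAt_target y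
  obtain ⟨ψ, hψ1, hψ⟩ := exists_bump (m := m) c htarget
  -- Hadamard's lemma is stated for functions on the whole Euclidean space. The cutoff `ψ` extends
  -- the chart expression of `f` by zero without changing its germ at `c`.
  let F : EuclideanSpace ℝ (Fin m) → ℝ := fun z => ψ z * f (φ.symm z)
  have hfs : ContMDiffOn (𝓡 m) 𝓘(ℝ, ℝ) ∞ (fun z => f (φ.symm z)) φ.target :=
    f.contMDiff.comp_contMDiffOn (contMDiffOn_extChartAt_symm y)
  have hF : ContDiff ℝ ∞ F := by
    rw [← contMDiff_iff_contDiff]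
    refine contMDiff_of_tsupport fun z hz => ?_
    have hz' : z ∈ φ.target := hψ (tsupport_mul_subset_left hz)
    exact ψ.contMDiff.contMDiffAt.mul (hfs.contMDiffAt (hopen.mem_nhds hz'))
  have hFeq : F =ᶠ[𝓝 c] fun z => f (φ.symm z) := by
    filter_upwards [hψ1] with z hz
    simp only [F, hz, one_mul]
  have hF0 : F c = 0 := by
    rw [hFeq.eq_of_nhds, hc, extChartAt_to_inv, h0]
  have hF1 : fderiv ℝ F c = 0 := by
    rw [hFeq.fderiv_eq]
    have h2 : mfderiv (𝓡 m) 𝓘(ℝ, ℝ) f y = 0 := h1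
    have h3 := mdifferentiableAt_of_smooth f y
    simp only [mfderiv, h3] at h2
    rw [ModelWithCorners.Boundaryless.range_eq_univ, fderivWithin_univ] at h2
    exact h2
  obtain ⟨G, hG, hGF, hGc⟩ := exists_hadamard hF c
  obtain ⟨ρ, hρ1, hρ⟩ := exists_bump (m := m) y (chart_source_mem_nhds (EuclideanSpace ℝ (Fin m)) y)
  have hsrc : IsOpen (chartAt (EuclideanSpace ℝ (Fin m)) y).source := (chartAt _ y).open_source
  have hφs : ContMDiffOn (𝓡 m) 𝓘(ℝ, EuclideanSpace ℝ (Fin m)) ∞ φ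
    (chartAt (EuclideanSpace ℝ (Fin m)) y).source := contMDiffOn_extChartAt
  have e1 : ∀ i, ContMDiffOn (𝓡 m) 𝓘(ℝ, ℝ) ∞ (fun x => φ x i - c i)
      (chartAt (EuclideanSpace ℝ (Fin m)) y).source := fun i =>
    (show ContDiff ℝ ∞ fun z : EuclideanSpace ℝ (Fin m) => z i - c i by fun_prop).contMDiff.comp_contMDiffOn hφs
  have e2 : ∀ i, ContMDiffOn (𝓡 m) 𝓘(ℝ, ℝ) ∞ (fun x => G i (φ x))
      (chartAt (EuclideanSpace ℝ (Fin m)) y).source := fun i =>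
    (hG i).contMDiff.comp_contMDiffOn hφs
  -- The factors are z_i - c_i and G_i, pulled back by the chart and cut off by `ρ`. The second
  -- vanishes at `y` because G_i(c) = ∂_i F(c) = 0.
  refine ⟨fun i => ⟨_, contMDiff_mul_of_tsupport hsrc hρ (e1 i)⟩,
    fun i => ⟨_, contMDiff_mul_of_tsupport hsrc hρ (e2 i)⟩, fun i => ?_, fun i => ?_, ?_⟩
  · change ρ y * (c i - c i) = 0
    rw [sub_self, mul_zero]
  · change ρ y * G i c = 0
    rw [hGc, hF1, zero_apply, mul_zero]
  · have hcont : ContinuousAt φ y := continuousAt_extChartAt y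
    filter_upwards [hρ1, hcont.eventually hFeq, extChartAt_source_mem_nhds (I := 𝓡 m) y]
      with x hx1 hx2 hx3
    have h4 : f x = F (φ x) := by rw [hx2, φ.left_inv hx3]
    rw [h4, hGF, hF0, zero_add]
    refine Finset.sum_congr rfl fun i _ => ?_
    change _ = ρ x * (φ x i - c i) * (ρ x * G i (φ x))
    rw [hx1, one_mul, one_mul]

end Bump

/-! ## Local frames -/

section LocalFrames

variable {m r : ℕ} {M : Type*} [TopologicalSpace M] [T2Space M]
  [ChartedSpace (EuclideanSpace ℝ (Fin m)) M] [IsManifold (𝓡 m) ∞ M]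
  {W : M → Type*} [TopologicalSpace (TotalSpace (EuclideanSpace ℝ (Fin r)) W)]
  [∀ x, AddCommGroup (W x)] [∀ x, Module ℝ (W x)] [∀ x, TopologicalSpace (W x)]
  [FiberBundle (EuclideanSpace ℝ (Fin r)) W] [VectorBundle ℝ (EuclideanSpace ℝ (Fin r)) W]
  [ContMDiffVectorBundle ∞ (EuclideanSpace ℝ (Fin r)) W (𝓡 m)]

/-- Near every point there are globally defined smooth sections forming a frame, and a dual frame of
globally defined smooth sections of the dual bundle. -/
theorem exists_local_frame (x₀ : M) :
    ∃ (s : Fin r → Sec m r W) (c : Fin r → ∀ x, Module.Dual ℝ (W x)),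
      (∀ j (σ : Sec m r W), ContMDiff (𝓡 m) 𝓘(ℝ, ℝ) ∞ fun x => c j x (σ x)) ∧
      ∀ᶠ x in 𝓝 x₀, (∀ i j, c i x (s j x) = if i = j then 1 else 0) ∧
        (∀ w, ∑ j, c j x w • s j x = w) ∧
        (∀ w j, c j x w =
          (trivializationAt (EuclideanSpace ℝ (Fin r)) W x₀ ⟨x, w⟩).2 j) ∧
        ∀ w j, ContMDiffAt ((𝓡 m).prod 𝓘(ℝ, EuclideanSpace ℝ (Fin r))) 𝓘(ℝ, ℝ) ∞
          (fun p : TotalSpace (EuclideanSpace ℝ (Fin r)) W => c j p.1 p.2) ⟨x, w⟩ := by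
  set e := trivializationAt (EuclideanSpace ℝ (Fin r)) W x₀ with he
  have hopen := e.open_baseSet
  have hmem : e.baseSet ∈ 𝓝 x₀ := hopen.mem_nhds (FiberBundle.mem_baseSet_trivializationAt' x₀)
  obtain ⟨ρ, hρ1, hρ⟩ := exists_bump (m := m) x₀ hmem
  let b := (EuclideanSpace.basisFun (Fin r) ℝ).toBasis
  -- Multiplication by `ρ` makes the frame, and below the dual forms, global. They are dual to each
  -- other only where `ρ` equals 1.
  let s : Fin r → Sec m r W := fun j =>
    ⟨fun x => ρ x • e.localFrame b j x,
      ContMDiffOn.smul_section_of_tsupport ρ.contMDiff.contMDiffOn hopen hρ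
        (e.contMDiffOn_localFrame_baseSet ∞ b j)⟩
  let c : Fin r → ∀ x, Module.Dual ℝ (W x) := fun j x =>
    ρ x • ((EuclideanSpace.proj j : EuclideanSpace ℝ (Fin r) →L[ℝ] ℝ).toLinearMap ∘ₗ
      e.linearMapAt ℝ x)
  have hc : ∀ j x w, x ∈ e.baseSet → c j x w = ρ x * (e ⟨x, w⟩).2 j := by
    intro j x w hx
    change ρ x * (e.linearMapAt ℝ x w) j = _
    rw [e.linearMapAt_apply, if_pos hx]
  -- Off the base set `linearMapAt` is zero by convention. The value `ρ x * 0` has the shape needed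
  -- to compare it with the cut-off component, where `ρ x = 0`.
  have hc0 : ∀ j x w, x ∉ e.baseSet → c j x w = ρ x * 0 := by
    intro j x w hx
    change ρ x * (e.linearMapAt ℝ x w) j = _
    rw [e.linearMapAt_apply, if_neg hx]
    rfl
  refine ⟨s, c, ?_, ?_⟩
  · intro j σ
    have h1 : ContMDiffOn (𝓡 m) 𝓘(ℝ, ℝ) ∞ (fun x => (e ⟨x, σ x⟩).2 j) e.baseSet := by
      intro x hx
      have h2 := (e.contMDiffAt_section_iff (IB := 𝓡 m) (n := ∞) (s := σ) hx).1
        σ.contMDiff.contMDiffAt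
      have h3 : ContDiff ℝ ∞ fun z : EuclideanSpace ℝ (Fin r) => z j := by fun_prop
      exact (h3.contMDiff.contMDiffAt.comp x h2).contMDiffWithinAt
    convert contMDiff_mul_of_tsupport hopen hρ h1 using 1
    funext x
    by_cases hx : x ∈ e.baseSet
    · exact hc j x _ hx
    · rw [hc0 j x _ hx, image_eq_zero_of_notMem_tsupport fun h => hx (hρ h), zero_mul, zero_mul]
  · filter_upwards [hρ1, eventually_eventually_nhds.2 hρ1, hmem] with x hx1 hx2 hx3
    have hb : ∀ j, e ⟨x, s j x⟩ = (x, b j) := by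
      intro j
      have h4 : s j x = e.symm x (b j) := by
        change ρ x • e.localFrame b j x = _
        rw [hx1, one_smul, e.localFrame_apply_of_mem_baseSet b hx3]
        rfl
      rw [h4, e.apply_mk_symm hx3]
    have hcs : ∀ w j, c j x w = (e ⟨x, w⟩).2 j := fun w j => by rw [hc j x w hx3, hx1, one_mul]
    refine ⟨fun i j => ?_, fun w => ?_, hcs, fun w j => ?_⟩
    · rw [hcs, hb]
      simp [b, EuclideanSpace.basisFun_apply, PiLp.single_apply]
    · have h5 : Function.Injective (e.linearEquivAt ℝ x hx3) := LinearEquiv.injective _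
      apply h5
      rw [map_sum]
      simp only [map_smul]
      have h6 : ∀ w, e.linearEquivAt ℝ x hx3 w = (e ⟨x, w⟩).2 := fun w => rfl
      simp only [h6, hb, hcs]
      have := b.sum_repr (e ⟨x, w⟩).2
      simpa [b] using this
    · have h7 : ContMDiffAt ((𝓡 m).prod 𝓘(ℝ, EuclideanSpace ℝ (Fin r)))
          ((𝓡 m).prod 𝓘(ℝ, EuclideanSpace ℝ (Fin r))) ∞ e ⟨x, w⟩ := by
        refine (e.contMDiffOn (IB := 𝓡 m) (n := ∞)).contMDiffAt (e.open_source.mem_nhds ?_)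
        rw [e.mem_source]
        exact hx3
      have h8 : ContDiff ℝ ∞ fun z : EuclideanSpace ℝ (Fin r) => z j := by fun_prop
      have h9 : ContMDiffAt ((𝓡 m).prod 𝓘(ℝ, EuclideanSpace ℝ (Fin r))) 𝓘(ℝ, ℝ) ∞
          (fun p : TotalSpace (EuclideanSpace ℝ (Fin r)) W => (e p).2 j) ⟨x, w⟩ :=
        h8.contMDiff.contMDiffAt.comp _ h7.snd
      refine h9.congr_of_eventuallyEq ?_
      have hcont : ContinuousAt (TotalSpace.proj :
          TotalSpace (EuclideanSpace ℝ (Fin r)) W → M) ⟨x, w⟩ :=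
        (FiberBundle.continuous_proj _ _).continuousAt
      filter_upwards [hcont.eventually (hx2 : ∀ᶠ y in 𝓝 x, ρ y = 1),
        hcont.eventually (hopen.mem_nhds hx3 : ∀ᶠ y in 𝓝 x, y ∈ e.baseSet)] with p hp1 hp2
      have := hc j p.1 p.2 hp2
      rw [this, show ρ p.1 = 1 from hp1, one_mul]

end LocalFrames

/-! ### Coordinate frames and point derivations -/

section Frames

variable {m n : ℕ} {M : Type*} [TopologicalSpace M] [T2Space M]
  [ChartedSpace (EuclideanSpace ℝ (Fin m)) M] [IsManifold (𝓡 m) ∞ M]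
  {V : M → Type*} [TopologicalSpace (TotalSpace (EuclideanSpace ℝ (Fin n)) V)]
  [∀ x, AddCommGroup (V x)] [∀ x, Module ℝ (V x)] [∀ x, TopologicalSpace (V x)]
  [FiberBundle (EuclideanSpace ℝ (Fin n)) V]

/-- The differential at `x`, as a linear map on smooth functions. -/
def dAt (x : M) : C^∞⟮𝓡 m, M; ℝ⟯ →ₗ[ℝ] TangentSpace (𝓡 m) x →L[ℝ] ℝ where
  toFun f := mvfderiv (𝓡 m) f x
  map_add' f g := mvfderiv_add (mdifferentiableAt_of_smooth f x) (mdifferentiableAt_of_smooth g x)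
  map_smul' r f := by
    have h : mvfderiv (𝓡 m) ((fun _ : M => r) • (f : M → ℝ)) x = _ :=
      mvfderiv_smul (I := 𝓡 m) (a := fun _ : M => r) (x := x) mdifferentiableAt_const
        (mdifferentiableAt_of_smooth f x)
    rw [mvfderiv_const] at h
    ext v
    have h' := congrArg (fun A => A v) h
    rw [ContinuousLinearMap.zero_smulRight, add_zero] at h'
    exact h'

/-- Evaluation of smooth functions at `x`. -/
def evalAt (x : M) : C^∞⟮𝓡 m, M; ℝ⟯ →ₗ[ℝ] ℝ where
  toFun f := f x
  map_add' _ _ := rfl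
  map_smul' _ _ := rfl

theorem evalAt_apply (x : M) (f : C^∞⟮𝓡 m, M; ℝ⟯) : evalAt x f = f x := rfl

theorem dAt_mul (x : M) (f g : C^∞⟮𝓡 m, M; ℝ⟯) (v : TangentSpace (𝓡 m) x) :
    dAt x (f * g) v = f x * dAt x g v + g x * dAt x f v := by
  have h : mvfderiv (𝓡 m) ((f : M → ℝ) * (g : M → ℝ)) x = _ :=
    mvfderiv_mul (mdifferentiableAt_of_smooth f x) (mdifferentiableAt_of_smooth g x)
  exact congrArg (fun A => A v) h

theorem dAt_const (x : M) (r : ℝ) :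
    dAt x (ContMDiffMap.const r : C^∞⟮𝓡 m, M; ℝ⟯) = 0 :=
  mvfderiv_const r

theorem dAt_congr {x : M} {f g : C^∞⟮𝓡 m, M; ℝ⟯} (h : ∀ᶠ y in 𝓝 x, f y = g y) :
    dAt x f = dAt x g :=
  mvfderiv_congr h

variable (m n V) in
/-- Smooth functions, vector fields, sections of `V` and sections of `V*`, meant to be local
coordinates, a frame of the tangent bundle, a frame of `V` and the dual frame of `V*`. -/
structure Frame where
  f : Fin m → C^∞⟮𝓡 m, M; ℝ⟯
  X : Fin m → VecField m M
  s : Fin n → Sec m n V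
  χ : Fin n → DualSec m n V

/-- The functions and fields of a frame are dual bases at the point `x`, and the linear forms in it
depend smoothly on the point of the total space. -/
structure Frame.IsAt (fr : Frame m n V) (x : M) : Prop where
  dual_tangent : ∀ i j, dAt x (fr.f i) (fr.X j x) = if i = j then 1 else 0
  sum_tangent : ∀ v, ∑ i, dAt x (fr.f i) v • fr.X i x = v
  dual_fibre : ∀ i j, (fr.χ i).toFun x (fr.s j x) = if i = j then 1 else 0
  sum_fibre : ∀ w, ∑ j, (fr.χ j).toFun x w • fr.s j x = w
  smooth_tangent : ∀ v i, ContMDiffAt (𝓡 m).tangent 𝓘(ℝ, ℝ) ∞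
    (fun p : TangentBundle (𝓡 m) M => dAt p.1 (fr.f i) p.2) ⟨x, v⟩
  smooth_fibre : ∀ w j, ContMDiffAt ((𝓡 m).prod 𝓘(ℝ, EuclideanSpace ℝ (Fin n))) 𝓘(ℝ, ℝ) ∞
    (fun p : TotalSpace (EuclideanSpace ℝ (Fin n)) V => (fr.χ j).toFun p.1 p.2) ⟨x, w⟩

/-- The tangent frame comes from the trivialization of the tangent bundle at `x₀`, the functions
from the chart at `x₀`. The differential of that chart is that trivialization, so the differentials
of the coordinates are the dual frame. -/
theorem exists_frame [VectorBundle ℝ (EuclideanSpace ℝ (Fin n)) V]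
    [ContMDiffVectorBundle ∞ (EuclideanSpace ℝ (Fin n)) V (𝓡 m)] (x₀ : M) :
    ∃ fr : Frame m n V, ∀ᶠ x in 𝓝 x₀, fr.IsAt x := by
  obtain ⟨s, χ, hχ, hs⟩ := exists_local_frame (m := m) (r := n) (W := V) x₀
  obtain ⟨X, c, hc, hX⟩ := exists_local_frame (m := m) (r := m)
    (W := (TangentSpace (𝓡 m) : M → Type _)) x₀
  obtain ⟨ρ, hρ1, hρ⟩ := exists_bump (m := m) x₀
    (chart_source_mem_nhds (EuclideanSpace ℝ (Fin m)) x₀)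
  set φ := extChartAt (𝓡 m) x₀ with hφ
  have hsrc : IsOpen (chartAt (EuclideanSpace ℝ (Fin m)) x₀).source := (chartAt _ x₀).open_source
  have hφs : ContMDiffOn (𝓡 m) 𝓘(ℝ, EuclideanSpace ℝ (Fin m)) ∞ φ
    (chartAt (EuclideanSpace ℝ (Fin m)) x₀).source := contMDiffOn_extChartAt
  have e1 : ∀ i, ContMDiffOn (𝓡 m) 𝓘(ℝ, ℝ) ∞ (fun x => φ x i)
      (chartAt (EuclideanSpace ℝ (Fin m)) x₀).source := fun i =>
    (show ContDiff ℝ ∞ fun z : EuclideanSpace ℝ (Fin m) => z i by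
      fun_prop).contMDiff.comp_contMDiffOn hφs
  let f : Fin m → C^∞⟮𝓡 m, M; ℝ⟯ := fun i => ⟨_, contMDiff_mul_of_tsupport hsrc hρ (e1 i)⟩
  have hf : ∀ᶠ x in 𝓝 x₀, ∀ (i : Fin m) (v : TangentSpace (𝓡 m) x), dAt x (f i) v = c i x v := by
    filter_upwards [eventually_eventually_nhds.2 hρ1, hX,
      chart_source_mem_nhds (EuclideanSpace ℝ (Fin m)) x₀] with x hx1 hx2 hx3 i v
    rw [hx2.2.2.1 v i]
    have h1 : dAt x (f i) = mvfderiv (𝓡 m) (fun y => φ y i) x := by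
      refine mvfderiv_congr ?_
      filter_upwards [hx1] with y hy
      change ρ y * φ y i = _
      rw [hy, one_mul]
    have h2 : HasMFDerivAt (𝓡 m) 𝓘(ℝ, EuclideanSpace ℝ (Fin m)) φ x
        (mfderiv (𝓡 m) 𝓘(ℝ, EuclideanSpace ℝ (Fin m)) φ x) :=
      (mdifferentiableAt_extChartAt hx3).hasMFDerivAt
    have h3 := (EuclideanSpace.proj i : EuclideanSpace ℝ (Fin m) →L[ℝ] ℝ).hasMFDerivAt (x := φ x)
    have h4 := (h3.comp x h2).mfderiv
    have h5 := TangentBundle.continuousLinearMapAt_trivializationAt (I := 𝓡 m) hx3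
    rw [h1]
    change mfderiv (𝓡 m) 𝓘(ℝ, ℝ) ((EuclideanSpace.proj i : EuclideanSpace ℝ (Fin m) →L[ℝ] ℝ) ∘ φ)
      x v = _
    rw [h4]
    change (show EuclideanSpace ℝ (Fin m) from
      mfderiv (𝓡 m) 𝓘(ℝ, EuclideanSpace ℝ (Fin m)) φ x v) i = _
    have h6 : (trivializationAt (EuclideanSpace ℝ (Fin m)) (TangentSpace (𝓡 m)) x₀).continuousLinearMapAt
        ℝ x v = (trivializationAt (EuclideanSpace ℝ (Fin m)) (TangentSpace (𝓡 m)) x₀ ⟨x, v⟩).2 := by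
      rw [Trivialization.continuousLinearMapAt_apply, Trivialization.linearMapAt_apply]
      exact if_pos hx3
    rw [← h5]
    exact congrArg (fun z : EuclideanSpace ℝ (Fin m) => z i) h6
  refine ⟨⟨f, X, s, fun j => ⟨χ j, hχ j⟩⟩, ?_⟩
  filter_upwards [hs, hX, eventually_eventually_nhds.2 hf] with x hx1 hx2 hx3
  refine ⟨fun i j => ?_, fun v => ?_, hx1.1, hx1.2.1, fun v i => ?_, hx1.2.2.2⟩
  · rw [hx3.self_of_nhds, hx2.1]
  · simp only [hx3.self_of_nhds, hx2.2.1]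
  · refine (hx2.2.2.2 v i).congr_of_eventuallyEq ?_
    have hcont : ContinuousAt (TotalSpace.proj : TangentBundle (𝓡 m) M → M) ⟨x, v⟩ :=
      (FiberBundle.continuous_proj _ _).continuousAt
    filter_upwards [hcont.eventually hx3] with p hp
    exact hp i p.2

theorem ofFun_add (f g : C^∞⟮𝓡 m, M; ℝ⟯) :
    ofFun m n V (f + g) = ofFun m n V f + ofFun m n V g :=
  SF.ext fun x => map_add (algebraMap ℝ (ExteriorAlgebra ℝ (V x))) _ _

theorem ofFun_mul (f g : C^∞⟮𝓡 m, M; ℝ⟯) :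
    ofFun m n V (f * g) = ofFun m n V f * ofFun m n V g :=
  SF.ext fun x => map_mul (algebraMap ℝ (ExteriorAlgebra ℝ (V x))) _ _

theorem ofFun_smul (r : ℝ) (f : C^∞⟮𝓡 m, M; ℝ⟯) :
    ofFun m n V (r • f) = r • ofFun m n V f :=
  SF.ext fun x => (Algebra.linearMap ℝ (ExteriorAlgebra ℝ (V x))).map_smul r (f x)

variable (m n V) in
/-- The inclusion of the smooth functions into the superfunctions, as a linear map. -/
def ofFunₗ : C^∞⟮𝓡 m, M; ℝ⟯ →ₗ[ℝ] SF m n V where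
  toFun := ofFun m n V
  map_add' := ofFun_add
  map_smul' := ofFun_smul

/-- A point derivation is determined by its values on coordinate functions. -/
theorem pointDerivation_ofFun {i : ZMod 2} {x : M}
    (P : SF m n V →ₗ[ℝ] ExteriorAlgebra ℝ (V x))
    (hmul : ∀ a b, P (a * b) = P a * b.1 x + (tw i a).1 x * P b)
    (hloc : ∀ a b : SF m n V, (∀ᶠ y in 𝓝 x, a.1 y = b.1 y) → P a = P b)
    {fr : Frame m n V} (hfr : fr.IsAt x) (g : C^∞⟮𝓡 m, M; ℝ⟯) :
    P (ofFun m n V g) = ∑ k, dAt x g (fr.X k x) • P (ofFun m n V (fr.f k)) := by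
  let Q : C^∞⟮𝓡 m, M; ℝ⟯ →ₗ[ℝ] ExteriorAlgebra ℝ (V x) := P ∘ₗ ofFunₗ m n V
  have hQ : ∀ g, Q g = P (ofFun m n V g) := fun g => rfl
  have hQmul : ∀ g h, Q (g * h) = h x • Q g + g x • Q h := by
    intro g h
    rw [hQ, ofFun_mul, hmul, tw_ofFun, coe_ofFun_apply, coe_ofFun_apply, ← Algebra.commutes,
      ← Algebra.smul_def, ← Algebra.smul_def, hQ, hQ]
  have hQ1 : Q 1 = 0 := by
    have := hQmul 1 1
    rw [mul_one] at this
    simpa using this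
  have hQc : ∀ r : ℝ, Q (ContMDiffMap.const r) = 0 := by
    intro r
    have : (ContMDiffMap.const r : C^∞⟮𝓡 m, M; ℝ⟯) = r • 1 := by
      ext y
      change r = r * 1
      rw [mul_one]
    rw [this, map_smul, hQ1, smul_zero]
  -- A function vanishing to second order is a sum of products of functions vanishing at `x`, and
  -- the Leibniz rule kills such products.
  have hflat : ∀ g : C^∞⟮𝓡 m, M; ℝ⟯, g x = 0 → dAt x g = 0 → Q g = 0 := by
    intro g h0 h1
    obtain ⟨p, q, hp, hq, hpq⟩ := exists_eq_sum_mul h0 h1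
    have hsum : Q g = Q (∑ k, p k * q k) := by
      refine hloc _ _ ?_
      filter_upwards [hpq] with y hy
      have h : evalAt y (∑ k, p k * q k) = ∑ k, p k y * q k y := map_sum (evalAt y) _ _
      change algebraMap ℝ _ (g y) = algebraMap ℝ _ (evalAt y (∑ k, p k * q k))
      rw [hy, h]
    rw [hsum, map_sum]
    refine Finset.sum_eq_zero fun k _ => ?_
    rw [hQmul, hp, hq, zero_smul, zero_smul, add_zero]
  -- Subtract from `g` its first-order Taylor polynomial in the coordinates of the frame.
  have key := hflat (g - ContMDiffMap.const (g x) -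
    ∑ k, dAt x g (fr.X k x) • (fr.f k - ContMDiffMap.const (fr.f k x))) ?_ ?_
  · rw [map_sub, map_sub, hQc, sub_zero, map_sum, sub_eq_zero] at key
    rw [← hQ, key]
    refine Finset.sum_congr rfl fun k _ => ?_
    rw [map_smul, map_sub, hQc, sub_zero, hQ]
  · rw [← evalAt_apply x, map_sub, map_sub, map_sum]
    have h1 : ∀ k, evalAt x (dAt x g (fr.X k x) •
        (fr.f k - ContMDiffMap.const (fr.f k x))) = (0 : ℝ) := by
      intro k
      change dAt x g (fr.X k x) * (fr.f k x - fr.f k x) = 0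
      rw [sub_self, mul_zero]
    simp only [h1, Finset.sum_const_zero, sub_zero]
    exact sub_self (g x)
  · rw [map_sub, map_sub, dAt_const, sub_zero, map_sum, sub_eq_zero]
    simp only [map_smul, map_sub, dAt_const, sub_zero]
    ext v
    conv_lhs => rw [← hfr.sum_tangent v, map_sum]
    rw [sum_apply]
    refine Finset.sum_congr rfl fun k _ => ?_
    rw [map_smul, smul_eq_mul, mul_comm]
    rfl

end Frames

/-! ## Covariant derivatives of superfunctions -/

section Covariant

variable {m n : ℕ} {M : Type*} [TopologicalSpace M] [T2Space M]
  [ChartedSpace (EuclideanSpace ℝ (Fin m)) M] [IsManifold (𝓡 m) ∞ M]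
  {V : M → Type*} [TopologicalSpace (TotalSpace (EuclideanSpace ℝ (Fin n)) V)]
  [∀ x, AddCommGroup (V x)] [∀ x, Module ℝ (V x)] [∀ x, TopologicalSpace (V x)]
  [FiberBundle (EuclideanSpace ℝ (Fin n)) V]

/-- The value of a section of the dual bundle on a section, as a smooth function. -/
def DualSec.pair (χ : DualSec m n V) (σ : Sec m n V) : C^∞⟮𝓡 m, M; ℝ⟯ :=
  ⟨fun x => χ.toFun x (σ x), χ.smooth σ⟩

namespace Frame

variable (n) in
/-- The standard basis of the exterior algebra of `ℝⁿ`. -/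
def stdBasis : Module.Basis (Finset (Fin n)) ℝ (ExteriorAlgebra ℝ (Fin n → ℝ)) :=
  (Pi.basisFun ℝ (Fin n)).ExteriorAlgebra

/-- The components of vectors of `V` with respect to the frame. -/
def toModel (fr : Frame m n V) (x : M) : V x →ₗ[ℝ] Fin n → ℝ :=
  LinearMap.pi fun j => (fr.χ j).toFun x

/-- The vector of `V` with given components with respect to the frame. -/
def ofModel (fr : Frame m n V) (x : M) : (Fin n → ℝ) →ₗ[ℝ] V x :=
  Fintype.linearCombination ℝ fun j => fr.s j x

theorem IsAt.ofModel_toModel {fr : Frame m n V} {x : M} (h : fr.IsAt x) (w : V x) :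
    fr.ofModel x (fr.toModel x w) = w := by
  rw [ofModel, Fintype.linearCombination_apply]
  exact h.sum_fibre w

/-- The algebra map induced by `toModel` carries all fibres into one fixed algebra, where
derivatives can be taken componentwise. The forms `fr.χ j` are global, so the components are smooth
even where the frame degenerates. -/
theorem contMDiff_coord (fr : Frame m n V) (S : Finset (Fin n)) (a : SF m n V) :
    ContMDiff (𝓡 m) 𝓘(ℝ, ℝ) ∞ fun x =>
      (stdBasis n).repr (ExteriorAlgebra.map (fr.toModel x) (a.1 x)) S := by
  intro x₀
  obtain ⟨b, hb, h⟩ := exists_mem_adjoin a x₀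
  suffices ∀ S, ContMDiff (𝓡 m) 𝓘(ℝ, ℝ) ∞ fun x =>
      (stdBasis n).repr (ExteriorAlgebra.map (fr.toModel x) (b.1 x)) S by
    refine (this S x₀).congr_of_eventuallyEq ?_
    filter_upwards [h] with x hx
    rw [hx]
  clear h
  refine adjoin_superfunction_induction (motive := fun b => ∀ S,
    ContMDiff (𝓡 m) 𝓘(ℝ, ℝ) ∞ fun x =>
      (stdBasis n).repr (ExteriorAlgebra.map (fr.toModel x) (b.1 x)) S) ?fn ?sec ?add ?mul hb
  case fn =>
    intro f S
    have : ∀ x, (stdBasis n).repr (ExteriorAlgebra.map (fr.toModel x) ((ofFun m n V f).1 x)) S =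
        f x * (stdBasis n).repr 1 S := by
      intro x
      rw [coe_ofFun_apply, AlgHom.commutes, Algebra.algebraMap_eq_smul_one, map_smul]
      rfl
    simp only [this]
    exact f.contMDiff.mul contMDiff_const
  case sec =>
    intro σ S
    have : ∀ x, (stdBasis n).repr (ExteriorAlgebra.map (fr.toModel x) ((ofSec m n V σ).1 x)) S =
        ∑ j, (fr.χ j).pair σ x * (stdBasis n).repr (ExteriorAlgebra.ι ℝ (Pi.single j 1)) S := by
      intro x
      rw [coe_ofSec_apply, ExteriorAlgebra.map_apply_ι,
        pi_eq_sum_univ' (fr.toModel x (σ x)), map_sum, map_sum, Finsupp.finsetSum_apply]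
      refine Finset.sum_congr rfl fun j _ => ?_
      rw [map_smul, map_smul]
      rfl
    simp only [this]
    exact ContMDiff.sum fun j _ => ((fr.χ j).pair σ).contMDiff.mul contMDiff_const
  case add =>
    intro a b ha hb S
    have := (ha S).add (hb S)
    convert this using 1
    funext x
    rw [coe_add_apply, map_add, map_add]
    rfl
  case mul =>
    intro a b ha hb S
    -- The structure constants of the exterior product in the standard basis do not depend on `x`.
    have : ∀ x, (stdBasis n).repr (ExteriorAlgebra.map (fr.toModel x) ((a * b).1 x)) S =
        ∑ R, ∑ Q, (stdBasis n).repr (ExteriorAlgebra.map (fr.toModel x) (a.1 x)) R *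
          ((stdBasis n).repr (ExteriorAlgebra.map (fr.toModel x) (b.1 x)) Q *
            (stdBasis n).repr (stdBasis n R * stdBasis n Q) S) := by
      intro x
      rw [coe_mul_apply, map_mul]
      conv_lhs => rw [← (stdBasis n).sum_repr (ExteriorAlgebra.map (fr.toModel x) (a.1 x)),
        ← (stdBasis n).sum_repr (ExteriorAlgebra.map (fr.toModel x) (b.1 x)), Finset.sum_mul_sum]
      simp only [map_sum, Finsupp.finsetSum_apply, smul_mul_assoc, mul_smul_comm, map_smul,
        Finsupp.smul_apply, smul_eq_mul]
      refine Finset.sum_congr rfl fun R _ => Finset.sum_congr rfl fun Q _ => ?_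
      ring
    simp only [this]
    exact ContMDiff.sum fun R _ => ContMDiff.sum fun Q _ => (ha R).mul ((hb Q).mul contMDiff_const)

/-- The components of superfunctions with respect to a frame. -/
def coord (fr : Frame m n V) (S : Finset (Fin n)) : SF m n V →ₗ[ℝ] C^∞⟮𝓡 m, M; ℝ⟯ where
  toFun a := ⟨_, fr.contMDiff_coord S a⟩
  map_add' a b := by
    ext x
    change (stdBasis n).repr (ExteriorAlgebra.map (fr.toModel x) (a.1 x + b.1 x)) S = _
    rw [map_add, map_add]
    rfl
  map_smul' r a := by
    ext x
    change (stdBasis n).repr (ExteriorAlgebra.map (fr.toModel x) (r • a.1 x)) S = _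
    rw [map_smul, map_smul]
    rfl

theorem coord_apply (fr : Frame m n V) (S : Finset (Fin n)) (a : SF m n V) (x : M) :
    fr.coord S a x = (stdBasis n).repr (ExteriorAlgebra.map (fr.toModel x) (a.1 x)) S := rfl

theorem sum_coord (fr : Frame m n V) (a : SF m n V) (x : M) :
    ∑ S, fr.coord S a x • stdBasis n S = ExteriorAlgebra.map (fr.toModel x) (a.1 x) :=
  (stdBasis n).sum_repr _

theorem coord_mul (fr : Frame m n V) (S : Finset (Fin n)) (a b : SF m n V) :
    fr.coord S (a * b) = ∑ R, ∑ Q, (stdBasis n).repr (stdBasis n R * stdBasis n Q) S •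
      (fr.coord R a * fr.coord Q b) := by
  ext x
  rw [← evalAt_apply x (∑ R, _)]
  simp only [map_sum, map_smul]
  rw [coord_apply, coe_mul_apply, map_mul, ← fr.sum_coord a, ← fr.sum_coord b, Finset.sum_mul_sum]
  simp only [map_sum, Finsupp.finsetSum_apply, smul_mul_assoc, mul_smul_comm, map_smul,
    Finsupp.smul_apply, smul_eq_mul]
  refine Finset.sum_congr rfl fun R _ => Finset.sum_congr rfl fun Q _ => ?_
  change _ = _ * (fr.coord R a x * fr.coord Q b x)
  ring

/-- The derivative at `x` along `v` of a superfunction, with the sections of the frame regarded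
as constant. -/
def flat (fr : Frame m n V) (x : M) (v : TangentSpace (𝓡 m) x) :
    SF m n V →ₗ[ℝ] ExteriorAlgebra ℝ (Fin n → ℝ) where
  toFun a := ∑ S, dAt x (fr.coord S a) v • stdBasis n S
  map_add' a b := by
    simp only [map_add, add_apply, add_smul, Finset.sum_add_distrib]
  map_smul' r a := by
    simp only [map_smul, RingHom.id_apply, Finset.smul_sum, smul_apply, smul_assoc]

theorem flat_apply (fr : Frame m n V) (x : M) (v : TangentSpace (𝓡 m) x) (a : SF m n V) :
    fr.flat x v a = ∑ S, dAt x (fr.coord S a) v • stdBasis n S := rfl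

/-- Since the structure constants are constant, this is the product rule of `dAt` applied to the
components. -/
theorem flat_mul (fr : Frame m n V) (x : M) (v : TangentSpace (𝓡 m) x) (a b : SF m n V) :
    fr.flat x v (a * b) = fr.flat x v a * ExteriorAlgebra.map (fr.toModel x) (b.1 x) +
      ExteriorAlgebra.map (fr.toModel x) (a.1 x) * fr.flat x v b := by
  have h : fr.flat x v (a * b) = ∑ R, ∑ Q, (fr.coord R a x * dAt x (fr.coord Q b) v +
      fr.coord Q b x * dAt x (fr.coord R a) v) • (stdBasis n R * stdBasis n Q) := by
    have h1 : ∀ R Q, (fr.coord R a x * dAt x (fr.coord Q b) v +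
        fr.coord Q b x * dAt x (fr.coord R a) v) • (stdBasis n R * stdBasis n Q) =
        ∑ S, ((fr.coord R a x * dAt x (fr.coord Q b) v +
        fr.coord Q b x * dAt x (fr.coord R a) v) *
          (stdBasis n).repr (stdBasis n R * stdBasis n Q) S) • stdBasis n S := by
      intro R Q
      conv_lhs => rw [← (stdBasis n).sum_repr (stdBasis n R * stdBasis n Q)]
      rw [Finset.smul_sum]
      simp only [smul_smul]
    simp only [h1]
    rw [flat_apply]
    simp only [coord_mul, map_sum, map_smul, sum_apply, smul_apply, dAt_mul, smul_eq_mul,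
      Finset.sum_smul]
    rw [Finset.sum_comm]
    refine Finset.sum_congr rfl fun R _ => ?_
    rw [Finset.sum_comm]
    refine Finset.sum_congr rfl fun Q _ => Finset.sum_congr rfl fun S _ => ?_
    rw [mul_comm]
  rw [h, flat_apply, flat_apply, ← fr.sum_coord a, ← fr.sum_coord b, Finset.sum_mul_sum,
    Finset.sum_mul_sum, ← Finset.sum_add_distrib]
  refine Finset.sum_congr rfl fun R _ => ?_
  rw [← Finset.sum_add_distrib]
  refine Finset.sum_congr rfl fun Q _ => ?_
  simp only [smul_mul_assoc, mul_smul_comm, smul_smul, add_smul]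
  rw [add_comm, mul_comm (fr.coord Q b x), mul_comm (fr.coord R a x)]

theorem flat_congr (fr : Frame m n V) {x : M} (v : TangentSpace (𝓡 m) x) {a b : SF m n V}
    (h : ∀ᶠ y in 𝓝 x, a.1 y = b.1 y) : fr.flat x v a = fr.flat x v b := by
  rw [flat_apply, flat_apply]
  refine Finset.sum_congr rfl fun S _ => ?_
  rw [dAt_congr (g := fr.coord S b)]
  filter_upwards [h] with y hy
  rw [coord_apply, coord_apply, hy]

theorem flat_ofFun (fr : Frame m n V) (x : M) (v : TangentSpace (𝓡 m) x)
    (f : C^∞⟮𝓡 m, M; ℝ⟯) : fr.flat x v (ofFun m n V f) = algebraMap ℝ _ (dAt x f v) := by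
  have h : ∀ S, fr.coord S (ofFun m n V f) = (stdBasis n).repr 1 S • f := by
    intro S
    ext y
    rw [coord_apply, coe_ofFun_apply, AlgHom.commutes, Algebra.algebraMap_eq_smul_one, map_smul,
      Finsupp.smul_apply, smul_eq_mul, mul_comm]
    rfl
  rw [flat_apply]
  simp only [h, map_smul, smul_apply, smul_eq_mul, mul_comm, mul_smul, ← Finset.smul_sum]
  rw [(stdBasis n).sum_repr, Algebra.algebraMap_eq_smul_one]

theorem flat_ofSec (fr : Frame m n V) (x : M) (v : TangentSpace (𝓡 m) x)
    (σ : Sec m n V) : fr.flat x v (ofSec m n V σ) =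
      ∑ j, dAt x ((fr.χ j).pair σ) v • ExteriorAlgebra.ι ℝ (Pi.single j 1) := by
  have h : ∀ S, fr.coord S (ofSec m n V σ) =
      ∑ j, (stdBasis n).repr (ExteriorAlgebra.ι ℝ (Pi.single j 1)) S • (fr.χ j).pair σ := by
    intro S
    ext y
    rw [← evalAt_apply y (∑ j, _), map_sum, coord_apply, coe_ofSec_apply,
      ExteriorAlgebra.map_apply_ι, pi_eq_sum_univ' (fr.toModel y (σ y)), map_sum, map_sum,
      Finsupp.finsetSum_apply]
    refine Finset.sum_congr rfl fun j _ => ?_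
    rw [map_smul, map_smul, map_smul, Finsupp.smul_apply, smul_eq_mul, smul_eq_mul, mul_comm]
    rfl
  rw [flat_apply]
  simp only [h, map_sum, map_smul, sum_apply, smul_apply, smul_eq_mul, Finset.sum_smul]
  rw [Finset.sum_comm]
  refine Finset.sum_congr rfl fun j _ => ?_
  simp only [mul_comm, mul_smul, ← Finset.smul_sum]
  rw [(stdBasis n).sum_repr]

end Frame

end Covariant

/-! ### The covariant derivative as an even supervector field -/

section Connection

variable {m n : ℕ} {M : Type*} [TopologicalSpace M] [T2Space M]
  [ChartedSpace (EuclideanSpace ℝ (Fin m)) M] [IsManifold (𝓡 m) ∞ M]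
  {V : M → Type*} [TopologicalSpace (TotalSpace (EuclideanSpace ℝ (Fin n)) V)]
  [∀ x, AddCommGroup (V x)] [∀ x, Module ℝ (V x)] [∀ x, TopologicalSpace (V x)]
  [∀ x, IsTopologicalAddGroup (V x)] [∀ x, ContinuousSMul ℝ (V x)]
  [FiberBundle (EuclideanSpace ℝ (Fin n)) V] [VectorBundle ℝ (EuclideanSpace ℝ (Fin n)) V]
  [ContMDiffVectorBundle ∞ (EuclideanSpace ℝ (Fin n)) V (𝓡 m)]
  (nab : CovariantDerivative (𝓡 m) (EuclideanSpace ℝ (Fin n)) V)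

theorem dAt_smooth (f : C^∞⟮𝓡 m, M; ℝ⟯) (X : VecField m M) :
    ContMDiff (𝓡 m) 𝓘(ℝ, ℝ) ∞ fun x => dAt x f (X x) := by
  have h1 : ContMDiff (𝓡 m).tangent 𝓘(ℝ, ℝ).tangent ∞ (tangentMap (𝓡 m) 𝓘(ℝ, ℝ) f) :=
    f.contMDiff.contMDiff_tangentMap (by simp)
  have h2 : ContMDiff (𝓡 m) (𝓡 m).tangent ∞ fun x => (⟨x, X x⟩ : TangentBundle (𝓡 m) M) :=
    X.contMDiff
  have h3 := h1.comp h2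
  exact ((contMDiff_snd_tangentBundle_modelSpace ℝ 𝓘(ℝ, ℝ))).comp h3

/-- The derivative of a smooth function along a vector field. -/
def VecField.deriv (X : VecField m M) (f : C^∞⟮𝓡 m, M; ℝ⟯) : C^∞⟮𝓡 m, M; ℝ⟯ :=
  ⟨_, dAt_smooth f X⟩

/-- The covariant derivative of a smooth section along a vector field. -/
def nabSec [CovariantDerivative.ContMDiffCovariantDerivative nab ∞] (X : VecField m M)
    (σ : Sec m n V) : Sec m n V :=
  ⟨fun x => nab σ x (X x), by
    have h := (CovariantDerivative.ContMDiffCovariantDerivative.contMDiff (cov := nab)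
      (k := ∞)).contMDiff (σ := σ) (by
        rw [contMDiffOn_univ]
        exact σ.contMDiff)
    rw [contMDiffOn_univ] at h
    exact h.clm_bundle_apply X.contMDiff⟩

/-- The product of a smooth function and a smooth section. -/
def funSMul (f : C^∞⟮𝓡 m, M; ℝ⟯) (σ : Sec m n V) : Sec m n V :=
  ⟨fun x => f x • σ x, f.contMDiff.smul_section σ.contMDiff⟩

/-- The covariant derivative at `x` along `v` as an additive map on sections. -/
def nabAt (x : M) (v : TangentSpace (𝓡 m) x) : Sec m n V →+ V x where
  toFun σ := nab σ x v
  map_zero' := by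
    have h : nab (0 : ∀ x, V x) x = 0 := congrFun (CovariantDerivative.zero nab) x
    exact congrArg (fun A => A v) h
  map_add' σ τ := by
    have h := nab.isCovariantDerivativeOnUniv.add (x := x) σ.mdifferentiableAt τ.mdifferentiableAt
    exact congrArg (fun A => A v) h

theorem nabAt_funSMul (x : M) (v : TangentSpace (𝓡 m) x) (f : C^∞⟮𝓡 m, M; ℝ⟯) (σ : Sec m n V) :
    nabAt nab x v (funSMul f σ) = f x • nab σ x v + dAt x f v • σ x := by
  have h := nab.isCovariantDerivativeOnUniv.leibniz (x := x) σ.mdifferentiableAt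
    (mdifferentiableAt_of_smooth f x)
  exact congrArg (fun A => A v) h

theorem nab_congr {x : M} {σ τ : Sec m n V} (h : ∀ᶠ y in 𝓝 x, σ y = τ y) : nab σ x = nab τ x :=
  nab.isCovariantDerivativeOnUniv.congr_of_eventuallyEq σ.mdifferentiableAt τ.mdifferentiableAt
    Filter.univ_mem h

theorem coe_sum_sec {ι : Type*} (s : Finset ι) (σ : ι → Sec m n V) (x : M) :
    (∑ i ∈ s, σ i) x = ∑ i ∈ s, σ i x := by
  let ev : Sec m n V →+ V x := ⟨⟨fun τ => τ x, rfl⟩, fun _ _ => rfl⟩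
  exact map_sum ev σ s

theorem Frame.eventually_sum_sec {fr : Frame m n V} {x : M} (h : ∀ᶠ y in 𝓝 x, fr.IsAt y)
    (σ : Sec m n V) : ∀ᶠ y in 𝓝 x, σ y = (∑ j, funSMul ((fr.χ j).pair σ) (fr.s j)) y := by
  filter_upwards [h] with y hy
  rw [coe_sum_sec]
  exact (hy.sum_fibre (σ y)).symm

theorem Frame.nab_eq_sum {fr : Frame m n V} {x : M} (h : ∀ᶠ y in 𝓝 x, fr.IsAt y)
    (σ : Sec m n V) (v : TangentSpace (𝓡 m) x) :
    nab σ x v = ∑ j, ((fr.χ j).pair σ x • nab (fr.s j) x v +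
      dAt x ((fr.χ j).pair σ) v • fr.s j x) := by
  rw [nab_congr nab (Frame.eventually_sum_sec h σ)]
  change nabAt nab x v _ = _
  rw [map_sum]
  simp only [nabAt_funSMul]

/-- In a frame, `∇_X` is the flat derivative plus ∑ (∇_X s_j) i_{χ_j}. A frame is chosen separately
at each point, with no compatibility required: the values on functions and sections do not depend on
the frame and are smooth, and `exists_homDer` needs no more. -/
theorem exists_covariant [CovariantDerivative.ContMDiffCovariantDerivative nab ∞]
    (X : VecField m M) : ∃ D : HomDer m n V 0, IsCovariant nab X D := by
  choose fr hfr using fun x : M => exists_frame (m := m) (n := n) (V := V) x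
  let P : ∀ x : M, SF m n V →ₗ[ℝ] ExteriorAlgebra ℝ (V x) := fun x =>
    (ExteriorAlgebra.map ((fr x).ofModel x)).toLinearMap ∘ₗ (fr x).flat x (X x) +
      ∑ j, LinearMap.mulLeft ℝ (ExteriorAlgebra.ι ℝ (nab ((fr x).s j) x (X x))) ∘ₗ
        contr (((fr x).χ j).toFun x) ∘ₗ ev x
  have hP : ∀ x a, P x a = ExteriorAlgebra.map ((fr x).ofModel x) ((fr x).flat x (X x) a) +
      ∑ j, ExteriorAlgebra.ι ℝ (nab ((fr x).s j) x (X x)) *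
        contr (((fr x).χ j).toFun x) (a.1 x) := by
    intro x a
    simp only [P, LinearMap.add_apply, LinearMap.sum_apply]
    rfl
  have hmap : ∀ x (y : ExteriorAlgebra ℝ (V x)), ExteriorAlgebra.map ((fr x).ofModel x)
      (ExteriorAlgebra.map ((fr x).toModel x) y) = y := by
    intro x y
    have h : (ExteriorAlgebra.map ((fr x).ofModel x)).comp (ExteriorAlgebra.map ((fr x).toModel x)) =
        AlgHom.id ℝ _ := by
      rw [ExteriorAlgebra.map_comp_map, ← ExteriorAlgebra.map_id]
      congr 1
      ext w
      exact (hfr x).self_of_nhds.ofModel_toModel w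
    exact congrArg (fun A : ExteriorAlgebra ℝ (V x) →ₐ[ℝ] ExteriorAlgebra ℝ (V x) => A y) h
  have hPf : ∀ (f : C^∞⟮𝓡 m, M; ℝ⟯) (x : M), P x (ofFun m n V f) =
      algebraMap ℝ _ (dAt x f (X x)) := by
    intro f x
    rw [hP, Frame.flat_ofFun, AlgHom.commutes]
    simp only [coe_ofFun_apply, contr_algebraMap, mul_zero, Finset.sum_const_zero, add_zero]
  have hPs : ∀ (σ : Sec m n V) (x : M), P x (ofSec m n V σ) =
      ExteriorAlgebra.ι ℝ (nab σ x (X x)) := by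
    intro σ x
    rw [hP, Frame.flat_ofSec, (fr x).nab_eq_sum nab (hfr x), map_sum, map_sum,
      ← Finset.sum_add_distrib]
    refine Finset.sum_congr rfl fun j _ => ?_
    rw [map_smul, ExteriorAlgebra.map_apply_ι, coe_ofSec_apply, contr_ι, map_add, map_smul,
      map_smul, add_comm, ← Algebra.commutes, ← Algebra.smul_def, Frame.ofModel,
      Fintype.linearCombination_apply_single, one_smul]
    rfl
  suffices ∃ D : HomDer m n V 0, ∀ a x, (D a).1 x = P x a by
    obtain ⟨D, hD⟩ := this
    exact ⟨D, fun f x => (hD _ x).trans (hPf f x), fun σ x => (hD _ x).trans (hPs σ x)⟩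
  refine exists_homDer (i := 0) P ?_ ?_ ?_ ?_
  · intro x a b
    rw [hP, hP, hP, Frame.flat_mul, map_add, map_mul, map_mul, hmap, hmap, tw_zero, add_mul,
      mul_add, Finset.sum_mul, Finset.mul_sum, coe_mul_apply]
    have h : ∀ j, ExteriorAlgebra.ι ℝ (nab ((fr x).s j) x (X x)) *
        contr (((fr x).χ j).toFun x) (a.1 x * b.1 x) =
        ExteriorAlgebra.ι ℝ (nab ((fr x).s j) x (X x)) *
          contr (((fr x).χ j).toFun x) (a.1 x) * b.1 x +
        a.1 x * (ExteriorAlgebra.ι ℝ (nab ((fr x).s j) x (X x)) *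
          contr (((fr x).χ j).toFun x) (b.1 x)) := by
      intro j
      have hcomm := ι_mul_inv (nab ((fr x).s j) x (X x)) (a.1 x)
      rw [contr_mul, mul_add, ← mul_assoc, ← mul_assoc, hcomm, mul_assoc (a.1 x)]
    simp only [h, Finset.sum_add_distrib]
    abel
  · intro x a b h
    rw [hP, hP, (fr x).flat_congr _ h, h.self_of_nhds]
  · exact fun f => ⟨ofFun m n V (VecField.deriv X f), hasParity_ofFun _, fun x => hPf f x⟩
  · exact fun σ => ⟨ofSec m n V (nabSec nab X σ), hasParity_ofSec _, fun x => hPs σ x⟩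

/-- The supervector field `∇_X`. -/
def cov [CovariantDerivative.ContMDiffCovariantDerivative nab ∞] (X : VecField m M) :
    HomDer m n V 0 :=
  (exists_covariant nab X).choose

theorem isCovariant_cov [CovariantDerivative.ContMDiffCovariantDerivative nab ∞]
    (X : VecField m M) : IsCovariant nab X (cov nab X) :=
  (exists_covariant nab X).choose_spec

end Connection

/-! ## Supervector fields in a local frame -/

section Generation

variable {m n : ℕ} {M : Type*} [TopologicalSpace M] [T2Space M]
  [ChartedSpace (EuclideanSpace ℝ (Fin m)) M] [IsManifold (𝓡 m) ∞ M]
  {V : M → Type*} [TopologicalSpace (TotalSpace (EuclideanSpace ℝ (Fin n)) V)]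
  [∀ x, AddCommGroup (V x)] [∀ x, Module ℝ (V x)] [∀ x, TopologicalSpace (V x)]
  [∀ x, IsTopologicalAddGroup (V x)] [∀ x, ContinuousSMul ℝ (V x)]
  [FiberBundle (EuclideanSpace ℝ (Fin n)) V] [VectorBundle ℝ (EuclideanSpace ℝ (Fin n)) V]
  [ContMDiffVectorBundle ∞ (EuclideanSpace ℝ (Fin n)) V (𝓡 m)]
  (nab : CovariantDerivative (𝓡 m) (EuclideanSpace ℝ (Fin n)) V)
  [CovariantDerivative.ContMDiffCovariantDerivative nab ∞]

theorem eq_at_of_bump_mul_eq_zero {x : M} {a : SF m n V} {ρ : C^∞⟮𝓡 m, M; ℝ⟯} (hρ : ρ x = 1)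
    (h : (ofFun m n V ρ * a).1 x = 0) : a.1 x = 0 := by
  rwa [coe_mul_apply, coe_ofFun_apply, hρ, map_one, one_mul] at h

theorem bump_mul_eq_zero {ρ : C^∞⟮𝓡 m, M; ℝ⟯} {a : SF m n V}
    (h : ∀ y ∈ tsupport ρ, a.1 y = 0) : ofFun m n V ρ * a = 0 := by
  refine SF.ext fun y => ?_
  by_cases hy : y ∈ tsupport ρ
  · rw [coe_mul_apply, h y hy, mul_zero]
    rfl
  · rw [coe_mul_apply, coe_ofFun_apply, image_eq_zero_of_notMem_tsupport hy, map_zero, zero_mul]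
    rfl

/-- Locality follows from the Leibniz rule: a bump function `ρ` with `ρ x = 1` annihilates `a - b`,
and applying `D` to `ρ (a - b) = 0` leaves only `D (a - b)` at `x`. -/
theorem IsDer.congr_of_eventually {i : ZMod 2} {D : SF m n V →ₗ[ℝ] SF m n V} (hD : IsDer i D)
    {a b : SF m n V} {x : M} (h : ∀ᶠ y in 𝓝 x, a.1 y = b.1 y) : (D a).1 x = (D b).1 x := by
  obtain ⟨ρ, hρ1, hρ⟩ := exists_bump (m := m) x h
  have h0 : ofFun m n V ρ * (a - b) = 0 := bump_mul_eq_zero fun y hy => by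
    rw [coe_sub_apply, sub_eq_zero]
    exact hρ hy
  have h1 : D (ofFun m n V ρ * (a - b)) = 0 := by rw [h0, map_zero]
  rw [hD.map_mul, tw_ofFun] at h1
  have h2 := congrArg (fun c : SF m n V => c.1 x) h1
  simp only [coe_add_apply, coe_mul_apply, coe_sub_apply, h.self_of_nhds, sub_self, mul_zero,
    zero_add, coe_zero_apply] at h2
  have h3 : (D (a - b)).1 x = 0 := eq_at_of_bump_mul_eq_zero hρ1.self_of_nhds h2
  rwa [map_sub, coe_sub_apply, sub_eq_zero] at h3

theorem IsDer.neg {i : ZMod 2} {D : SF m n V →ₗ[ℝ] SF m n V} (h : IsDer i D) : IsDer i (-D) where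
  parity j a ha := by
    have := (h.parity j a ha).smul (-1)
    rwa [neg_one_smul] at this
  leibniz j a b ha := by
    simp only [LinearMap.neg_apply, h.leibniz j a b ha, neg_add, neg_mul, mul_neg, smul_neg]

theorem IsDer.sub {i : ZMod 2} {D D' : SF m n V →ₗ[ℝ] SF m n V} (h : IsDer i D)
    (h' : IsDer i D') : IsDer i (D - D') := by
  rw [sub_eq_add_neg]
  exact h.add h'.neg

theorem IsDer.sum {ι : Type*} {i : ZMod 2} {s : Finset ι} {D : ι → SF m n V →ₗ[ℝ] SF m n V}
    (h : ∀ k, IsDer i (D k)) : IsDer i (∑ k ∈ s, D k) :=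
  Finset.sum_induction _ (IsDer i) (fun _ _ => IsDer.add) (IsDer.zero i) fun k _ => h k

theorem HasParity.sum {ι : Type*} {i : ZMod 2} {s : Finset ι} {a : ι → SF m n V}
    (h : ∀ k, HasParity i (a k)) : HasParity i (∑ k ∈ s, a k) :=
  Finset.sum_induction _ (HasParity i) (fun _ _ => HasParity.add) (fun _ => zero_mem _)
    fun k _ => h k

theorem HasParity.sub {i : ZMod 2} {a b : SF m n V} (ha : HasParity i a) (hb : HasParity i b) :
    HasParity i (a - b) := fun x => sub_mem (ha x) (hb x)

instance : AddGroup (SX m n V) := AddCommGroup.toAddGroup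

instance : AddMonoid (SX m n V) := SubNegMonoid.toAddMonoid

instance : AddZeroClass (SX m n V) := AddMonoid.toAddZeroClass

instance : AddCommMonoid (SX m n V) := AddCommGroup.toAddCommMonoid

/-- Additive maps from supervector fields to superfunctions that are linear up to the `i`-th power
of the parity involution. -/
structure IsTwisted (i : ZMod 2) (F : SX m n V → SF m n V) : Prop where
  map_add : ∀ D D', F (D + D') = F D + F D'
  map_smul : ∀ (a : SF m n V) D, F (a • D) = tw i a * F D

namespace IsTwisted

variable {i : ZMod 2} {F G : SX m n V → SF m n V}

theorem map_zero (hF : IsTwisted i F) : F 0 = 0 := by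
  have h := hF.map_add 0 0
  rwa [add_zero, left_eq_add] at h

theorem map_sub (hF : IsTwisted i F) (D D' : SX m n V) : F (D - D') = F D - F D' := by
  rw [eq_sub_iff_add_eq, ← hF.map_add, sub_add_cancel]

theorem map_sum {ι : Type*} (hF : IsTwisted i F) (s : Finset ι) (D : ι → SX m n V) :
    F (∑ k ∈ s, D k) = ∑ k ∈ s, F (D k) := by
  classical
  induction s using Finset.induction_on with
  | empty => exact hF.map_zero
  | insert k s hk ih => rw [Finset.sum_insert hk, Finset.sum_insert hk, hF.map_add, ih]

theorem sub (hF : IsTwisted i F) (hG : IsTwisted i G) : IsTwisted i fun D => F D - G D where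
  map_add D D' := by rw [hF.map_add, hG.map_add]; abel
  map_smul a D := by rw [hF.map_smul, hG.map_smul, mul_sub]

end IsTwisted

theorem coe_cov_ofFun (X : VecField m M) (f : C^∞⟮𝓡 m, M; ℝ⟯) (x : M) :
    (cov (V := V) nab X (ofFun m n V f)).1 x = algebraMap ℝ _ (dAt x f (X x)) :=
  (isCovariant_cov nab X).1 f x

theorem coe_cov_ofSec (X : VecField m M) (σ : Sec m n V) (x : M) :
    (cov nab X (ofSec m n V σ)).1 x = ExteriorAlgebra.ι ℝ (nab σ x (X x)) :=
  (isCovariant_cov nab X).2 σ x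

namespace Frame

/-- The coefficients of the insertions in the expansion of a supervector field in a frame. -/
def coeffIns (fr : Frame m n V) (j : Fin n) :
    (SF m n V →ₗ[ℝ] SF m n V) →+ SF m n V where
  toFun D := D (ofSec m n V (fr.s j)) -
    ∑ k, D (ofFun m n V (fr.f k)) * cov nab (fr.X k) (ofSec m n V (fr.s j))
  map_zero' := by simp
  map_add' D D' := by
    simp only [LinearMap.add_apply, add_mul, Finset.sum_add_distrib]
    abel

theorem coeffIns_apply (fr : Frame m n V) (j : Fin n) (D : SF m n V →ₗ[ℝ] SF m n V) :
    fr.coeffIns nab j D = D (ofSec m n V (fr.s j)) -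
      ∑ k, D (ofFun m n V (fr.f k)) * cov nab (fr.X k) (ofSec m n V (fr.s j)) := rfl

theorem hasParity_coeffIns (fr : Frame m n V) (j : Fin n) {i : ZMod 2}
    {D : SF m n V →ₗ[ℝ] SF m n V} (hD : IsDer i D) : HasParity (i + 1) (fr.coeffIns nab j D) := by
  rw [coeffIns_apply]
  refine (hD.parity _ _ (hasParity_ofSec _)).sub (HasParity.sum fun k => ?_)
  have h1 := hD.parity _ _ (hasParity_ofFun (m := m) (n := n) (V := V) (fr.f k))
  have h2 := (cov nab (fr.X k)).isDer.parity _ _ (hasParity_ofSec (fr.s j))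
  have := h1.mul h2
  rwa [add_zero, zero_add] at this

/-- The expansion of a homogeneous supervector field in a frame, at a point. -/
theorem homDer_apply_eq {fr : Frame m n V} {x : M} (hfr : ∀ᶠ y in 𝓝 x, fr.IsAt y) {i : ZMod 2}
    (D : HomDer m n V i) (a : SF m n V) :
    (D a).1 x = ∑ k, (D (ofFun m n V (fr.f k))).1 x * (cov nab (fr.X k) a).1 x +
      ∑ j, (fr.coeffIns nab j D.toMap).1 x * (ins (fr.χ j) a).1 x := by
  -- The remainder is again a homogeneous derivation. At `x` it kills the coordinates and the frame
  -- sections, hence everything.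
  let R : SF m n V →ₗ[ℝ] SF m n V := D.toMap -
    (∑ k, D (ofFun m n V (fr.f k)) • (cov nab (fr.X k)).toMap +
      ∑ j, fr.coeffIns nab j D.toMap • (ins (fr.χ j)).toMap)
  have hR : IsDer i R := by
    refine D.isDer.sub ((IsDer.sum fun k => ?_).add (IsDer.sum fun j => ?_))
    · have h := IsDer.smul (D.isDer.parity _ _ (hasParity_ofFun (fr.f k)))
        (cov nab (fr.X k)).isDer
      rwa [add_zero, add_zero] at h
    · have h := IsDer.smul (fr.hasParity_coeffIns nab j D.isDer) (ins (fr.χ j)).isDer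
      rwa [add_assoc, show (1 : ZMod 2) + 1 = 0 by decide, add_zero] at h
  have hRa : ∀ a, (R a).1 x = (D a).1 x -
      (∑ k, (D (ofFun m n V (fr.f k))).1 x * (cov nab (fr.X k) a).1 x +
      ∑ j, (fr.coeffIns nab j D.toMap).1 x * (ins (fr.χ j) a).1 x) := by
    intro a
    simp only [R, LinearMap.sub_apply, LinearMap.add_apply, LinearMap.sum_apply,
      LinearMap.smul_apply, smul_eq_mul, coe_sub_apply, coe_add_apply, coe_sum_apply, coe_mul_apply]
  have hmul : ∀ a b, (ev x ∘ₗ R) (a * b) = (ev x ∘ₗ R) a * b.1 x + (tw i a).1 x * (ev x ∘ₗ R) b :=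
    fun a b => congrArg (fun c : SF m n V => c.1 x) (hR.map_mul a b)
  have hloc : ∀ a b : SF m n V, (∀ᶠ y in 𝓝 x, a.1 y = b.1 y) → (ev x ∘ₗ R) a = (ev x ∘ₗ R) b :=
    fun a b h => hR.congr_of_eventually h
  have hx := hfr.self_of_nhds
  have hfun : ∀ f, (ev x ∘ₗ R) (ofFun m n V f) = 0 := by
    intro f
    rw [pointDerivation_ofFun _ hmul hloc hx]
    refine Finset.sum_eq_zero fun k _ => ?_
    change _ • (R _).1 x = 0
    rw [hRa]
    simp only [coe_cov_ofFun, hx.dual_tangent, coe_ins_apply, coe_ofFun_apply, contr_algebraMap,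
      mul_zero, Finset.sum_const_zero, add_zero]
    rw [Finset.sum_eq_single k]
    · simp
    · intro l _ hl
      simp [hl.symm]
    · simp
  have hsec : ∀ j, (ev x ∘ₗ R) (ofSec m n V (fr.s j)) = 0 := by
    intro j
    change (R _).1 x = 0
    rw [hRa]
    have h : ∑ l, (fr.coeffIns nab l D.toMap).1 x * (ins (fr.χ l) (ofSec m n V (fr.s j))).1 x =
        (fr.coeffIns nab j D.toMap).1 x := by
      simp only [coe_ins_apply, coe_ofSec_apply, contr_ι, hx.dual_fibre]
      rw [Finset.sum_eq_single j]
      · simp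
      · intro l _ hl
        simp [hl]
      · simp
    rw [h, coeffIns_apply, coe_sub_apply, coe_sum_apply]
    simp only [coe_mul_apply]
    abel
  have key := eq_zero_of_generators (ev x ∘ₗ R) hmul hloc hfun ?_ a
  · change (R a).1 x = 0 at key
    rwa [hRa, sub_eq_zero] at key
  · intro σ
    -- Near `x` every section is a combination of the frame with smooth coefficients, so `hfun` and
    -- `hsec` suffice.
    have h : (ev x ∘ₗ R) (ofSec m n V σ) = (ev x ∘ₗ R)
        (∑ j, ofFun m n V ((fr.χ j).pair σ) * ofSec m n V (fr.s j)) := by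
      refine hloc _ _ ?_
      filter_upwards [hfr] with y hy
      rw [coe_sum_apply, coe_ofSec_apply]
      conv_lhs => rw [← hy.sum_fibre (σ y), map_sum]
      refine Finset.sum_congr rfl fun j _ => ?_
      rw [map_smul, coe_mul_apply, coe_ofFun_apply, coe_ofSec_apply, ← Algebra.smul_def]
      rfl
    rw [h, map_sum]
    refine Finset.sum_eq_zero fun j _ => ?_
    rw [hmul, hfun, hsec, zero_mul, mul_zero, add_zero]

/-- A twisted linear map on supervector fields, evaluated in a frame. -/
theorem apply_eq_sum {fr : Frame m n V} {x : M} (hfr : ∀ᶠ y in 𝓝 x, fr.IsAt y) {i : ZMod 2}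
    {F : SX m n V → SF m n V} (hF : IsTwisted i F) (D : SX m n V) :
    (F D).1 x = ∑ k, (tw i (D.1 (ofFun m n V (fr.f k)))).1 x * (F (cov nab (fr.X k)).toSX).1 x +
      ∑ j, (tw i (fr.coeffIns nab j D.1)).1 x * (F (ins (fr.χ j)).toSX).1 x := by
  have hom : ∀ {l : ZMod 2} (D : HomDer m n V l), (F D.toSX).1 x =
      ∑ k, (tw i (D (ofFun m n V (fr.f k)))).1 x * (F (cov nab (fr.X k)).toSX).1 x +
      ∑ j, (tw i (fr.coeffIns nab j D.toMap)).1 x * (F (ins (fr.χ j)).toSX).1 x := by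
    intro l D
    let R : SX m n V := D.toSX - (∑ k, D (ofFun m n V (fr.f k)) • (cov nab (fr.X k)).toSX +
      ∑ j, fr.coeffIns nab j D.toMap • (ins (fr.χ j)).toSX)
    have hR : ∀ a, R.1 a = D a - (∑ k, D (ofFun m n V (fr.f k)) * cov nab (fr.X k) a +
      ∑ j, fr.coeffIns nab j D.toMap * ins (fr.χ j) a) := by
      intro a
      simp only [R, AddSubgroupClass.coe_sub, Submodule.coe_add, Submodule.coe_sum,
        Submodule.coe_smul, LinearMap.sub_apply, LinearMap.add_apply, LinearMap.sum_apply,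
        LinearMap.smul_apply, smul_eq_mul]
      rfl
    obtain ⟨ρ, hρ1, hρ⟩ := exists_bump (m := m) x (eventually_eventually_nhds.2 hfr)
    -- The expansion is only local, while `F` is linear over global superfunctions. On the support
    -- of `ρ` the expansion holds, so `ρ R` vanishes identically; linearity then gives `F R = 0` at
    -- `x`.
    have h0 : ofFun m n V ρ • R = 0 := by
      refine Subtype.ext (LinearMap.ext fun a => ?_)
      change ofFun m n V ρ * R.1 a = 0
      refine bump_mul_eq_zero fun y hy => ?_
      rw [hR, coe_sub_apply, coe_add_apply, coe_sum_apply, coe_sum_apply, sub_eq_zero]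
      exact homDer_apply_eq nab (hρ hy) D a
    have h1 := hF.map_smul (ofFun m n V ρ) R
    rw [h0, hF.map_zero, tw_ofFun] at h1
    have h2 : (F R).1 x = 0 :=
      eq_at_of_bump_mul_eq_zero hρ1.self_of_nhds (by rw [← h1]; rfl)
    simp only [R, hF.map_sub, hF.map_add, hF.map_sum, hF.map_smul] at h2
    rw [coe_sub_apply, sub_eq_zero, coe_add_apply, coe_sum_apply, coe_sum_apply] at h2
    exact h2
  obtain ⟨D, D₀, D₁, h₀, h₁, rfl⟩ := D
  have hsplit : (⟨D₀ + D₁, ⟨D₀, D₁, h₀, h₁, rfl⟩⟩ : SX m n V) =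
      (⟨D₀, h₀⟩ : HomDer m n V 0).toSX + (⟨D₁, h₁⟩ : HomDer m n V 1).toSX := rfl
  rw [hsplit, hF.map_add, coe_add_apply, hom, hom]
  have e : ∀ a, (D₀ + D₁) a = D₀ a + D₁ a := fun _ => rfl
  change _ = ∑ k, (tw i ((D₀ + D₁) (ofFun m n V (fr.f k)))).1 x * _ +
    ∑ j, (tw i (fr.coeffIns nab j (D₀ + D₁))).1 x * _
  simp only [e, map_add, coe_add_apply, add_mul, Finset.sum_add_distrib]
  abel

end Frame

/-- A twisted linear map on supervector fields which vanishes on covariant derivatives and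
insertions is zero. -/
theorem eq_zero_of_cov_of_ins {i : ZMod 2} {F : SX m n V → SF m n V} (hF : IsTwisted i F)
    (hcov : ∀ X, F (cov nab X).toSX = 0) (hins : ∀ χ, F (ins χ).toSX = 0) (D : SX m n V) :
    F D = 0 := by
  refine SF.ext fun x => ?_
  obtain ⟨fr, hfr⟩ := exists_frame (m := m) (n := n) (V := V) x
  rw [Frame.apply_eq_sum nab hfr hF]
  simp only [hcov, hins, coe_zero_apply, mul_zero, Finset.sum_const_zero, add_zero]

end Generation

/-! ## Graded commutators and exterior differentials -/

section Forms

variable {m n : ℕ} {M : Type*} [TopologicalSpace M] [T2Space M]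
  [ChartedSpace (EuclideanSpace ℝ (Fin m)) M] [IsManifold (𝓡 m) ∞ M]
  {V : M → Type*} [TopologicalSpace (TotalSpace (EuclideanSpace ℝ (Fin n)) V)]
  [∀ x, AddCommGroup (V x)] [∀ x, Module ℝ (V x)] [∀ x, TopologicalSpace (V x)]
  [∀ x, IsTopologicalAddGroup (V x)] [∀ x, ContinuousSMul ℝ (V x)]
  [FiberBundle (EuclideanSpace ℝ (Fin n)) V] [VectorBundle ℝ (EuclideanSpace ℝ (Fin n)) V]
  [ContMDiffVectorBundle ∞ (EuclideanSpace ℝ (Fin n)) V (𝓡 m)]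

theorem SX.ext {D D' : SX m n V} (h : ∀ a, D.1 a = D'.1 a) : D = D' :=
  Subtype.ext (LinearMap.ext h)

theorem SX.exists_homDer (D : SX m n V) :
    ∃ (D₀ : HomDer m n V 0) (D₁ : HomDer m n V 1), D = D₀.toSX + D₁.toSX := by
  obtain ⟨D, D₀, D₁, h₀, h₁, rfl⟩ := D
  exact ⟨⟨D₀, h₀⟩, ⟨D₁, h₁⟩, rfl⟩

theorem SX.add_apply (D D' : SX m n V) (a : SF m n V) : (D + D').1 a = D.1 a + D'.1 a := rfl

theorem SX.smul_apply (b : SF m n V) (D : SX m n V) (a : SF m n V) : (b • D).1 a = b * D.1 a := rfl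

theorem SX.real_smul_apply (r : ℝ) (D : SX m n V) (a : SF m n V) : (r • D).1 a = r • D.1 a := rfl

theorem HomDer.toSX_apply {i : ZMod 2} (D : HomDer m n V i) (a : SF m n V) : D.toSX.1 a = D a := rfl

theorem HomDer.bracket_apply {i j : ZMod 2} (D : HomDer m n V i) (D' : HomDer m n V j)
    (a : SF m n V) : D.bracket D' a = D (D' a) - sgn (i * j) • D' (D a) := rfl

theorem HomDer.map_mul {i : ZMod 2} (D : HomDer m n V i) (a b : SF m n V) :
    D (a * b) = D a * b + tw i a * D b := D.isDer.map_mul a b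

theorem HomDer.map_add {i : ZMod 2} (D : HomDer m n V i) (a b : SF m n V) :
    D (a + b) = D a + D b := D.toMap.map_add a b

theorem HomDer.map_sub {i : ZMod 2} (D : HomDer m n V i) (a b : SF m n V) :
    D (a - b) = D a - D b := D.toMap.map_sub a b

theorem HomDer.map_smul {i : ZMod 2} (D : HomDer m n V i) (r : ℝ) (a : SF m n V) :
    D (r • a) = r • D a := D.toMap.map_smul r a

theorem HomDer.map_zero {i : ZMod 2} (D : HomDer m n V i) : D 0 = 0 := D.toMap.map_zero

/-- Conjugation by the involution produces the sign in a graded commutator. In this form the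
commutator and the differential extend to inhomogeneous second arguments, as in `ad` and
`OneForm.dRight`. -/
theorem HomDer.tw_conj {j : ZMod 2} (i : ZMod 2) (D : HomDer m n V j) (a : SF m n V) :
    tw i (D (tw i a)) = sgn (i * j) • D a := by
  have h : ∀ (k : ZMod 2) (a : SF m n V), HasParity k a →
      tw i (D (tw i a)) = sgn (i * j) • D a := by
    intro k a ha
    rw [tw_eq_smul ha, D.map_smul, _root_.map_smul, tw_eq_smul (D.isDer.parity k a ha), mul_add,
      sgn_add, smul_smul, mul_comm, mul_assoc, sgn_mul_self, mul_one]
  obtain ⟨a₀, a₁, h₀, h₁, rfl⟩ := exists_parity_decomposition a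
  rw [_root_.map_add, D.map_add, _root_.map_add, h 0 _ h₀, h 1 _ h₁, D.map_add, smul_add]

/-- The graded commutator of a homogeneous supervector field with an arbitrary one. -/
def ad {i : ZMod 2} (D : HomDer m n V i) (D' : SX m n V) : SX m n V :=
  ⟨D.toMap ∘ₗ D'.1 - (tw i).toLinearMap ∘ₗ D'.1 ∘ₗ (tw i).toLinearMap ∘ₗ D.toMap, by
    obtain ⟨D₀, D₁, rfl⟩ := SX.exists_homDer D'
    have h := add_mem (D.bracket D₀).toSX.2 (D.bracket D₁).toSX.2
    convert h using 1
    refine LinearMap.ext fun a => ?_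
    change D (D₀ a + D₁ a) - tw i (D₀ (tw i (D a)) + D₁ (tw i (D a))) =
      (D (D₀ a) - sgn (i * 0) • D₀ (D a)) + (D (D₁ a) - sgn (i * 1) • D₁ (D a))
    rw [_root_.map_add (tw i), D₀.tw_conj, D₁.tw_conj, D.toMap.map_add]
    abel⟩

theorem ad_apply {i : ZMod 2} (D : HomDer m n V i) (D' : SX m n V) (a : SF m n V) :
    (ad D D').1 a = D (D'.1 a) - tw i (D'.1 (tw i (D a))) := rfl

theorem ad_toSX {i j : ZMod 2} (D : HomDer m n V i) (D' : HomDer m n V j) :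
    ad D D'.toSX = (D.bracket D').toSX :=
  SX.ext fun a => by
    rw [ad_apply, HomDer.toSX_apply, HomDer.toSX_apply, HomDer.toSX_apply, HomDer.bracket_apply,
      D'.tw_conj]

theorem ad_add {i : ZMod 2} (D : HomDer m n V i) (D' D'' : SX m n V) :
    ad D (D' + D'') = ad D D' + ad D D'' :=
  SX.ext fun a => by
    simp only [ad_apply, SX.add_apply, D.map_add, _root_.map_add]
    abel

theorem ad_smul {i : ZMod 2} (D : HomDer m n V i) (a : SF m n V) (D' : SX m n V) :
    ad D (a • D') = D a • D' + tw i a • ad D D' :=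
  SX.ext fun b => by
    simp only [ad_apply, SX.add_apply, SX.smul_apply, D.map_mul, _root_.map_mul, mul_sub]
    abel

theorem OneForm.isTwisted (lam : OneForm m n V) : IsTwisted 0 lam where
  map_add := lam.map_add
  map_smul a D := by rw [tw_zero, lam.map_smul, smul_eq_mul]

theorem OneForm.map_real_smul (lam : OneForm m n V) (r : ℝ) (D : SX m n V) :
    lam (r • D) = r • lam D := by
  have h : r • D = (algebraMap ℝ (SF m n V) r) • D :=
    SX.ext fun a => by rw [SX.real_smul_apply, SX.smul_apply, Algebra.smul_def]
  rw [h, lam.map_smul, smul_eq_mul, ← Algebra.smul_def]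

theorem TwoForm.isTwisted_left (Ω : TwoForm m n V) (D' : SX m n V) :
    IsTwisted 0 fun D => Ω.toMap D D' where
  map_add D₁ D₂ := by rw [Ω.toMap.map_add, LinearMap.add_apply]
  map_smul a D := by rw [tw_zero, Ω.smul_left]

theorem TwoForm.isTwisted_right (Ω : TwoForm m n V) {i : ZMod 2} (D : HomDer m n V i) :
    IsTwisted i (Ω.toMap D.toSX) where
  map_add := (Ω.toMap D.toSX).map_add
  map_smul a D' := by
    obtain ⟨a₀, a₁, h₀, h₁, rfl⟩ := exists_parity_decomposition a
    rw [add_smul, (Ω.toMap D.toSX).map_add, Ω.smul_right i 0 D a₀ D' h₀,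
      Ω.smul_right i 1 D a₁ D' h₁, _root_.map_add, tw_eq_smul h₀, tw_eq_smul h₁, add_mul,
      smul_mul_assoc, smul_mul_assoc]

/-- The exterior differential of a graded `1`-form, with an arbitrary second argument. -/
def OneForm.dRight (lam : OneForm m n V) {i : ZMod 2} (D : HomDer m n V i) (D' : SX m n V) :
    SF m n V :=
  D (lam D') - tw i (D'.1 (tw i (lam D.toSX))) - lam (ad D D')

theorem OneForm.dRight_toSX (lam : OneForm m n V) {i j : ZMod 2} (D : HomDer m n V i)
    (D' : HomDer m n V j) : lam.dRight D D'.toSX = lam.d D D' := by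
  rw [OneForm.dRight, OneForm.d, HomDer.toSX_apply, D'.tw_conj, ad_toSX]

/-- Tensoriality of the differential: the term with `D a` from the Leibniz rule cancels against the
one from `ad_smul`. -/
theorem OneForm.isTwisted_dRight (lam : OneForm m n V) {i : ZMod 2} (D : HomDer m n V i) :
    IsTwisted i (lam.dRight D) where
  map_add D₁ D₂ := by
    simp only [OneForm.dRight, ad_add, lam.map_add, SX.add_apply, D.map_add, _root_.map_add]
    abel
  map_smul a D' := by
    simp only [OneForm.dRight, ad_smul, lam.map_add, lam.map_smul, SX.smul_apply, smul_eq_mul,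
      D.map_mul, _root_.map_mul, mul_sub]
    abel

theorem HomDer.bracket_comm {i j : ZMod 2} (D : HomDer m n V i) (D' : HomDer m n V j) :
    (D.bracket D').toSX = (-sgn (i * j)) • (D'.bracket D).toSX :=
  SX.ext fun a => by
    rw [SX.real_smul_apply]
    simp only [HomDer.toSX_apply, HomDer.bracket_apply, smul_sub, smul_smul, mul_comm j i, neg_mul,
      sgn_mul_self, neg_smul, one_smul]
    abel

theorem OneForm.d_alternating (lam : OneForm m n V) {i j : ZMod 2} (D : HomDer m n V i)
    (D' : HomDer m n V j) : lam.d D D' = -(sgn (i * j) • lam.d D' D) := by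
  rw [OneForm.d, OneForm.d, HomDer.bracket_comm, lam.map_real_smul]
  simp only [smul_sub, smul_smul, mul_comm j i, sgn_mul_self, neg_smul, one_smul]
  abel

variable (nab : CovariantDerivative (𝓡 m) (EuclideanSpace ℝ (Fin n)) V)
  [CovariantDerivative.ContMDiffCovariantDerivative nab ∞]

/-- A homogeneous family of twisted maps that is graded alternating vanishes as soon as it vanishes
on covariant derivatives and insertions. -/
theorem eq_zero_of_alternating_of_cov_of_ins
    (B : ∀ {i : ZMod 2}, HomDer m n V i → SX m n V → SF m n V)
    (hB : ∀ {i : ZMod 2} (D : HomDer m n V i), IsTwisted i (B D))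
    (halt : ∀ {i j : ZMod 2} (D : HomDer m n V i) (D' : HomDer m n V j),
      B D D'.toSX = -(sgn (i * j) • B D' D.toSX))
    (hcc : ∀ X Y, B (cov nab X) (cov nab Y).toSX = 0)
    (hci : ∀ X χ, B (cov nab X) (ins χ).toSX = 0)
    (hii : ∀ χ ψ, B (ins χ) (ins ψ).toSX = 0) {i : ZMod 2} (D : HomDer m n V i) (D' : SX m n V) :
    B D D' = 0 := by
  have hic : ∀ χ X, B (ins χ) (cov nab X).toSX = 0 := fun χ X => by
    rw [halt, hci, smul_zero, neg_zero]
  have hc : ∀ X D', B (cov nab X) D' = 0 := fun X =>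
    eq_zero_of_cov_of_ins nab (hB _) (hcc X) (hci X)
  have hi : ∀ χ D', B (ins χ) D' = 0 := fun χ =>
    eq_zero_of_cov_of_ins nab (hB _) (hic χ) (hii χ)
  refine eq_zero_of_cov_of_ins nab (hB D) (fun X => ?_) (fun χ => ?_) D'
  · rw [halt, hc, smul_zero, neg_zero]
  · rw [halt, hi, smul_zero, neg_zero]

theorem IsDer.ext {i : ZMod 2} {D D' : SF m n V →ₗ[ℝ] SF m n V} (hD : IsDer i D)
    (hD' : IsDer i D') (hfun : ∀ f, D (ofFun m n V f) = D' (ofFun m n V f))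
    (hsec : ∀ σ, D (ofSec m n V σ) = D' (ofSec m n V σ)) : D = D' := by
  have h := hD.sub hD'
  refine LinearMap.ext fun a => SF.ext fun x => ?_
  have key := eq_zero_of_generators (i := i) (ev x ∘ₗ (D - D'))
    (fun a b => congrArg (fun c : SF m n V => c.1 x) (h.map_mul a b))
    (fun a b hab => h.congr_of_eventually hab) (fun f => ?_) (fun σ => ?_) a
  · exact sub_eq_zero.1 key
  · change (D _).1 x - (D' _).1 x = 0
    rw [hfun, sub_self]
  · change (D _).1 x - (D' _).1 x = 0
    rw [hsec, sub_self]

/-- `D` shifts the degree of superfunctions by `w`. -/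
def HasWeight (w : ℝ) {i : ZMod 2} (D : HomDer m n V i) : Prop :=
  ∀ a, eps m n V (D a) = D (eps m n V a) + w • D a

theorem HasWeight.ad_eq {w : ℝ} {i : ZMod 2} {D : HomDer m n V i} (h : HasWeight w D) :
    ad (eps m n V) D.toSX = w • D.toSX :=
  SX.ext fun a => by
    rw [ad_apply, HomDer.toSX_apply, h, tw_zero, tw_zero, SX.real_smul_apply]
    simp only [HomDer.toSX_apply, add_sub_cancel_left]

/-- The bracket [ε, D] and `w • D` are derivations of the same parity, so it is enough that they
agree on generators. -/
theorem HasWeight.of_generators {w : ℝ} {i : ZMod 2} {D : HomDer m n V i}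
    (hfun : ∀ f, eps m n V (D (ofFun m n V f)) = w • D (ofFun m n V f))
    (hsec : ∀ σ, eps m n V (D (ofSec m n V σ)) = (1 + w) • D (ofSec m n V σ)) :
    HasWeight w D := by
  have hw : IsDer i (w • D.toMap) :=
    { parity := fun j a ha => (D.isDer.parity j a ha).smul w
      leibniz := fun j a b ha => by
        simp only [LinearMap.smul_apply, D.isDer.leibniz j a b ha, smul_add, smul_mul_assoc,
          mul_smul_comm, smul_comm w] }
  -- The bracket carries the parity `0 + i`, which has to be transported to `i`.
  have hbr : IsDer i ((eps m n V).bracket D).toMap := by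
    have h := ((eps m n V).bracket D).isDer
    have e : ∀ k, k = i → IsDer k ((eps m n V).bracket D).toMap →
        IsDer i ((eps m n V).bracket D).toMap := fun k hk hD => hk ▸ hD
    exact e _ (zero_add i) h
  have heq : ((eps m n V).bracket D).toMap = w • D.toMap := by
    refine hbr.ext hw (fun f => ?_) (fun σ => ?_)
    · have e : eps m n V (ofFun m n V f) = 0 := SF.ext fun x => by
        rw [coe_eps_apply, coe_ofFun_apply, eul_of_mem (algebraMap_mem_degree _)]
        simp
      rw [HomDer.bracket_apply, e, D.map_zero, smul_zero, sub_zero, hfun, LinearMap.smul_apply]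
    · have e : eps m n V (ofSec m n V σ) = ofSec m n V σ := SF.ext fun x => by
        rw [coe_eps_apply, coe_ofSec_apply, eul_of_mem (ι_mem_degree _)]
        simp
      rw [HomDer.bracket_apply, e, hsec, zero_mul, sgn_zero, LinearMap.smul_apply, add_smul]
      abel
  intro a
  have h := LinearMap.congr_fun heq a
  rw [HomDer.bracket_apply, zero_mul, sgn_zero, one_smul, LinearMap.smul_apply] at h
  rw [← h]
  abel

theorem hasWeight_cov (X : VecField m M) : HasWeight 0 (cov nab X) :=
  HasWeight.of_generators
    (fun f => SF.ext fun x => by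
      rw [coe_eps_apply, coe_cov_ofFun, eul_of_mem (algebraMap_mem_degree _), zero_smul]
      simp)
    (fun σ => SF.ext fun x => by
      rw [coe_eps_apply, coe_smul_apply, coe_cov_ofSec, eul_of_mem (ι_mem_degree _)]
      simp)

theorem hasWeight_ins (χ : DualSec m n V) : HasWeight (-1) (ins χ) :=
  HasWeight.of_generators
    (fun f => SF.ext fun x => by
      rw [coe_eps_apply, coe_smul_apply, coe_ins_apply, coe_ofFun_apply, contr_algebraMap,
        map_zero, smul_zero])
    (fun σ => SF.ext fun x => by
      rw [coe_eps_apply, coe_smul_apply, coe_ins_apply, coe_ofSec_apply, contr_ι,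
        eul_of_mem (algebraMap_mem_degree _)]
      simp)

theorem HasWeight.bracket {w w' : ℝ} {i j : ZMod 2} {D : HomDer m n V i} {D' : HomDer m n V j}
    (h : HasWeight w D) (h' : HasWeight w' D') : HasWeight (w + w') (D.bracket D') := by
  intro a
  simp only [HomDer.bracket_apply, HomDer.map_sub, HomDer.map_smul, h _, h' _, HomDer.map_add]
  module

end Forms

/-! ## Primitives of closed odd two-forms -/

section Primitive

variable {m n : ℕ} {M : Type*} [TopologicalSpace M] [T2Space M]
  [ChartedSpace (EuclideanSpace ℝ (Fin m)) M] [IsManifold (𝓡 m) ∞ M]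
  {V : M → Type*} [TopologicalSpace (TotalSpace (EuclideanSpace ℝ (Fin n)) V)]
  [∀ x, AddCommGroup (V x)] [∀ x, Module ℝ (V x)] [∀ x, TopologicalSpace (V x)]
  [∀ x, IsTopologicalAddGroup (V x)] [∀ x, ContinuousSMul ℝ (V x)]
  [FiberBundle (EuclideanSpace ℝ (Fin n)) V] [VectorBundle ℝ (EuclideanSpace ℝ (Fin n)) V]
  [ContMDiffVectorBundle ∞ (EuclideanSpace ℝ (Fin n)) V (𝓡 m)]

/-- A fibre of `V` is linearly equivalent to the model fibre. -/
def fibreEquiv (x : M) : V x ≃ₗ[ℝ] EuclideanSpace ℝ (Fin n) :=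
  ((trivializationAt (EuclideanSpace ℝ (Fin n)) V x).continuousLinearEquivAt ℝ x
    (mem_baseSet_trivializationAt _ V x)).toLinearEquiv

theorem finrank_fibre (x : M) : Module.finrank ℝ (V x) = n := by
  rw [(fibreEquiv (n := n) (V := V) x).finrank_eq, finrank_euclideanSpace_fin]

theorem sum_proj_fibre {x : M} (y : ExteriorAlgebra ℝ (V x)) :
    ∑ k ∈ Finset.range (n + 1), proj k y = y :=
  haveI : Module.Finite ℝ (V x) := Module.Finite.equiv (fibreEquiv (n := n) x).symm
  sum_proj (finrank_fibre (n := n) x).le y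

theorem proj_fibre_eq_zero {x : M} {k : ℕ} (hk : n < k) (y : ExteriorAlgebra ℝ (V x)) :
    proj k y = 0 :=
  haveI : Module.Finite ℝ (V x) := Module.Finite.equiv (fibreEquiv (n := n) x).symm
  eq_zero_of_mem_degree ((finrank_fibre (n := n) x).trans_lt hk) (proj_mem k y)

theorem SF.ext_pr {a b : SF m n V} (h : ∀ k ≤ n, pr k a = pr k b) : a = b :=
  SF.ext fun x => by
    rw [← sum_proj_fibre (n := n) (a.1 x), ← sum_proj_fibre (n := n) (b.1 x)]
    refine Finset.sum_congr rfl fun k hk => ?_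
    exact congrArg (fun c : SF m n V => c.1 x) (h k (Nat.lt_succ_iff.1 (Finset.mem_range.1 hk)))

theorem pr_eps (k : ℕ) (a : SF m n V) : pr k (eps m n V a) = (k : ℝ) • pr k a :=
  SF.ext fun x => by
    rw [coe_pr_apply, coe_eps_apply, proj_eul, coe_smul_apply, coe_pr_apply]

theorem pr_eq_zero_of_hasParity {i : ZMod 2} {k : ℕ} (hk : (k : ZMod 2) ≠ i) {a : SF m n V}
    (ha : HasParity i a) : pr k a = 0 :=
  SF.ext fun x => proj_eq_zero_of_parity hk (ha x)

/-- The degree k part is an eigenvector of ε with eigenvalue k. Only degrees with a nonzero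
component are tested, so that parity can rule out the remaining ones. -/
theorem eq_zero_of_eps_eq {a : SF m n V} {w : ℝ} (hw : ∀ k ≤ n, pr k a ≠ 0 → (k : ℝ) ≠ w)
    (h : eps m n V a = w • a) : a = 0 := by
  refine SF.ext_pr fun k hk => ?_
  by_contra hne
  rw [map_zero] at hne
  have h1 := pr_eps k a
  rw [h, map_smul, ← sub_eq_zero, ← sub_smul] at h1
  rcases smul_eq_zero.1 h1 with h2 | h2
  · exact hw k hk hne (sub_eq_zero.1 h2).symm
  · exact hne h2

namespace OneForm

/-- The Lie derivative of a graded `1`-form along the Euler field. -/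
def lieEps (ν : OneForm m n V) : OneForm m n V where
  toFun D := eps m n V (ν D) - ν (ad (eps m n V) D)
  map_add' D D' := by
    rw [ν.map_add, HomDer.map_add, ad_add, ν.map_add]
    abel
  map_smul' a D := by
    rw [RingHom.id_apply, ν.map_smul, ad_smul, ν.map_add, ν.map_smul, ν.map_smul, smul_eq_mul,
      smul_eq_mul, smul_eq_mul, HomDer.map_mul, tw_zero, smul_eq_mul, mul_sub]
    abel

theorem lieEps_apply (ν : OneForm m n V) (D : SX m n V) :
    ν.lieEps D = eps m n V (ν D) - ν (ad (eps m n V) D) := rfl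

/-- A polynomial in the Lie derivative along the Euler field, applied to a `1`-form. -/
def polyLieEps (p : Polynomial ℝ) (ν : OneForm m n V) : OneForm m n V where
  toFun D := ∑ j ∈ Finset.range (p.natDegree + 1), p.coeff j • lieEps^[j] ν D
  map_add' D D' := by
    rw [← Finset.sum_add_distrib]
    exact Finset.sum_congr rfl fun j _ => by rw [LinearMap.map_add, smul_add]
  map_smul' a D := by
    rw [RingHom.id_apply, smul_eq_mul, Finset.mul_sum]
    exact Finset.sum_congr rfl fun j _ => by rw [LinearMap.map_smul, smul_eq_mul, mul_smul_comm]

theorem polyLieEps_apply (p : Polynomial ℝ) (ν : OneForm m n V) (D : SX m n V) :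
    polyLieEps p ν D = ∑ j ∈ Finset.range (p.natDegree + 1), p.coeff j • lieEps^[j] ν D := rfl

theorem lieEps_of_hasWeight (ν : OneForm m n V) {w : ℝ} {i : ZMod 2} {D : HomDer m n V i}
    (h : HasWeight w D) : ν.lieEps D.toSX = eps m n V (ν D.toSX) - w • ν D.toSX := by
  rw [lieEps_apply, h.ad_eq, ν.map_real_smul]

/-- L_ε is diagonal with respect to degree and weight. On the generators the eigenvalues are k at
`∇_X` and k + 1 at `i_χ`. -/
theorem pr_lieEps (ν : OneForm m n V) {w : ℝ} {i : ZMod 2} {D : HomDer m n V i}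
    (h : HasWeight w D) (k : ℕ) : pr k (ν.lieEps D.toSX) = ((k : ℝ) - w) • pr k (ν D.toSX) := by
  rw [ν.lieEps_of_hasWeight h, map_sub, pr_eps, map_smul, sub_smul]

theorem pr_iterate_lieEps {w : ℝ} {i : ZMod 2} {D : HomDer m n V i} (h : HasWeight w D) (k j : ℕ)
    (ν : OneForm m n V) :
    pr k (lieEps^[j] ν D.toSX) = ((k : ℝ) - w) ^ j • pr k (ν D.toSX) := by
  induction j with
  | zero => simp
  | succ j ih => rw [Function.iterate_succ_apply', pr_lieEps _ h, ih, smul_smul, pow_succ']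

theorem pr_polyLieEps (p : Polynomial ℝ) (ν : OneForm m n V) {w : ℝ} {i : ZMod 2}
    {D : HomDer m n V i} (h : HasWeight w D) (k : ℕ) :
    pr k (polyLieEps p ν D.toSX) = p.eval ((k : ℝ) - w) • pr k (ν D.toSX) := by
  rw [polyLieEps_apply, map_sum, p.eval_eq_sum_range, Finset.sum_smul]
  exact Finset.sum_congr rfl fun j _ => by rw [map_smul, pr_iterate_lieEps h, smul_smul]

/-- A `1`-form that reverses parity. -/
def IsOdd (ν : OneForm m n V) : Prop :=
  ∀ (i : ZMod 2) (D : HomDer m n V i), HasParity (i + 1) (ν D.toSX)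

theorem IsOdd.lieEps {ν : OneForm m n V} (h : ν.IsOdd) : ν.lieEps.IsOdd := by
  intro i D
  rw [lieEps_apply, ad_toSX]
  have h1 := (eps m n V).isDer.parity _ _ (h i D)
  have h2 := h _ ((eps m n V).bracket D)
  have e : ∀ k, k = 0 + i → HasParity (k + 1) (eps m n V (ν D.toSX)) →
      HasParity (0 + i + 1) (eps m n V (ν D.toSX)) := fun k hk h => hk ▸ h
  have h3 := (e i (zero_add i).symm (by rwa [zero_add] at h1)).sub h2
  revert h3
  generalize ν ((eps m n V).bracket D).toSX = c
  rw [zero_add]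
  exact id

theorem IsOdd.polyLieEps {ν : OneForm m n V} (h : ν.IsOdd) (p : Polynomial ℝ) :
    (polyLieEps p ν).IsOdd := by
  intro i D
  have hj : ∀ j, IsOdd (OneForm.lieEps^[j] ν) := by
    intro j
    induction j with
    | zero => exact h
    | succ j ih =>
      rw [Function.iterate_succ_apply']
      exact ih.lieEps
  exact HasParity.sum fun j => (hj j i D).smul _

theorem IsOdd.d {ν : OneForm m n V} (h : ν.IsOdd) {i j : ZMod 2} (D : HomDer m n V i)
    (D' : HomDer m n V j) : HasParity (i + j + 1) (ν.d D D') := by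
  have h1 := D.isDer.parity _ _ (h j D')
  have h2 := D'.isDer.parity _ _ (h i D)
  have h3 := h _ (D.bracket D')
  rw [← add_assoc] at h1 h2
  rw [add_comm j i] at h2
  exact (h1.sub (h2.smul _)).sub h3

/-- This is d L_ε = L_ε d, evaluated on fields of weights `w` and `w'`, whose brackets with ε
contribute the term `w + w'`. -/
theorem eps_d (ν : OneForm m n V) {w w' : ℝ} {i j : ZMod 2} {D : HomDer m n V i}
    {D' : HomDer m n V j} (h : HasWeight w D) (h' : HasWeight w' D') :
    eps m n V (ν.d D D') = (w + w') • ν.d D D' + ν.lieEps.d D D' := by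
  have e1 := h (ν D'.toSX)
  have e2 := h' (ν D.toSX)
  simp only [OneForm.d, HomDer.map_sub, HomDer.map_smul, ν.lieEps_of_hasWeight h,
    ν.lieEps_of_hasWeight h', ν.lieEps_of_hasWeight (h.bracket h'), e1, e2]
  module

end OneForm

/-- Cartan's formula L_ε Ω = d(ι_ε Ω) for closed Ω: it is the identity dΩ(ε, D, D') = 0, in which
brackets with ε act by the weights. -/
theorem TwoForm.eps_apply {Ω : TwoForm m n V} (hΩ : Ω.IsClosed) {w w' : ℝ} {i j : ZMod 2}
    {D : HomDer m n V i} {D' : HomDer m n V j} (h : HasWeight w D) (h' : HasWeight w' D') :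
    eps m n V (Ω.toMap D.toSX D'.toSX) = (w + w') • Ω.toMap D.toSX D'.toSX +
      (Ω.contract (eps m n V).toSX).d D D' := by
  have key := hΩ 0 i j (eps m n V) D D'
  have e1 : Ω.toMap ((eps m n V).bracket D).toSX D'.toSX = w • Ω.toMap D.toSX D'.toSX := by
    rw [← ad_toSX, h.ad_eq, map_smul, LinearMap.smul_apply]
  have e2 : Ω.toMap ((eps m n V).bracket D').toSX D.toSX = w' • Ω.toMap D'.toSX D.toSX := by
    rw [← ad_toSX, h'.ad_eq, map_smul, LinearMap.smul_apply]
  have e3 : ∀ {k : ZMod 2} (D : HomDer m n V k),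
      Ω.contract (eps m n V).toSX D.toSX = Ω.toMap (eps m n V).toSX D.toSX := by
    intro _ D
    rw [Ω.contract_apply, zero_mul, sgn_zero, one_smul]
  have e4 := Ω.alternating _ _ (eps m n V) (D.bracket D')
  have e5 := Ω.alternating _ _ D D'
  simp only [TwoForm.d, e1, e2, zero_mul, zero_add, sgn_zero, one_smul, add_zero] at key e4
  rw [OneForm.d, e3, e3, e3, e4]
  have e6 : sgn (i * j) • w' • Ω.toMap D'.toSX D.toSX = -(w' • Ω.toMap D.toSX D'.toSX) := by
    rw [e5, smul_comm, smul_neg, neg_neg]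
  rw [e6] at key
  rw [← sub_eq_zero, ← key]
  module

-- The nodes 1, …, n + 1 contain every eigenvalue of L_ε that occurs for odd 1-forms: k with 1 ≤ k ≤
-- n at `∇_X`, and k + 1 with 0 ≤ k ≤ n at `i_χ`. Inverting L_ε by a polynomial in L_ε keeps
-- linearity over superfunctions and parity for free.
variable (n) in
theorem exists_inverse_polynomial :
    ∃ p : Polynomial ℝ, ∀ k : ℕ, 1 ≤ k → k ≤ n + 1 → p.eval (k : ℝ) = (k : ℝ)⁻¹ :=
  ⟨Lagrange.interpolate (Finset.Icc 1 (n + 1)) (fun k : ℕ => (k : ℝ)) fun k => (k : ℝ)⁻¹,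
    fun _ h1 h2 => Lagrange.eval_interpolate_at_node _ (fun _ _ _ _ h => Nat.cast_injective h)
      (Finset.mem_Icc.2 ⟨h1, h2⟩)⟩

variable (nab : CovariantDerivative (𝓡 m) (EuclideanSpace ℝ (Fin n)) V)
  [CovariantDerivative.ContMDiffCovariantDerivative nab ∞]

theorem OneForm.ext_generators {ν ν' : OneForm m n V}
    (hcov : ∀ X, ν (cov nab X).toSX = ν' (cov nab X).toSX)
    (hins : ∀ χ, ν (ins χ).toSX = ν' (ins χ).toSX) : ν = ν' :=
  LinearMap.ext fun D => sub_eq_zero.1 <|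
    eq_zero_of_cov_of_ins nab (ν.isTwisted.sub ν'.isTwisted)
      (fun X => sub_eq_zero.2 (hcov X)) (fun χ => sub_eq_zero.2 (hins χ)) D

theorem TwoForm.contract_eps_eps (Ω : TwoForm m n V) :
    Ω.contract (eps m n V).toSX (eps m n V).toSX = 0 := by
  have h := Ω.alternating _ _ (eps m n V) (eps m n V)
  rw [zero_mul, sgn_zero, one_smul] at h
  rw [Ω.contract_apply, zero_mul, sgn_zero, one_smul]
  rw [eq_neg_iff_add_eq_zero, ← two_smul ℝ] at h
  exact (smul_eq_zero.1 h).resolve_left two_ne_zero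

theorem hasWeight_eps : HasWeight 0 (eps m n V) := fun a => by rw [zero_smul, add_zero]

/-- A closed odd `2`-form is the differential of an odd `1`-form that vanishes on the Euler
field. -/
theorem TwoForm.exists_primitive (nab : CovariantDerivative (𝓡 m) (EuclideanSpace ℝ (Fin n)) V)
    [CovariantDerivative.ContMDiffCovariantDerivative nab ∞] {Ω : TwoForm m n V} (hΩ : Ω.IsClosed) (hodd : Ω.IsOdd) :
    ∃ lam : OneForm m n V, lam.IsOdd ∧ lam (eps m n V).toSX = 0 ∧
      ∀ {i j : ZMod 2} (D : HomDer m n V i) (D' : HomDer m n V j),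
        Ω.toMap D.toSX D'.toSX = lam.d D D' := by
  set μ := Ω.contract (eps m n V).toSX with hμ
  have hμodd : μ.IsOdd := fun i D => by
    rw [hμ, Ω.contract_apply]
    have h := (hodd _ _ (eps m n V) D).smul (sgn (0 * i))
    rwa [zero_add] at h
  obtain ⟨p, hp⟩ := exists_inverse_polynomial n
  have hodd' := hμodd.polyLieEps p
  have hT : (OneForm.polyLieEps p μ).lieEps = μ := by
    refine OneForm.ext_generators nab (fun X => ?_) (fun χ => ?_)
    · refine SF.ext_pr fun k hk => ?_
      rw [OneForm.pr_lieEps _ (hasWeight_cov nab X), OneForm.pr_polyLieEps _ _ (hasWeight_cov nab X),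
        sub_zero, smul_smul]
      rcases Nat.eq_zero_or_pos k with rfl | h
      -- The eigenvalue 0 does no harm: `μ(∇_X)` is odd and so has no degree 0 part.
      · rw [pr_eq_zero_of_hasParity (by decide) (hμodd _ (cov nab X)), smul_zero]
      · rw [hp k h (by lia), mul_inv_cancel₀ (by positivity), one_smul]
    · refine SF.ext_pr fun k hk => ?_
      have e : (k : ℝ) - (-1) = ((k + 1 : ℕ) : ℝ) := by push_cast; ring
      rw [OneForm.pr_lieEps _ (hasWeight_ins χ), OneForm.pr_polyLieEps _ _ (hasWeight_ins χ),
        smul_smul, e, hp (k + 1) (by lia) (by lia), mul_inv_cancel₀ (by positivity), one_smul]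
  refine ⟨OneForm.polyLieEps p μ, hodd', ?_, ?_⟩
  -- The field ε has weight 0, so each component of λ(ε) is a multiple of the corresponding one of
  -- μ(ε), and μ(ε) = Ω(ε, ε) = 0.
  · refine SF.ext_pr fun k _ => ?_
    rw [OneForm.pr_polyLieEps _ _ hasWeight_eps, hμ, Ω.contract_eps_eps, map_zero, smul_zero]
  set lam := OneForm.polyLieEps p μ
  -- Since L_ε λ = μ and L_ε commutes with d, L_ε annihilates Ω - dλ. Its value on fields of weights
  -- `w` and `w'` therefore lives in degree `w + w'`.
  have hw : ∀ {w w' : ℝ} {i j : ZMod 2} {D : HomDer m n V i} {D' : HomDer m n V j},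
      HasWeight w D → HasWeight w' D' →
      eps m n V (Ω.toMap D.toSX D'.toSX - lam.d D D') =
        (w + w') • (Ω.toMap D.toSX D'.toSX - lam.d D D') := by
    intro w w' i j D D' h h'
    rw [HomDer.map_sub, lam.eps_d h h', hT, Ω.eps_apply hΩ h h']
    module
  intro i j D D'
  refine sub_eq_zero.1 ?_
  rw [← lam.dRight_toSX]
  refine eq_zero_of_alternating_of_cov_of_ins nab
    (fun {i} D D' => Ω.toMap (HomDer.toSX D) D' - lam.dRight D D')
    (fun D => (Ω.isTwisted_right D).sub (lam.isTwisted_dRight D)) (fun D D' => ?_) (fun X Y => ?_)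
    (fun X χ => ?_) (fun χ ψ => ?_) D D'.toSX
  · simp only [OneForm.dRight_toSX]
    rw [Ω.alternating, lam.d_alternating, smul_sub]
    abel
  -- Two covariant derivatives give total weight 0, but the value is odd and has no degree 0 part.
  -- The pairs below have weight -1 and -2, and there are no negative degrees.
  · rw [lam.dRight_toSX]
    refine eq_zero_of_eps_eq (fun k _ hk hk0 => hk ?_)
      (hw (hasWeight_cov nab X) (hasWeight_cov nab Y))
    have : k = 0 := by simpa using hk0
    subst this
    exact pr_eq_zero_of_hasParity (i := 0 + 0 + 1) (by decide)
      ((hodd _ _ (cov nab X) (cov nab Y)).sub (hodd'.d _ _))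
  · rw [lam.dRight_toSX]
    refine eq_zero_of_eps_eq (fun k _ _ hk0 => ?_) (hw (hasWeight_cov nab X) (hasWeight_ins χ))
    have : (0 : ℝ) ≤ k := k.cast_nonneg
    linarith
  · rw [lam.dRight_toSX]
    refine eq_zero_of_eps_eq (fun k _ _ hk0 => ?_) (hw (hasWeight_ins χ) (hasWeight_ins ψ))
    have : (0 : ℝ) ≤ k := k.cast_nonneg
    linarith

end Primitive

/-! ## Existence and uniqueness of the tensor fields -/

section ExteriorDegree

variable {W : Type*} [AddCommGroup W] [Module ℝ W]

theorem proj_succ_ι_mul (k : ℕ) (w : W) (y : ExteriorAlgebra ℝ W) :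
    proj (k + 1) (ExteriorAlgebra.ι ℝ w * y) = ExteriorAlgebra.ι ℝ w * proj k y := by
  rw [proj_mul, Finset.sum_eq_single (1, k)]
  · rw [proj_of_mem (ι_mem_degree w)]
  · rintro ⟨i, j⟩ hij hne
    have h1 : i ≠ 1 := by
      rintro rfl
      have := Finset.HasAntidiagonal.mem_antidiagonal.1 hij
      exact hne (by simp only [Prod.mk.injEq, true_and]; lia)
    rw [proj_of_mem_ne (ι_mem_degree w) h1.symm, zero_mul]
  · intro h
    exact absurd (Finset.HasAntidiagonal.mem_antidiagonal.2 (add_comm 1 k)) h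

theorem proj_sum_of_mem {s : Finset ℕ} {y : ℕ → ExteriorAlgebra ℝ W} (hy : ∀ k, y k ∈ ⋀[ℝ]^k W)
    (k : ℕ) : proj k (∑ j ∈ s, y j) = if k ∈ s then y k else 0 := by
  rw [map_sum, ← Finset.sum_ite_eq' s k y]
  refine Finset.sum_congr rfl fun j _ => ?_
  split_ifs with h
  · rw [← h, proj_of_mem (hy j)]
  · exact proj_of_mem_ne (hy j) h

end ExteriorDegree

/-! ### Values of 1-forms on the generators as tensor fields -/

section Tensors

variable {m n : ℕ} {M : Type*} [TopologicalSpace M] [T2Space M]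
  [ChartedSpace (EuclideanSpace ℝ (Fin m)) M] [IsManifold (𝓡 m) ∞ M]
  {V : M → Type*} [TopologicalSpace (TotalSpace (EuclideanSpace ℝ (Fin n)) V)]
  [∀ x, AddCommGroup (V x)] [∀ x, Module ℝ (V x)] [∀ x, TopologicalSpace (V x)]
  [∀ x, IsTopologicalAddGroup (V x)] [∀ x, ContinuousSMul ℝ (V x)]
  [FiberBundle (EuclideanSpace ℝ (Fin n)) V] [VectorBundle ℝ (EuclideanSpace ℝ (Fin n)) V]
  [ContMDiffVectorBundle ∞ (EuclideanSpace ℝ (Fin n)) V (𝓡 m)]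

namespace Frame

variable {fr : Frame m n V} {x : M}

theorem IsAt.sum_dual (h : fr.IsAt x) (φ : Module.Dual ℝ (V x)) :
    ∑ j, φ (fr.s j x) • (fr.χ j).toFun x = φ :=
  LinearMap.ext fun w => by
    conv_rhs => rw [← h.sum_fibre w, map_sum]
    rw [LinearMap.sum_apply]
    refine Finset.sum_congr rfl fun j _ => ?_
    rw [LinearMap.smul_apply, map_smul, smul_eq_mul, smul_eq_mul, mul_comm]

/-- The contraction of a linear map on the dual space with the exterior product does not depend on
the choice of dual bases. -/
theorem IsAt.sum_ι_mul (h : fr.IsAt x) (e : Module.Basis (Fin n) ℝ (V x))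
    (Λ : Module.Dual ℝ (V x) →ₗ[ℝ] ExteriorAlgebra ℝ (V x)) :
    ∑ i, ExteriorAlgebra.ι ℝ (e i) * Λ (e.coord i) =
      ∑ j, ExteriorAlgebra.ι ℝ (fr.s j x) * Λ ((fr.χ j).toFun x) := by
  have h1 : ∀ i, ExteriorAlgebra.ι ℝ (e i) * Λ (e.coord i) =
      ∑ j, ExteriorAlgebra.ι ℝ (e.coord i (fr.s j x) • e i) * Λ ((fr.χ j).toFun x) := by
    intro i
    conv_lhs => rw [← h.sum_dual (e.coord i), map_sum, Finset.mul_sum]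
    refine Finset.sum_congr rfl fun j _ => ?_
    rw [map_smul, map_smul, mul_smul_comm, smul_mul_assoc]
  simp only [h1]
  rw [Finset.sum_comm]
  refine Finset.sum_congr rfl fun j _ => ?_
  rw [← Finset.sum_mul, ← map_sum]
  congr 2
  exact e.sum_repr (fr.s j x)

theorem eps_ofFun (f : C^∞⟮𝓡 m, M; ℝ⟯) : eps m n V (ofFun m n V f) = 0 :=
  SF.ext fun x => by
    rw [coe_eps_apply, coe_ofFun_apply, eul_of_mem (algebraMap_mem_degree _)]
    simp

theorem eps_ofSec (σ : Sec m n V) : eps m n V (ofSec m n V σ) = ofSec m n V σ :=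
  SF.ext fun x => by
    rw [coe_eps_apply, coe_ofSec_apply, eul_of_mem (ι_mem_degree _)]
    simp

theorem ins_ofFun (χ : DualSec m n V) (f : C^∞⟮𝓡 m, M; ℝ⟯) : ins χ (ofFun m n V f) = 0 :=
  SF.ext fun x => by
    rw [coe_ins_apply, coe_ofFun_apply, contr_algebraMap]
    rfl

variable (nab : CovariantDerivative (𝓡 m) (EuclideanSpace ℝ (Fin n)) V)
  [CovariantDerivative.ContMDiffCovariantDerivative nab ∞]

/-- Locally ε = ∑ s_j i_{χ_j}. Hence, for a 1-form λ, the condition λ(ε) = 0 is the vanishing of the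
total antisymmetrization of `χ ↦ λ(i_χ)`. -/
theorem apply_eps_eq_sum (nab : CovariantDerivative (𝓡 m) (EuclideanSpace ℝ (Fin n)) V)
    [CovariantDerivative.ContMDiffCovariantDerivative nab ∞]
    (hfr : ∀ᶠ y in 𝓝 x, fr.IsAt y) {F : SX m n V → SF m n V}
    (hF : IsTwisted 0 F) :
    (F (eps m n V).toSX).1 x =
      ∑ j, ExteriorAlgebra.ι ℝ (fr.s j x) * (F (ins (fr.χ j)).toSX).1 x := by
  rw [apply_eq_sum nab hfr hF]
  have h1 : ∀ j, fr.coeffIns nab j (eps m n V).toSX.1 = ofSec m n V (fr.s j) := by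
    intro j
    rw [coeffIns_apply]
    simp only [HomDer.toSX_apply, eps_ofFun, eps_ofSec, zero_mul, Finset.sum_const_zero,
      sub_zero]
  simp only [h1, HomDer.toSX_apply, eps_ofFun, map_zero, coe_zero_apply, zero_mul,
    Finset.sum_const_zero, zero_add, tw_zero, coe_ofSec_apply]

/-- The field `∇_X` has no insertion part, since `∇_X s_j` is the combination of the `∇_{X_k} s_j`
with coefficients `X f_k`. So the value at `x` depends only on `X x`. -/
theorem apply_cov_eq_sum (hfr : ∀ᶠ y in 𝓝 x, fr.IsAt y) {F : SX m n V → SF m n V}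
    (hF : IsTwisted 0 F) (X : VecField m M) :
    (F (cov nab X).toSX).1 x =
      ∑ k, dAt x (fr.f k) (X x) • (F (cov nab (fr.X k)).toSX).1 x := by
  rw [apply_eq_sum nab hfr hF]
  have h1 : ∀ j, (fr.coeffIns nab j (cov nab X).toSX.1).1 x = 0 := by
    intro j
    rw [coeffIns_apply, coe_sub_apply, coe_sum_apply]
    simp only [HomDer.toSX_apply, coe_mul_apply, coe_cov_ofFun, coe_cov_ofSec, ← Algebra.smul_def,
      ← map_smul]
    rw [← map_sum, ← map_sub, ← map_sum, hfr.self_of_nhds.sum_tangent, sub_self, map_zero]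
  simp only [tw_zero, h1, HomDer.toSX_apply, coe_cov_ofFun, zero_mul, Finset.sum_const_zero,
    add_zero, ← Algebra.smul_def]

theorem apply_ins_eq_sum (nab : CovariantDerivative (𝓡 m) (EuclideanSpace ℝ (Fin n)) V)
    [CovariantDerivative.ContMDiffCovariantDerivative nab ∞]
    (hfr : ∀ᶠ y in 𝓝 x, fr.IsAt y) {F : SX m n V → SF m n V}
    (hF : IsTwisted 0 F) (χ : DualSec m n V) :
    (F (ins χ).toSX).1 x =
      ∑ j, χ.toFun x (fr.s j x) • (F (ins (fr.χ j)).toSX).1 x := by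
  rw [apply_eq_sum nab hfr hF]
  have h1 : ∀ j, (fr.coeffIns nab j (ins χ).toSX.1).1 x =
      algebraMap ℝ _ (χ.toFun x (fr.s j x)) := by
    intro j
    rw [coeffIns_apply]
    simp only [HomDer.toSX_apply, ins_ofFun, zero_mul, Finset.sum_const_zero, sub_zero,
      coe_ins_apply, coe_ofSec_apply, contr_ι]
  simp only [tw_zero, h1, HomDer.toSX_apply, ins_ofFun, coe_zero_apply, zero_mul,
    Finset.sum_const_zero, zero_add, ← Algebra.smul_def]

end Frame

/-- A frame that is dual near the point `x`. -/
def frameAt (m n : ℕ) {M : Type*} [TopologicalSpace M] [T2Space M]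
    [ChartedSpace (EuclideanSpace ℝ (Fin m)) M] [IsManifold (𝓡 m) ∞ M]
    (V : M → Type*) [TopologicalSpace (TotalSpace (EuclideanSpace ℝ (Fin n)) V)]
    [∀ x, AddCommGroup (V x)] [∀ x, Module ℝ (V x)] [∀ x, TopologicalSpace (V x)]
    [∀ x, IsTopologicalAddGroup (V x)] [∀ x, ContinuousSMul ℝ (V x)]
    [FiberBundle (EuclideanSpace ℝ (Fin n)) V] [VectorBundle ℝ (EuclideanSpace ℝ (Fin n)) V]
    [ContMDiffVectorBundle ∞ (EuclideanSpace ℝ (Fin n)) V (𝓡 m)] (x : M) : Frame m n V :=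
  (exists_frame x).choose

theorem frameAt_isAt (x : M) : ∀ᶠ y in 𝓝 x, (frameAt m n V x).IsAt y := (exists_frame x).choose_spec

theorem exists_vecField (x : M) (v : TangentSpace (𝓡 m) x) (fr : Frame m n V) (h : fr.IsAt x) :
    ∃ X : VecField m M, X x = v :=
  ⟨∑ k, dAt x (fr.f k) v • fr.X k, by
    change ContMDiffSection.coeAddHom (𝓡 m) (EuclideanSpace ℝ (Fin m)) ∞
      (TangentSpace (𝓡 m) : M → Type _) _ x = v
    rw [map_sum, Finset.sum_apply]
    exact h.sum_tangent v⟩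

variable (nab : CovariantDerivative (𝓡 m) (EuclideanSpace ℝ (Fin n)) V)
  [CovariantDerivative.ContMDiffCovariantDerivative nab ∞]

theorem IsCovariant.toSX_eq {X : VecField m M} {D : HomDer m n V 0} (h : IsCovariant nab X D) :
    D.toSX = (cov nab X).toSX := by
  have h' := isCovariant_cov nab X
  have e := D.isDer.ext (cov nab X).isDer
    (fun f => SF.ext fun x => (h.1 f x).trans (h'.1 f x).symm)
    (fun σ => SF.ext fun x => (h.2 σ x).trans (h'.2 σ x).symm)
  exact Subtype.ext e

theorem IsInsertion.toSX_eq {χ : DualSec m n V} {D : HomDer m n V 1} (h : IsInsertion χ D) :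
    D.toSX = (ins χ).toSX := by
  have h' := isInsertion_ins χ
  have e := D.isDer.ext (ins χ).isDer
    (fun f => SF.ext fun x => (h.1 f x).trans (h'.1 f x).symm)
    (fun σ => SF.ext fun x => (h.2 σ x).trans (h'.2 σ x).symm)
  exact Subtype.ext e

namespace OneForm

variable (lam : OneForm m n V)

/-- The tensor field `v ↦ λ(∇_v)`. -/
def onCov (x : M) : TangentSpace (𝓡 m) x →ₗ[ℝ] ExteriorAlgebra ℝ (V x) :=
  ∑ k, (dAt x ((frameAt m n V x).f k)).toLinearMap.smulRight
    ((lam (cov nab ((frameAt m n V x).X k)).toSX).1 x)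

theorem onCov_apply (x : M) (v : TangentSpace (𝓡 m) x) :
    lam.onCov nab x v = ∑ k, dAt x ((frameAt m n V x).f k) v •
      (lam (cov nab ((frameAt m n V x).X k)).toSX).1 x := by
  rw [onCov, LinearMap.sum_apply]
  rfl

theorem onCov_vecField (X : VecField m M) (x : M) :
    lam.onCov nab x (X x) = (lam (cov nab X).toSX).1 x := by
  rw [onCov_apply, Frame.apply_cov_eq_sum nab (frameAt_isAt x) lam.isTwisted]

/-- The tensor field `φ ↦ λ(i_φ)`. -/
def onIns (x : M) : Module.Dual ℝ (V x) →ₗ[ℝ] ExteriorAlgebra ℝ (V x) :=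
  ∑ j, (LinearMap.applyₗ ((frameAt m n V x).s j x)).smulRight
    ((lam (ins ((frameAt m n V x).χ j)).toSX).1 x)

theorem onIns_apply (x : M) (φ : Module.Dual ℝ (V x)) :
    lam.onIns x φ = ∑ j, φ ((frameAt m n V x).s j x) •
      (lam (ins ((frameAt m n V x).χ j)).toSX).1 x := by
  rw [onIns, LinearMap.sum_apply]
  rfl

end OneForm

end Tensors

/-! ### From a primitive to the tensor fields, and uniqueness -/

section Data

variable {m n : ℕ} {M : Type*} [TopologicalSpace M] [T2Space M]
  [ChartedSpace (EuclideanSpace ℝ (Fin m)) M] [IsManifold (𝓡 m) ∞ M]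
  {V : M → Type*} [TopologicalSpace (TotalSpace (EuclideanSpace ℝ (Fin n)) V)]
  [∀ x, AddCommGroup (V x)] [∀ x, Module ℝ (V x)] [∀ x, TopologicalSpace (V x)]
  [∀ x, IsTopologicalAddGroup (V x)] [∀ x, ContinuousSMul ℝ (V x)]
  [FiberBundle (EuclideanSpace ℝ (Fin n)) V] [VectorBundle ℝ (EuclideanSpace ℝ (Fin n)) V]
  [ContMDiffVectorBundle ∞ (EuclideanSpace ℝ (Fin n)) V (𝓡 m)]
  (nab : CovariantDerivative (𝓡 m) (EuclideanSpace ℝ (Fin n)) V)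
  [CovariantDerivative.ContMDiffCovariantDerivative nab ∞]

namespace OneForm

variable (lam : OneForm m n V)

theorem onIns_dualSec (nab : CovariantDerivative (𝓡 m) (EuclideanSpace ℝ (Fin n)) V)
    [CovariantDerivative.ContMDiffCovariantDerivative nab ∞] 
    (χ : DualSec m n V) (x : M) :
    lam.onIns x (χ.toFun x) = (lam (ins χ).toSX).1 x := by
  rw [onIns_apply, Frame.apply_ins_eq_sum nab (frameAt_isAt x) lam.isTwisted]

theorem sum_ι_mul_onIns (nab : CovariantDerivative (𝓡 m) (EuclideanSpace ℝ (Fin n)) V)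
    [CovariantDerivative.ContMDiffCovariantDerivative nab ∞] 
    {x : M} (e : Module.Basis (Fin n) ℝ (V x)) :
    ∑ i, ExteriorAlgebra.ι ℝ (e i) * lam.onIns x (e.coord i) =
      (lam (eps m n V).toSX).1 x := by
  rw [(frameAt_isAt (m := m) (n := n) (V := V) x).self_of_nhds.sum_ι_mul e,
    Frame.apply_eps_eq_sum nab (frameAt_isAt x) lam.isTwisted]
  simp only [lam.onIns_dualSec nab]

variable {lam}

/-- The degree 1 part of λ(ε) = 0 is the combination of the s_j whose coefficients are the scalar
parts of the λ(i_{χ_j}). Linear independence of the s_j kills them. This gives the convention `L 1 =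
0`. -/
theorem proj_zero_onIns (nab : CovariantDerivative (𝓡 m) (EuclideanSpace ℝ (Fin n)) V)
    [CovariantDerivative.ContMDiffCovariantDerivative nab ∞] 
    (h0 : lam (eps m n V).toSX = 0) (x : M) (φ : Module.Dual ℝ (V x)) :
    proj 0 (lam.onIns x φ) = 0 := by
  set fr := frameAt m n V x
  have hx := (frameAt_isAt (m := m) (n := n) (V := V) x).self_of_nhds
  have h1 := Frame.apply_eps_eq_sum nab (frameAt_isAt x) lam.isTwisted
  rw [h0, coe_zero_apply] at h1
  have h2 := congrArg (proj 1) h1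
  rw [map_zero, map_sum] at h2
  simp only [proj_succ_ι_mul 0] at h2
  simp only [proj_zero_eq, ← Algebra.commutes, ← Algebra.smul_def, ← map_smul] at h2
  rw [← map_sum] at h2
  have h3 := (ExteriorAlgebra.ι_eq_zero_iff _).1 h2.symm
  have h4 : ∀ i, ExteriorAlgebra.algebraMapInv ((lam (ins (fr.χ i)).toSX).1 x) = 0 := by
    intro i
    have h5 := congrArg ((fr.χ i).toFun x) h3
    rw [map_sum, map_zero] at h5
    simpa [hx.dual_fibre, fr] using h5
  rw [onIns_apply, map_sum]
  refine Finset.sum_eq_zero fun j _ => ?_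
  rw [map_smul, proj_zero_eq, h4, map_zero, smul_zero]

theorem proj_zero_onCov (hodd : lam.IsOdd) (x : M) (v : TangentSpace (𝓡 m) x) :
    proj 0 (lam.onCov nab x v) = 0 := by
  rw [onCov_apply, map_sum]
  refine Finset.sum_eq_zero fun k _ => ?_
  rw [map_smul, proj_eq_zero_of_parity (by decide) (hodd _ (cov nab _) x), smul_zero]

/-- The tensor fields determined by an odd `1`-form that vanishes on the Euler field. -/
def data (hodd : lam.IsOdd) (h0 : lam (eps m n V).toSX = 0) : MonterdeData m n V where
  base := 0
  K k x := proj k ∘ₗ lam.onCov nab x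
  L
    | 0 => 0
    -- The index of `L` counts the factor V as well, so `L (k + 1)` is the degree k part of λ(i_χ).
    | k + 1 => fun x => proj k ∘ₗ lam.onIns x
  base_alternating _ _ := rfl
  base_smooth _ _ := contMDiff_const
  base_closed X Y Z x := by
    have h : ∀ (A B : VecField m M) (z : M) (w : TangentSpace (𝓡 m) z),
        mvfderiv (𝓡 m) (fun y : M => (0 : ∀ x : M, TangentSpace (𝓡 m) x →ₗ[ℝ]
          TangentSpace (𝓡 m) x →ₗ[ℝ] ℝ) y (A y) (B y)) z w = 0 := fun A B z w =>
      congrArg (fun l => l w) (dAt_const (m := m) z (0 : ℝ))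
    simp only [h]
    simp
  K_zero := funext fun x => LinearMap.ext fun v => proj_zero_onCov nab hodd x v
  K_degree _ _ _ := proj_mem _ _
  K_smooth k X := by
    have h := (pr k (lam (cov nab X).toSX)).2
    convert h using 1
    funext x
    exact congrArg (proj k) (lam.onCov_vecField nab X x)
  L_zero := rfl
  L_one := funext fun x => LinearMap.ext fun φ => proj_zero_onIns nab h0 x φ
  L_degree _ _ _ := proj_mem _ _
  L_smooth k χ := by
    cases k with
    | zero => exact (0 : SF m n V).2
    | succ k =>
      have h := (pr k (lam (ins χ).toSX)).2
      convert h using 1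
      funext x
      exact congrArg (proj k) (lam.onIns_dualSec nab χ x)
  L_symm k x e := by
    cases k with
    | zero => simp
    | succ k =>
      -- The required symmetry is the degree k + 1 part of λ(ε) = 0.
      have h := congrArg (proj (k + 1)) (lam.sum_ι_mul_onIns nab e)
      rw [h0, map_sum] at h
      simp only [proj_succ_ι_mul] at h
      exact h.trans (map_zero _)

end OneForm

variable (m n V) in
/-- The zero graded `2`-form. -/
def TwoForm.zero : TwoForm m n V where
  toMap := 0
  smul_left _ _ _ := (mul_zero _).symm
  smul_right _ _ _ a _ _ := by
    change (0 : SF m n V) = _ • (a * 0)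
    rw [mul_zero, smul_zero]
  alternating _ _ _ _ := by
    change (0 : SF m n V) = -(_ • 0)
    rw [smul_zero, neg_zero]

theorem OneForm.represents_data {lam : OneForm m n V} (hodd : lam.IsOdd)
    (h0 : lam (eps m n V).toSX = 0) {Ω : TwoForm m n V}
    (hΩ : ∀ {i j : ZMod 2} (D : HomDer m n V i) (D' : HomDer m n V j),
      Ω.toMap D.toSX D'.toSX = lam.d D D') : (OneForm.data nab hodd h0).Represents nab Ω := by
  refine ⟨TwoForm.zero m n V, lam, ?_, ?_, ?_, ?_⟩
  · intro X Y D D' _ _ x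
    exact (map_zero _).symm
  · intro X D hD x
    rw [hD.toSX_eq, ← lam.onCov_vecField nab, ← sum_proj_fibre (n := n) (lam.onCov nab x (X x)),
      Finset.range_eq_Ico, Finset.sum_eq_sum_Ico_succ_bot n.succ_pos,
      OneForm.proj_zero_onCov nab hodd, zero_add]
    rfl
  · intro χ D hD x
    rw [hD.toSX_eq, ← lam.onIns_dualSec nab, ← sum_proj_fibre (n := n) (lam.onIns x (χ.toFun x)),
      Finset.range_eq_Ico, Finset.sum_eq_sum_Ico_succ_bot n.succ_pos,
      OneForm.proj_zero_onIns nab h0, zero_add]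
    change ∑ k ∈ Finset.Ico 1 (n + 1), (OneForm.data nab hodd h0).L (k + 1) x (χ.toFun x) = _
    rw [Finset.sum_Ico_add' (fun k => (OneForm.data nab hodd h0).L k x (χ.toFun x))]
    rfl
  · intro i j D D'
    rw [hΩ]
    exact (zero_add _).symm

theorem MonterdeData.eq_of_fields {d d' : MonterdeData m n V} (hb : d.base = d'.base)
    (hK : d.K = d'.K) (hL : d.L = d'.L) : d = d' := by
  cases d
  cases d'
  simp only at hb hK hL
  subst hb hK hL
  rfl

namespace MonterdeData

theorem K_eq_zero_of_lt (d : MonterdeData m n V) {k : ℕ} (hk : n < k) (x : M)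
    (v : TangentSpace (𝓡 m) x) : d.K k x v = 0 := by
  rw [← proj_of_mem (d.K_degree k x v), proj_fibre_eq_zero hk]

theorem L_eq_zero_of_lt (d : MonterdeData m n V) {k : ℕ} (hk : n < k) (x : M)
    (φ : Module.Dual ℝ (V x)) : d.L (k + 1) x φ = 0 := by
  rw [← proj_of_mem (d.L_degree k x φ), proj_fibre_eq_zero hk]

theorem proj_sum_K (d : MonterdeData m n V) (k : ℕ) (x : M) (v : TangentSpace (𝓡 m) x) :
    proj k (∑ k ∈ Finset.Icc 1 n, d.K k x v) = d.K k x v := by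
  rw [proj_sum_of_mem fun k => d.K_degree k x v]
  split_ifs with h
  · rfl
  · rw [Finset.mem_Icc, not_and_or, not_le, not_le, Nat.lt_one_iff] at h
    rcases h with rfl | h
    · rw [d.K_zero]
      rfl
    · rw [d.K_eq_zero_of_lt h]

theorem proj_sum_L (d : MonterdeData m n V) (k : ℕ) (x : M) (φ : Module.Dual ℝ (V x)) :
    proj k (∑ k ∈ Finset.Icc 2 (n + 1), d.L k x φ) = d.L (k + 1) x φ := by
  have e : ∑ k ∈ Finset.Icc 2 (n + 1), d.L k x φ = ∑ k ∈ Finset.Ico 1 (n + 1), d.L (k + 1) x φ := by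
    rw [Finset.sum_Ico_add' (fun k => d.L k x φ)]
    rfl
  rw [e, proj_sum_of_mem fun k => d.L_degree k x φ]
  split_ifs with h
  · rfl
  · rw [Finset.mem_Ico, not_and_or, not_le, not_lt, Nat.lt_one_iff] at h
    rcases h with rfl | h
    · rw [zero_add, d.L_one]
      rfl
    · rw [d.L_eq_zero_of_lt h]

/-- By `Frame.IsAt.sum_ι_mul` the contraction is independent of the dual bases, so `L_symm` for any
one basis applies. -/
theorem sum_ι_mul_sum_L (d : MonterdeData m n V) {fr : Frame m n V} {x : M} (h : fr.IsAt x) :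
    ∑ j, ExteriorAlgebra.ι ℝ (fr.s j x) *
      ∑ k ∈ Finset.Icc 2 (n + 1), d.L k x ((fr.χ j).toFun x) = 0 := by
  have : Module.Finite ℝ (V x) := Module.Finite.equiv (fibreEquiv (n := n) x).symm
  simp only [Finset.mul_sum]
  rw [Finset.sum_comm]
  refine Finset.sum_eq_zero fun k _ => ?_
  rw [← h.sum_ι_mul (Module.finBasisOfFinrankEq ℝ (V x) (finrank_fibre x)), d.L_symm]

theorem projectsTo_eps : ProjectsTo (eps m n V) (0 : VecField m M) := by
  intro f x
  rw [Frame.eps_ofFun, ContMDiffSection.coe_zero, Pi.zero_apply, map_zero, map_zero]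
  rfl

theorem projectsTo_ins (χ : DualSec m n V) : ProjectsTo (ins χ) (0 : VecField m M) := by
  intro f x
  rw [Frame.ins_ofFun, ContMDiffSection.coe_zero, Pi.zero_apply, map_zero, map_zero]
  rfl

/-- Two triples of tensor fields representing the same graded `2`-form are equal. -/
theorem Represents.unique {d d' : MonterdeData m n V} {Ω : TwoForm m n V}
    (h : d.Represents nab Ω) (h' : d'.Represents nab Ω) : d = d' := by
  obtain ⟨η, lam, hη, hK, hL, hd⟩ := h
  obtain ⟨η', lam', hη', hK', hL', hd'⟩ := h'
  -- For every representing triple λ(ε) = 0 by `L_symm`, and the pullback vanishes on ε because ε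
  -- projects to the zero field. What remains is L_ε λ = ι_ε Ω, whose right-hand side does not
  -- involve the triple.
  have key : ∀ {d : MonterdeData m n V} {η : TwoForm m n V} {lam : OneForm m n V},
      IsPullback d.base η →
      (∀ (χ : DualSec m n V) (D : HomDer m n V 1), IsInsertion χ D →
        ∀ x, (lam D.toSX).1 x = ∑ k ∈ Finset.Icc 2 (n + 1), d.L k x (χ.toFun x)) →
      (∀ (i j : ZMod 2) (D : HomDer m n V i) (D' : HomDer m n V j),
        Ω.toMap D.toSX D'.toSX = η.toMap D.toSX D'.toSX + lam.d D D') →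
      ∀ {w : ℝ} {i : ZMod 2} {D : HomDer m n V i} {X : VecField m M}, HasWeight w D →
      ProjectsTo D X → ∀ k : ℕ, ((k : ℝ) - w) • pr k (lam D.toSX) =
        pr k (Ω.toMap (eps m n V).toSX D.toSX) := by
    intro d η lam hη hL hd w i D X hw hX k
    have h0 : lam (eps m n V).toSX = 0 := SF.ext fun x => by
      rw [Frame.apply_eps_eq_sum nab (frameAt_isAt x) lam.isTwisted]
      simp only [hL _ _ (isInsertion_ins _)]
      exact d.sum_ι_mul_sum_L (frameAt_isAt x).self_of_nhds
    have h1 : η.toMap (eps m n V).toSX D.toSX = 0 := SF.ext fun x => by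
      rw [hη 0 X _ _ projectsTo_eps hX, ContMDiffSection.coe_zero, Pi.zero_apply, map_zero,
        LinearMap.zero_apply, map_zero]
      rfl
    rw [hd, h1, zero_add, OneForm.d, h0, HomDer.map_zero, smul_zero, sub_zero, ← ad_toSX,
      ← OneForm.lieEps_apply, lam.pr_lieEps hw]
  have hcov : ∀ X, lam (cov nab X).toSX = lam' (cov nab X).toSX := by
    intro X
    have hX := (isCovariant_cov nab X).1
    refine SF.ext_pr fun k hk => ?_
    rcases Nat.eq_zero_or_pos k with rfl | hk0
    -- The eigenvalue is 0 here, so Ω gives no information; the component vanishes because `K`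
    -- starts in degree 1.
    · refine SF.ext fun x => ?_
      rw [coe_pr_apply, coe_pr_apply, hK _ _ (isCovariant_cov nab X),
        hK' _ _ (isCovariant_cov nab X), d.proj_sum_K, d'.proj_sum_K, d.K_zero, d'.K_zero]
    · have h1 := key hη hL hd (hasWeight_cov nab X) hX k
      rw [← key hη' hL' hd' (hasWeight_cov nab X) hX k, sub_zero] at h1
      exact smul_right_injective _ (Nat.cast_ne_zero.2 hk0.ne') h1
  have hins : ∀ χ, lam (ins χ).toSX = lam' (ins χ).toSX := by
    intro χ
    refine SF.ext_pr fun k hk => ?_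
    have h1 := key hη hL hd (hasWeight_ins χ) (projectsTo_ins χ) k
    rw [← key hη' hL' hd' (hasWeight_ins χ) (projectsTo_ins χ) k] at h1
    refine smul_right_injective _ ?_ h1
    have : (0 : ℝ) ≤ k := k.cast_nonneg
    linarith
  have hlam : lam = lam' := OneForm.ext_generators nab hcov hins
  subst hlam
  have hfr := fun x => (frameAt_isAt (m := m) (n := n) (V := V) x).self_of_nhds
  refine eq_of_fields ?_ ?_ ?_
  -- With equal λ the two pullbacks coincide. Values of the base forms are recovered by evaluating
  -- on covariant derivatives along fields extending `v` and `w`.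
  · refine funext fun x => LinearMap.ext fun v => LinearMap.ext fun w => ?_
    obtain ⟨X, rfl⟩ := exists_vecField x v _ (hfr x)
    obtain ⟨Y, rfl⟩ := exists_vecField x w _ (hfr x)
    have e1 := hη X Y (cov nab X).toSX (cov nab Y).toSX (isCovariant_cov nab X).1 (isCovariant_cov nab Y).1 x
    have e2 := hη' X Y (cov nab X).toSX (cov nab Y).toSX (isCovariant_cov nab X).1 (isCovariant_cov nab Y).1 x
    have e3 := hd _ _ (cov nab X) (cov nab Y)
    rw [hd', add_left_inj] at e3
    refine (ExteriorAlgebra.algebraMap_leftInverse (R := ℝ) (V x)).injective ?_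
    rw [← e1, ← e2]
    exact congrArg (fun c : SF m n V => c.1 x) e3.symm
  · refine funext fun k => funext fun x => LinearMap.ext fun v => ?_
    obtain ⟨X, rfl⟩ := exists_vecField x v _ (hfr x)
    rw [← d.proj_sum_K, ← d'.proj_sum_K, ← hK _ _ (isCovariant_cov nab X),
      ← hK' _ _ (isCovariant_cov nab X)]
  · refine funext fun k => funext fun x => LinearMap.ext fun φ => ?_
    cases k with
    | zero => rw [d.L_zero, d'.L_zero]
    | succ k =>
      rw [← (hfr x).sum_dual φ, map_sum, map_sum]
      refine Finset.sum_congr rfl fun j _ => ?_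
      rw [map_smul, map_smul, ← d.proj_sum_L, ← d'.proj_sum_L, ← hL _ _ (isInsertion_ins _),
        ← hL' _ _ (isInsertion_ins _)]

end MonterdeData

end Data

/-! ## The bundle isomorphism -/

section Scalar

theorem algebraMapInv_inv {W : Type*} [AddCommGroup W] [Module ℝ W] (y : ExteriorAlgebra ℝ W) :
    ExteriorAlgebra.algebraMapInv (inv y) = ExteriorAlgebra.algebraMapInv y := by
  have h : (ExteriorAlgebra.algebraMapInv (R := ℝ) (M := W)).comp inv =
      ExteriorAlgebra.algebraMapInv := by
    refine ExteriorAlgebra.hom_ext (LinearMap.ext fun w => ?_)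
    change ExteriorAlgebra.algebraMapInv (inv (ExteriorAlgebra.ι ℝ w)) =
      ExteriorAlgebra.algebraMapInv (ExteriorAlgebra.ι ℝ w)
    rw [inv_ι, map_neg]
    simp [ExteriorAlgebra.algebraMapInv]
  exact congrArg (fun g => g y) h

theorem ι_ιInv_of_mem_degree_one {W : Type*} [AddCommGroup W] [Module ℝ W]
    {y : ExteriorAlgebra ℝ W} (hy : y ∈ ⋀[ℝ]^1 W) :
    ExteriorAlgebra.ι ℝ (ExteriorAlgebra.ιInv y) = y := by
  rw [ExteriorAlgebra.exteriorPower, pow_one] at hy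
  obtain ⟨w, rfl⟩ := hy
  rw [ExteriorAlgebra.ι_leftInverse w]

variable {m n : ℕ} {M : Type*} [TopologicalSpace M] [T2Space M]
  [ChartedSpace (EuclideanSpace ℝ (Fin m)) M] [IsManifold (𝓡 m) ∞ M]
  {V : M → Type*} [TopologicalSpace (TotalSpace (EuclideanSpace ℝ (Fin n)) V)]
  [∀ x, AddCommGroup (V x)] [∀ x, Module ℝ (V x)] [∀ x, TopologicalSpace (V x)]
  [FiberBundle (EuclideanSpace ℝ (Fin n)) V]

/-- The degree zero part of a superfunction, as a function on `M`. -/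
def scalar (a : SF m n V) (x : M) : ℝ := ExteriorAlgebra.algebraMapInv (a.1 x)

theorem contMDiff_scalar (a : SF m n V) : ContMDiff (𝓡 m) 𝓘(ℝ, ℝ) ∞ (scalar a) := by
  intro x
  obtain ⟨b, hb, h⟩ := exists_mem_adjoin a x
  have h1 : ContMDiff (𝓡 m) 𝓘(ℝ, ℝ) ∞ (scalar b) := by
    clear h
    refine adjoin_superfunction_induction
      (motive := fun b => ContMDiff (𝓡 m) 𝓘(ℝ, ℝ) ∞ (scalar b)) ?fn ?sec ?add ?mul hb
    case fn =>
      intro f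
      have e : scalar (ofFun m n V f) = f := funext fun x =>
        ExteriorAlgebra.algebraMap_leftInverse (V x) (f x)
      rw [e]
      exact f.contMDiff
    case sec =>
      intro σ
      have e : scalar (ofSec m n V σ) = fun _ => 0 := funext fun x => by
        simp [scalar, ExteriorAlgebra.algebraMapInv]
      rw [e]
      exact contMDiff_const
    case add =>
      intro a b ha hb
      have e : scalar (a + b) = fun x => scalar a x + scalar b x := funext fun x =>
        map_add ExteriorAlgebra.algebraMapInv (a.1 x) (b.1 x)
      rw [e]
      exact ha.add hb
    case mul =>
      intro a b ha hb
      have e : scalar (a * b) = fun x => scalar a x * scalar b x := funext fun x =>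
        map_mul ExteriorAlgebra.algebraMapInv (a.1 x) (b.1 x)
      rw [e]
      exact ha.mul hb
  refine (h1 x).congr_of_eventuallyEq ?_
  filter_upwards [h] with y hy
  exact congrArg ExteriorAlgebra.algebraMapInv hy

theorem scalar_tw (i : ZMod 2) (a : SF m n V) (x : M) :
    ExteriorAlgebra.algebraMapInv ((tw i a).1 x) = scalar a x := by
  rcases zmod_two_cases i with rfl | rfl
  · rw [tw_zero, scalar]
  · rw [tw_one, coe_tau_apply, algebraMapInv_inv, scalar]

theorem scalar_eq_zero_of_odd {a : SF m n V} (ha : HasParity 1 a) (x : M) : scalar a x = 0 := by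
  have h := proj_eq_zero_of_parity (k := 0) (by decide) (ha x)
  rw [proj_zero_eq] at h
  exact (ExteriorAlgebra.algebraMap_leftInverse (R := ℝ) (V x)).injective (h.trans (map_zero _).symm)

end Scalar

/-! ### Smooth maps into the total space of a vector bundle -/

section TotalSpace

variable {m r : ℕ} {M : Type*} [TopologicalSpace M]
  [ChartedSpace (EuclideanSpace ℝ (Fin m)) M] [IsManifold (𝓡 m) ∞ M]
  {W : M → Type*} [TopologicalSpace (TotalSpace (EuclideanSpace ℝ (Fin r)) W)]
  [∀ x, AddCommGroup (W x)] [∀ x, Module ℝ (W x)] [∀ x, TopologicalSpace (W x)]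
  [FiberBundle (EuclideanSpace ℝ (Fin r)) W] [VectorBundle ℝ (EuclideanSpace ℝ (Fin r)) W]
  [ContMDiffVectorBundle ∞ (EuclideanSpace ℝ (Fin r)) W (𝓡 m)]
  {E : Type*} [NormedAddCommGroup E] [NormedSpace ℝ E] {H : Type*} [TopologicalSpace H]
  {J : ModelWithCorners ℝ E H} {N : Type*} [TopologicalSpace N] [ChartedSpace H N]

/-- Combinations of smooth sections with smooth coefficients are smooth. -/
theorem contMDiffAt_sum_smul_section {ι : Type*} [Fintype ι] {g : N → M} {p₀ : N}
    (hg : ContMDiffAt J (𝓡 m) ∞ g p₀) {a : ι → N → ℝ}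
    (ha : ∀ j, ContMDiffAt J 𝓘(ℝ, ℝ) ∞ (a j) p₀) (s : ι → Sec m r W) :
    ContMDiffAt J ((𝓡 m).prod 𝓘(ℝ, EuclideanSpace ℝ (Fin r))) ∞
      (fun p => (⟨g p, ∑ j, a j p • s j (g p)⟩ : TotalSpace (EuclideanSpace ℝ (Fin r)) W)) p₀ := by
  set t := trivializationAt (EuclideanSpace ℝ (Fin r)) W (g p₀)
  refine contMDiffAt_totalSpace.2 ⟨hg, ?_⟩
  have hs : ∀ j, ContMDiffAt J 𝓘(ℝ, EuclideanSpace ℝ (Fin r)) ∞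
      (fun p => (t ⟨g p, s j (g p)⟩).2) p₀ := fun j =>
    (contMDiffAt_totalSpace.1 (((s j).contMDiff (g p₀)).comp p₀ hg)).2
  have h : ContMDiffAt J 𝓘(ℝ, EuclideanSpace ℝ (Fin r)) ∞
      (fun p => ∑ j, a j p • (t ⟨g p, s j (g p)⟩).2) p₀ :=
    contMDiffAt_finsetSum fun j _ => (ha j).smul (hs j)
  refine h.congr_of_eventuallyEq ?_
  have hb : ∀ᶠ p in 𝓝 p₀, g p ∈ t.baseSet :=
    hg.continuousAt.eventually (t.open_baseSet.mem_nhds (mem_baseSet_trivializationAt _ W (g p₀)))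
  filter_upwards [hb] with p hp
  -- Over its base set the trivialization is linear on fibres, so it commutes with the combination.
  change (t.linear ℝ hp).mk' _ _ = ∑ j, a j p • (t.linear ℝ hp).mk' _ _
  rw [map_sum]
  simp only [map_smul]

end TotalSpace

/-! ### The degree one part of the primitive and nondegeneracy -/

section BundleIso

variable {m n : ℕ} {M : Type*} [TopologicalSpace M] [T2Space M]
  [ChartedSpace (EuclideanSpace ℝ (Fin m)) M] [IsManifold (𝓡 m) ∞ M]
  {V : M → Type*} [TopologicalSpace (TotalSpace (EuclideanSpace ℝ (Fin n)) V)]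
  [∀ x, AddCommGroup (V x)] [∀ x, Module ℝ (V x)] [∀ x, TopologicalSpace (V x)]
  [∀ x, IsTopologicalAddGroup (V x)] [∀ x, ContinuousSMul ℝ (V x)]
  [FiberBundle (EuclideanSpace ℝ (Fin n)) V] [VectorBundle ℝ (EuclideanSpace ℝ (Fin n)) V]
  [ContMDiffVectorBundle ∞ (EuclideanSpace ℝ (Fin n)) V (𝓡 m)]
  (nab : CovariantDerivative (𝓡 m) (EuclideanSpace ℝ (Fin n)) V)
  [CovariantDerivative.ContMDiffCovariantDerivative nab ∞]

/-- The evaluation of supervector fields at a superfunction, as a graded `1`-form. -/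
def OneForm.evalAt (b : SF m n V) : OneForm m n V where
  toFun D := D.1 b
  map_add' _ _ := rfl
  map_smul' _ _ := rfl

theorem exists_sec {x : M} {fr : Frame m n V} (h : fr.IsAt x) (w : V x) :
    ∃ σ : Sec m n V, σ x = w :=
  ⟨∑ j, (fr.χ j).toFun x w • fr.s j, by
    rw [coe_sum_sec]
    exact h.sum_fibre w⟩

theorem scalar_sum_mul {ι : Type*} [Fintype ι] {x : M} (y z : ι → ExteriorAlgebra ℝ (V x)) :
    ExteriorAlgebra.algebraMapInv (∑ k, y k * z k) =
      ∑ k, ExteriorAlgebra.algebraMapInv (y k) * ExteriorAlgebra.algebraMapInv (z k) := by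
  rw [map_sum]
  simp only [map_mul]

namespace TwoForm

variable {Ω : TwoForm m n V}

/-- The value of an odd Ω on two covariant derivatives is odd and has no scalar part. Modulo
nilpotents a covariant derivative therefore pairs only with insertions; `scalar_ins_right` is the
counterpart. -/
theorem scalar_cov_right (hodd : Ω.IsOdd) {fr : Frame m n V} {x : M}
    (hfr : ∀ᶠ y in 𝓝 x, fr.IsAt y) (X : VecField m M) (Y : SX m n V) :
    scalar (Ω.toMap (cov nab X).toSX Y) x = ∑ j, scalar (fr.coeffIns nab j Y.1) x *
      scalar (Ω.toMap (cov nab X).toSX (ins (fr.χ j)).toSX) x := by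
  have h0 : ∀ k, scalar (Ω.toMap (cov nab X).toSX (cov nab (fr.X k)).toSX) x = 0 := fun k =>
    scalar_eq_zero_of_odd (hodd _ _ (cov nab X) (cov nab (fr.X k))) x
  rw [scalar, Frame.apply_eq_sum nab hfr (Ω.isTwisted_right (cov nab X)), map_add, scalar_sum_mul,
    scalar_sum_mul]
  simp only [scalar_tw]
  simp only [scalar] at h0 ⊢
  simp only [h0, mul_zero, Finset.sum_const_zero, zero_add]

theorem scalar_ins_right (hodd : Ω.IsOdd) {fr : Frame m n V} {x : M}
    (hfr : ∀ᶠ y in 𝓝 x, fr.IsAt y) (χ : DualSec m n V) (Y : SX m n V) :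
    scalar (Ω.toMap (ins χ).toSX Y) x = ∑ k, scalar (Y.1 (ofFun m n V (fr.f k))) x *
      scalar (Ω.toMap (ins χ).toSX (cov nab (fr.X k)).toSX) x := by
  have h0 : ∀ j, scalar (Ω.toMap (ins χ).toSX (ins (fr.χ j)).toSX) x = 0 := fun j =>
    scalar_eq_zero_of_odd (hodd _ _ (ins χ) (ins (fr.χ j))) x
  rw [scalar, Frame.apply_eq_sum nab hfr (Ω.isTwisted_right (ins χ)), map_add, scalar_sum_mul,
    scalar_sum_mul]
  simp only [scalar_tw]
  simp only [scalar] at h0 ⊢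
  simp only [h0, mul_zero, Finset.sum_const_zero, add_zero]

end TwoForm

namespace OneForm

variable (lam : OneForm m n V)

/-- The degree one part of `v ↦ λ(∇_v)`, as a linear map into the fibre of `V`. -/
def anchor (x : M) : TangentSpace (𝓡 m) x →ₗ[ℝ] V x :=
  ExteriorAlgebra.ιInv ∘ₗ proj 1 ∘ₗ lam.onCov nab x

theorem ι_anchor (x : M) (v : TangentSpace (𝓡 m) x) :
    ExteriorAlgebra.ι ℝ (lam.anchor nab x v) = proj 1 (lam.onCov nab x v) :=
  ι_ιInv_of_mem_degree_one (proj_mem 1 _)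

variable {lam} {Ω : TwoForm m n V}

/-- At `∇_X` the operator L_ε has eigenvalue 1 in degree 1, so the degree 1 parts of λ and of L_ε λ
= ι_ε Ω agree there. Expanding ε = ∑ s_j i_{χ_j} leaves the scalar parts of Ω(i_{χ_j}, ∇_X) as
coefficients. -/
theorem anchor_eq_sum (h0 : lam (eps m n V).toSX = 0)
    (hΩ : ∀ {i j : ZMod 2} (D : HomDer m n V i) (D' : HomDer m n V j),
      Ω.toMap D.toSX D'.toSX = lam.d D D')
    {fr : Frame m n V} {x : M} (hfr : ∀ᶠ y in 𝓝 x, fr.IsAt y)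
    (X : VecField m M) : lam.anchor nab x (X x) =
      ∑ j, scalar (Ω.toMap (ins (fr.χ j)).toSX (cov nab X).toSX) x • fr.s j x := by
  refine (ExteriorAlgebra.ι_leftInverse (R := ℝ) (M := V x)).injective ?_
  have h1 : Ω.toMap (eps m n V).toSX (cov nab X).toSX = lam.lieEps (cov nab X).toSX := by
    rw [hΩ, OneForm.d, h0, HomDer.map_zero, smul_zero, sub_zero, ← ad_toSX, lieEps_apply]
  have h2 := lam.pr_lieEps (hasWeight_cov nab X) 1
  rw [Nat.cast_one, sub_zero, one_smul, ← h1] at h2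
  have h3 := Frame.apply_eps_eq_sum nab hfr (Ω.isTwisted_left (cov nab X).toSX)
  rw [ι_anchor, onCov_vecField, ← coe_pr_apply, ← h2, coe_pr_apply, h3, map_sum, map_sum]
  refine Finset.sum_congr rfl fun j _ => ?_
  rw [proj_succ_ι_mul 0, proj_zero_eq, ← Algebra.commutes, ← Algebra.smul_def, map_smul]
  rfl

theorem dual_anchor (h0 : lam (eps m n V).toSX = 0)
    (hΩ : ∀ {i j : ZMod 2} (D : HomDer m n V i) (D' : HomDer m n V j),
      Ω.toMap D.toSX D'.toSX = lam.d D D')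
    {fr : Frame m n V} {x : M} (hfr : ∀ᶠ y in 𝓝 x, fr.IsAt y)
    (X : VecField m M) (j : Fin n) : (fr.χ j).toFun x (lam.anchor nab x (X x)) =
      scalar (Ω.toMap (ins (fr.χ j)).toSX (cov nab X).toSX) x := by
  rw [anchor_eq_sum nab h0 hΩ hfr, map_sum]
  simp [hfr.self_of_nhds.dual_fibre]

/-- If K_1 kills `X x`, then Ω(∇_X, ·) has no scalar part at `x`. But D ↦ D f is a contraction of Ω
for every function f, so X f vanishes at `x` for all f, and `X x = 0`. -/
theorem injective_anchor (h0 : lam (eps m n V).toSX = 0)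
    (hΩ : ∀ {i j : ZMod 2} (D : HomDer m n V i) (D' : HomDer m n V j),
      Ω.toMap D.toSX D'.toSX = lam.d D D')
    (hodd : Ω.IsOdd) (hsurj : Function.Surjective Ω.contract) (x : M) :
    Function.Injective (lam.anchor nab x) := by
  refine (injective_iff_map_eq_zero _).2 fun v hv => ?_
  set fr := frameAt m n V x
  have hfr : ∀ᶠ y in 𝓝 x, fr.IsAt y := frameAt_isAt x
  obtain ⟨X, rfl⟩ := exists_vecField x v fr hfr.self_of_nhds
  have h1 : ∀ j, scalar (Ω.toMap (cov nab X).toSX (ins (fr.χ j)).toSX) x = 0 := by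
    intro j
    have h := dual_anchor nab h0 hΩ hfr X j
    rw [hv, map_zero] at h
    rw [Ω.alternating, zero_mul, sgn_zero, one_smul, scalar, coe_neg_apply, map_neg]
    exact neg_eq_zero.2 h.symm
  have h2 : ∀ f, dAt x f (X x) = 0 := by
    intro f
    obtain ⟨Y, hY⟩ := hsurj (OneForm.evalAt (ofFun m n V f))
    have h3 : -Ω.toMap (cov nab X).toSX Y = cov nab X (ofFun m n V f) :=
      LinearMap.congr_fun hY (cov nab X).toSX
    have h4 := congrArg (fun c => scalar c x) h3
    simp only [scalar, coe_neg_apply, map_neg, coe_cov_ofFun] at h4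
    rw [ExteriorAlgebra.algebraMap_leftInverse (V x)] at h4
    rw [← h4, neg_eq_zero]
    refine (Ω.scalar_cov_right nab hodd hfr X Y).trans ?_
    simp only [h1, mul_zero, Finset.sum_const_zero]
  rw [← hfr.self_of_nhds.sum_tangent (X x)]
  simp only [h2, zero_smul, Finset.sum_const_zero]

/-- Sections of `V` lift along the anchor, with smooth coefficients. -/
theorem exists_anchor_eq (h0 : lam (eps m n V).toSX = 0)
    (hΩ : ∀ {i j : ZMod 2} (D : HomDer m n V i) (D' : HomDer m n V j),
      Ω.toMap D.toSX D'.toSX = lam.d D D')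
    (hodd : Ω.IsOdd) (hsurj : Function.Surjective Ω.contract)
    (σ : Sec m n V) : ∃ Y : SX m n V, ∀ {fr : Frame m n V} {x : M}, (∀ᶠ y in 𝓝 x, fr.IsAt y) →
      lam.anchor nab x (∑ k, (-scalar (Y.1 (ofFun m n V (fr.f k))) x) • fr.X k x) = σ x := by
  -- The 1-form D ↦ D σ is ι_Y Ω. Comparing scalar parts at i_{χ_j} expresses χ_j(σ) through the
  -- scalar parts of Y f_k; the minus sign is that of `contract`, which is D ↦ -Ω(D, Y).
  obtain ⟨Y, hY⟩ := hsurj (OneForm.evalAt (ofSec m n V σ))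
  refine ⟨Y, fun {fr x} hfr => ?_⟩
  have hx := hfr.self_of_nhds
  rw [← hx.sum_fibre (σ x), ← hx.sum_fibre (lam.anchor nab x _)]
  refine Finset.sum_congr rfl fun j _ => ?_
  congr 1
  have h3 : -Ω.toMap (ins (fr.χ j)).toSX Y = ins (fr.χ j) (ofSec m n V σ) :=
    LinearMap.congr_fun hY (ins (fr.χ j)).toSX
  have h4 := congrArg (fun c => scalar c x) h3
  simp only [scalar, coe_neg_apply, map_neg, coe_ins_apply, coe_ofSec_apply, contr_ι] at h4
  rw [ExteriorAlgebra.algebraMap_leftInverse (V x)] at h4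
  rw [← h4, map_sum, map_sum]
  have h5 := Ω.scalar_ins_right nab hodd hfr (fr.χ j) Y
  rw [scalar] at h5
  rw [h5, ← Finset.sum_neg_distrib]
  refine Finset.sum_congr rfl fun k _ => ?_
  rw [map_smul, map_smul, dual_anchor nab h0 hΩ hfr, smul_eq_mul, neg_mul]

/-- Both the map and its inverse are combinations of frame sections whose coefficients are products
of smooth fibre coordinates with scalar parts of superfunctions. The inverse uses the preimages of
the frame sections from `exists_anchor_eq`, so no matrix is inverted and equality of the ranks `m`
and `n` is not needed beforehand. -/
theorem definesBundleIso_anchor (h0 : lam (eps m n V).toSX = 0)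
    (hΩ : ∀ {i j : ZMod 2} (D : HomDer m n V i) (D' : HomDer m n V j),
      Ω.toMap D.toSX D'.toSX = lam.d D D')
    (hodd : Ω.IsOdd) (hsurj : Function.Surjective Ω.contract) :
    DefinesBundleIso m n V (fun x => proj 1 ∘ₗ lam.onCov nab x) := by
  have hinj := injective_anchor nab h0 hΩ hodd hsurj
  choose Y hY using exists_anchor_eq nab h0 hΩ hodd hsurj
  have hsur : ∀ x, Function.Surjective (lam.anchor nab x) := by
    intro x w
    obtain ⟨σ, rfl⟩ := exists_sec (frameAt_isAt (m := m) (n := n) (V := V) x).self_of_nhds w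
    exact ⟨_, hY σ (frameAt_isAt x)⟩
  refine ⟨fun x => LinearEquiv.ofBijective (lam.anchor nab x) ⟨hinj x, hsur x⟩, ?_, ?_, ?_⟩
  · intro x v
    exact (lam.ι_anchor nab x v).symm
  · rintro ⟨x, v⟩
    set fr := frameAt m n V x
    have hfr : ∀ᶠ y in 𝓝 x, fr.IsAt y := frameAt_isAt x
    have hproj : ContMDiffAt (𝓡 m).tangent (𝓡 m) ∞
      (fun p : TangentBundle (𝓡 m) M => p.1) ⟨x, v⟩ := contMDiffAt_proj _
    have hsm := contMDiffAt_sum_smul_section (W := V) hproj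
      (a := fun j p => ∑ k, dAt p.1 (fr.f k) p.2 *
        scalar (Ω.toMap (ins (fr.χ j)).toSX (cov nab (fr.X k)).toSX) p.1)
      (fun j => contMDiffAt_finsetSum fun k _ =>
        (hfr.self_of_nhds.smooth_tangent v k).mul
          ((contMDiff_scalar _ x).comp (⟨x, v⟩ : TangentBundle (𝓡 m) M) hproj)) fr.s
    refine hsm.congr_of_eventuallyEq ?_
    filter_upwards [hproj.continuousAt.eventually (eventually_eventually_nhds.2 hfr)] with p hp
    refine congrArg (TotalSpace.mk p.1) ?_
    change lam.anchor nab p.1 p.2 = _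
    conv_lhs => rw [← hp.self_of_nhds.sum_tangent p.2]
    rw [map_sum]
    simp only [map_smul, anchor_eq_sum nab h0 hΩ hp, Finset.smul_sum, Finset.sum_smul, mul_smul]
    exact Finset.sum_comm
  · rintro ⟨x, w⟩
    set fr := frameAt m n V x
    have hfr : ∀ᶠ y in 𝓝 x, fr.IsAt y := frameAt_isAt x
    have hproj : ContMDiffAt ((𝓡 m).prod 𝓘(ℝ, EuclideanSpace ℝ (Fin n))) (𝓡 m) ∞
      (fun p : TotalSpace (EuclideanSpace ℝ (Fin n)) V => p.1) ⟨x, w⟩ := contMDiffAt_proj _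
    have hsm := contMDiffAt_sum_smul_section (W := (TangentSpace (𝓡 m) : M → Type _)) hproj
      (a := fun k p => ∑ j, (fr.χ j).toFun p.1 p.2 *
        -scalar ((Y (fr.s j)).1 (ofFun m n V (fr.f k))) p.1)
      (fun k => contMDiffAt_finsetSum fun j _ =>
        (hfr.self_of_nhds.smooth_fibre w j).mul
          ((contMDiff_scalar _ x).comp
            (⟨x, w⟩ : TotalSpace (EuclideanSpace ℝ (Fin n)) V) hproj).neg) fr.X
    refine hsm.congr_of_eventuallyEq ?_
    filter_upwards [hproj.continuousAt.eventually (eventually_eventually_nhds.2 hfr)] with p hp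
    refine congrArg (TotalSpace.mk p.1) ?_
    refine (LinearEquiv.symm_apply_eq _).2 ?_
    change p.2 = lam.anchor nab p.1 _
    conv_lhs => rw [← hp.self_of_nhds.sum_fibre p.2]
    have h : ∀ j, (fr.χ j).toFun p.1 p.2 • fr.s j p.1 = lam.anchor nab p.1
        (∑ k, ((fr.χ j).toFun p.1 p.2 * -scalar ((Y (fr.s j)).1 (ofFun m n V (fr.f k))) p.1) •
          fr.X k p.1) := by
      intro j
      simp only [mul_smul]
      rw [← Finset.smul_sum, map_smul, hY (fr.s j) hp]
    simp only [h, Finset.sum_smul]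
    rw [← map_sum, Finset.sum_comm]

end OneForm

end BundleIso

end OddSymplectic

end

/-! ### The main theorem -/

theorem mainTheorem4 (m n : ℕ) {M : Type*} [TopologicalSpace M] [T2Space M] [SigmaCompactSpace M]
    [ChartedSpace (EuclideanSpace ℝ (Fin m)) M] [IsManifold (𝓡 m) ∞ M]
    (V : M → Type*) [TopologicalSpace (TotalSpace (EuclideanSpace ℝ (Fin n)) V)]
    [∀ x, AddCommGroup (V x)] [∀ x, Module ℝ (V x)] [∀ x, TopologicalSpace (V x)]
    [∀ x, IsTopologicalAddGroup (V x)] [∀ x, ContinuousSMul ℝ (V x)]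
    [FiberBundle (EuclideanSpace ℝ (Fin n)) V] [VectorBundle ℝ (EuclideanSpace ℝ (Fin n)) V]
    [ContMDiffVectorBundle ∞ (EuclideanSpace ℝ (Fin n)) V (𝓡 m)]
    (nab : CovariantDerivative (𝓡 m) (EuclideanSpace ℝ (Fin n)) V)
    [CovariantDerivative.ContMDiffCovariantDerivative nab ∞]
    (Ω : OddSymplectic.TwoForm m n V) (hΩ : Ω.IsSymplectic) (hodd : Ω.IsOdd) :
    ∃ d : OddSymplectic.MonterdeData m n V,
      d.Represents nab Ω ∧
      (∀ d' : OddSymplectic.MonterdeData m n V, d'.Represents nab Ω → d' = d) ∧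
      d.base = 0 ∧ d.L 2 = 0 ∧ OddSymplectic.DefinesBundleIso m n V (d.K 1) := by
  obtain ⟨lam, hlam, h0, hd⟩ := OddSymplectic.TwoForm.exists_primitive nab hΩ.1 hodd
  have hrep := OddSymplectic.OneForm.represents_data nab hlam h0 hd
  refine ⟨OddSymplectic.OneForm.data nab hlam h0, hrep, fun d' h => h.unique nab hrep, rfl, ?_,
    OddSymplectic.OneForm.definesBundleIso_anchor nab h0 hd hodd hΩ.2.2⟩
  refine funext fun x => LinearMap.ext fun φ => ?_
  -- `L 2` is the degree 1 part of λ(i_χ), which is even because λ and i_χ are both odd.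
  change OddSymplectic.proj 1 (lam.onIns x φ) = 0
  rw [OddSymplectic.OneForm.onIns_apply, map_sum]
  refine Finset.sum_eq_zero fun j _ => ?_
  rw [map_smul, OddSymplectic.proj_eq_zero_of_parity (by decide)
    (hlam _ (OddSymplectic.ins _) x), smul_zero]
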